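/- Let $\Sigma\subset\mathbb R^3$ be a compact, closed, regular $C^2$-curve of length $L>0$ without self-intersections, and let $\sigma:\mathbb R\to\mathbb R^3$ be an $L$-periodic $C^2$ arc length parametrization of it ($|\dot\sigma|=1$, $\sigma$ injective on $[0,L)$). Let $L^2(\Sigma)$ be taken with respect to arc length $d\sigma$, and let $-\Delta$ be the free Laplacian in $L^2(\mathbb R^3)$ with domain $H^2(\mathbb R^3)$. For $h\in L^2(\Sigma)$ let $h\delta_\Sigma$ be the distribution $\varphi\mapsto\int_\Sigma h\varphi\,d\sigma$. For $\lambda<0$ let $\gamma_\lambda:L^2(\Sigma)\to L^2(\mathbb R^3)$ be the bounded operator $\gamma_\lambda h=(-\Delta-\lambda)^{-1}(h\delta_\Sigma)$, that is, $\gamma_\lambda h$ is the unique $u\in L^2(\mathbb R^3)$ with $-\Delta u-\lambda u=h\delta_\Sigma$ in the sense of distributions. Let $B_\lambda$ be the operator in $L^2(\Sigma)$ defined on all Lipschitz functions $h$ on $\Sigma$ by $$(B_\lambda h)(x)=\lim_{\delta\searrow0}\left[\int_{\Sigma\setminus I_\delta(x)}h(y)\frac{e^{-\sqrt{-\lambda}|x-y|}}{4\pi|x-y|}\,d\sigma(y)+h(x)\frac{\ln\delta}{2\pi}\right],\qquad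 x\in\Sigma,$$ where $I_\delta(\sigma(s_0))=\sigma((s_0-\delta,s_0+\delta))$, and let $\overline{B_\lambda}$ be its closure. For $u=u_c+\gamma_\lambda h$ with $u_c\in H^2(\mathbb R^3)$ and $h\in\operatorname{dom}\overline{B_\lambda}$ the generalized trace is $u|_\Sigma=u_c|_\Sigma+\overline{B_\lambda}h\in L^2(\Sigma)$, where $u_c|_\Sigma$ is the restriction of the continuous representative of $u_c$. For $\alpha\in\mathbb R\setminus\{0\}$ the operator $-\Delta_{\Sigma,\alpha}$ in $L^2(\mathbb R^3)$ is defined by $$-\Delta_{\Sigma,\alpha}u=-\Delta u-\tfrac1\alpha\,u|_\Sigma\cdot\delta_\Sigma$$ (in the sense of distributions) on the set of all $u=u_c+\gamma_\lambda h$ with $u_c\in H^2(\mathbb R^3)$, $h\in\operatorname{dom}\overline{B_\lambda}$ for which the right-hand side belongs to $L^2(\mathbb R^3)$; here $\lambda<0$ is arbitrary. **Theorem.** All these objects are well defined: the operators $\gamma_\lambda$ exist, functions in $H^2(\mathbb R^3)$ have a trace in $L^2(\Sigma)$, $B_\lambda$ is defined on all Lipschitz functions and is essentially selfadjoint, and $-\Delta_{\Sigma,\alpha}$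 is a single-valued operator that does not depend on the choice of $\lambda<0$ in its definition. For every $\alpha\in\mathbb R\setminus\{0\}$ the operator $-\Delta_{\Sigma,\alpha}$ is selfadjoint in $L^2(\mathbb R^3)$. Moreover: (i) For each $\lambda<0$ the operator $\gamma_\lambda$ is an isomorphism (a linear homeomorphism) from $\ker(\alpha-\overline{B_\lambda})$ onto $\ker(-\Delta_{\Sigma,\alpha}-\lambda)$. In particular, $\lambda\in\sigma_{\rm p}(-\Delta_{\Sigma,\alpha})$ if and only if $\alpha\in\sigma_{\rm p}(\overline{B_\lambda})$. (ii) The set $\rho(-\Delta_{\Sigma,\alpha})\cap(-\infty,0)$ is nonempty, and for each $\lambda$ in it $\lambda\in\rho(-\Delta)$, the operator $\alpha-\overline{B_\lambda}$ is boundedly invertible, and $$(-\Delta_{\Sigma,\alpha}-\lambda)^{-1}=(-\Delta-\lambda)^{-1}+\gamma_\lambda\bigl(\alpha-\overline{B_\lambda}\bigr)^{-1}\gamma_\lambda^*.$$ Furthermore, $-\Delta_{\Sigma,\alpha}$ converges to $-\Delta$ in the norm resolvent sense as $\alpha\to+\infty$: each $z\in\rho(-\Delta)$ belongs to $\rho(-\Delta_{\Sigma,\alpha})$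 for all sufficiently large $\alpha$, and $\|(-\Delta_{\Sigma,\alpha}-z)^{-1}-(-\Delta-z)^{-1}\|\to0$. (iii) For each $z\in\rho(-\Delta_{\Sigma,\alpha})\cap\rho(-\Delta)$ the resolvent difference $(-\Delta_{\Sigma,\alpha}-z)^{-1}-(-\Delta-z)^{-1}$ is compact, and $\sigma_{\rm ess}(-\Delta_{\Sigma,\alpha})=[0,\infty)$, where the essential spectrum is the complement in the spectrum of the isolated eigenvalues of finite multiplicity. -/

import Mathlib

open MeasureTheory Filter Topology Set TemperedDistribution
open scoped SchwartzMap Laplacian ENNReal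

noncomputable section

/-! ### Unbounded operators in a complex Hilbert space -/

namespace UnboundedOp

variable {H : Type*} [NormedAddCommGroup H] [InnerProductSpace ℂ H]

/-- The operator `A - z`, with the domain of `A`. -/
def subScalar (A : H →ₗ.[ℂ] H) (z : ℂ) : H →ₗ.[ℂ] H :=
  (-(z • (LinearMap.id : H →ₗ[ℂ] H))) +ᵥ A

/-- The operator `z - A`, with the domain of `A`. -/
def scalarSub (z : ℂ) (A : H →ₗ.[ℂ] H) : H →ₗ.[ℂ] H :=
  (z • (LinearMap.id : H →ₗ[ℂ] H)) +ᵥ (-A)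

/-- The kernel of an unbounded operator, as a subspace of the whole space. -/
def kernel (T : H →ₗ.[ℂ] H) : Submodule ℂ H :=
  (LinearMap.ker T.toFun).map T.domain.subtype

/-- `R` is an everywhere defined bounded operator and the two-sided inverse of `T`:
`u ∈ dom T` and `T u = v` if and only if `u = R v`. -/
def IsBoundedInverse (T : H →ₗ.[ℂ] H) (R : H →L[ℂ] H) : Prop :=
  ∀ u v : H, (u, v) ∈ T.graph ↔ u = R v

open Classical in
/-- The bounded inverse `T⁻¹` (it is unique if it exists; the value is `0` otherwise). -/
def boundedInverse (T : H →ₗ.[ℂ] H) : H →L[ℂ] H :=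
  if h : ∃ R, IsBoundedInverse T R then h.choose else 0

/-- The resolvent set `ρ(A)`. -/
def resolventSet (A : H →ₗ.[ℂ] H) : Set ℂ :=
  {z | ∃ R, IsBoundedInverse (subScalar A z) R}

/-- The resolvent `(A - z)⁻¹`, meaningful for `z ∈ ρ(A)`. -/
def resolvent (A : H →ₗ.[ℂ] H) (z : ℂ) : H →L[ℂ] H :=
  boundedInverse (subScalar A z)

/-- The spectrum `σ(A)`. -/
def spectrum (A : H →ₗ.[ℂ] H) : Set ℂ := (resolventSet A)ᶜ

/-- The point spectrum (the set of eigenvalues) `σ_p(A)`. -/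
def pointSpectrum (A : H →ₗ.[ℂ] H) : Set ℂ := {z | kernel (subScalar A z) ≠ ⊥}

/-- The discrete spectrum: eigenvalues of finite multiplicity that are isolated points of
the spectrum. -/
def discreteSpectrum (A : H →ₗ.[ℂ] H) : Set ℂ :=
  {z | z ∈ pointSpectrum A ∧ FiniteDimensional ℂ (kernel (subScalar A z)) ∧
    ∃ ε > 0, ∀ w ∈ spectrum A, w ≠ z → ε ≤ ‖w - z‖}

/-- The essential spectrum of a selfadjoint operator. -/
def essentialSpectrum (A : H →ₗ.[ℂ] H) : Set ℂ := spectrum A \ discreteSpectrum A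

/-- Convergence in the norm resolvent sense: each `z ∈ ρ(A₀)` eventually belongs to `ρ(A i)`,
and the resolvents at `z` converge in operator norm. -/
def NormResolventTendsto {ι : Type*} (A : ι → H →ₗ.[ℂ] H) (l : Filter ι)
    (A₀ : H →ₗ.[ℂ] H) : Prop :=
  ∀ z ∈ resolventSet A₀, (∀ᶠ i in l, z ∈ resolventSet (A i)) ∧
    Tendsto (fun i => resolvent (A i) z) l (𝓝 (resolvent A₀ z))

end UnboundedOp

/-! ### The free Laplacian in `L²(ℝ³)` -/

/-- Euclidean three-space. -/
abbrev E3 : Type := EuclideanSpace ℝ (Fin 3)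

/-- The complex Hilbert space `L²(ℝ³)`. -/
abbrev L2E3 : Type := Lp ℂ 2 (volume : Measure E3)

/-- The Sobolev space `H²(ℝ³)` as a subspace of `L²(ℝ³)`. -/
def sobolevH2 : Submodule ℂ L2E3 where
  carrier := {u | MemSobolev 2 2 (u : 𝓢'(E3, ℂ))}
  add_mem' := by
    intro u v hu hv
    have := MemSobolev.add hu hv
    simpa only [mem_ofPred_eq, ← Lp.toTemperedDistributionCLM_apply, map_add] using this
  zero_mem' := by
    have := memSobolev_fun_zero E3 ℂ 2 2
    simpa only [mem_ofPred_eq, ← Lp.toTemperedDistributionCLM_apply, map_zero] using this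
  smul_mem' := by
    intro c u hu
    have := MemSobolev.smul c hu
    simpa only [mem_ofPred_eq, ← Lp.toTemperedDistributionCLM_apply, map_smul] using this

theorem exists_laplacian_of_mem_sobolevH2 {u : L2E3} (hu : u ∈ sobolevH2) :
    ∃ f : L2E3, (f : 𝓢'(E3, ℂ)) = -Δ (u : 𝓢'(E3, ℂ)) := by
  have h : MemSobolev (2 - 2) 2 (Δ (u : 𝓢'(E3, ℂ))) := MemSobolev.laplacian hu
  rw [sub_self, memSobolev_zero_iff] at h
  obtain ⟨f, hf⟩ := h
  refine ⟨-f, ?_⟩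
  rw [hf, ← Lp.toTemperedDistributionCLM_apply, ← Lp.toTemperedDistributionCLM_apply, map_neg]

theorem toTemperedDistribution_injective :
    Function.Injective (Lp.toTemperedDistributionCLM ℂ (volume : Measure E3) 2) :=
  LinearMap.ker_eq_bot.mp Lp.ker_toTemperedDistributionCLM_eq_bot

/-- The free Laplacian `-Δ` in `L²(ℝ³)` with domain `H²(ℝ³)`; `-Δ u` is the element of
`L²(ℝ³)` that represents the distribution `-Δ u`. -/
def freeLaplacian : L2E3 →ₗ.[ℂ] L2E3 where
  domain := sobolevH2
  toFun :=
    { toFun := fun u => (exists_laplacian_of_mem_sobolevH2 u.2).choose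
      map_add' := by
        intro u v
        apply toTemperedDistribution_injective
        rw [map_add]
        simp only [Lp.toTemperedDistributionCLM_apply]
        rw [(exists_laplacian_of_mem_sobolevH2 u.2).choose_spec,
          (exists_laplacian_of_mem_sobolevH2 v.2).choose_spec,
          (exists_laplacian_of_mem_sobolevH2 (u + v).2).choose_spec]
        simp only [← Lp.toTemperedDistributionCLM_apply, ← laplacianCLM_apply, map_add,
          Submodule.coe_add, neg_add]
      map_smul' := by
        intro c u
        apply toTemperedDistribution_injective
        rw [map_smul]
        simp only [Lp.toTemperedDistributionCLM_apply]
        rw [(exists_laplacian_of_mem_sobolevH2 u.2).choose_spec,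
          (exists_laplacian_of_mem_sobolevH2 (c • u).2).choose_spec]
        simp only [← Lp.toTemperedDistributionCLM_apply, ← laplacianCLM_apply, map_smul,
          Submodule.coe_smul, smul_neg, RingHom.id_apply] }

/-! ### Closed curves and the `δ`-interaction -/

/-- A compact, closed, regular `C²`-curve in `ℝ³` without self-intersections, given by the
`L`-periodic extension of an arc length parametrization on `[0, L]`. -/
structure ClosedCurve where
  /-- the length -/
  L : ℝ
  /-- the `L`-periodic arc length parametrization -/
  σ : ℝ → E3
  L_pos : 0 < L
  contDiff : ContDiff ℝ 2 σ
  periodic : Function.Periodic σ L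
  norm_deriv : ∀ s, ‖deriv σ s‖ = 1
  injOn : InjOn σ (Ico 0 L)

namespace ClosedCurve

variable (C : ClosedCurve)

/-- The curve `Σ` as a subset of `ℝ³`. -/
def carrier : Set E3 := range C.σ

/-- The arc length measure on `Σ`, as a measure on `ℝ³`. -/
def arcLength : Measure E3 := (volume.restrict (Ico 0 C.L)).map C.σ

instance : IsFiniteMeasure C.arcLength := by
  unfold arcLength; infer_instance

/-- The complex Hilbert space `L²(Σ)`. -/
abbrev L2 : Type := Lp ℂ 2 C.arcLength

/-- The distribution `h δ_Σ`, that is `φ ↦ ∫_Σ h φ dσ`. -/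
def deltaDist (h : C.L2) : 𝓢'(E3, ℂ) := h

/-- `u ∈ L²(ℝ³)` satisfies `(-Δ - lam) u = h δ_Σ` in the sense of distributions. -/
def Solves (lam : ℝ) (h : C.L2) (u : L2E3) : Prop :=
  -Δ (u : 𝓢'(E3, ℂ)) - (lam : ℂ) • (u : 𝓢'(E3, ℂ)) = C.deltaDist h

open Classical in
/-- The bounded operator `γ_lam : L²(Σ) → L²(ℝ³)`, `γ_lam h = (-Δ - lam)⁻¹ (h δ_Σ)`,
meaningful for `lam < 0`. -/
def gammaField (lam : ℝ) : C.L2 →L[ℂ] L2E3 :=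
  if hG : ∃ G : C.L2 →L[ℂ] L2E3, ∀ h, C.Solves lam h (G h) then hG.choose else 0

/-- `t ∈ L²(Σ)` is the restriction to `Σ` of the continuous representative of `u`. -/
def IsTrace (u : L2E3) (t : C.L2) : Prop :=
  ∃ g : E3 → ℂ, Continuous g ∧ u =ᵐ[volume] g ∧ t =ᵐ[C.arcLength] g

/-- The open arc of length `2δ` centred at `σ(s₀)`. -/
def arc (s₀ δ : ℝ) : Set E3 := C.σ '' Ioo (s₀ - δ) (s₀ + δ)

/-- The integral kernel `exp(-√(-lam) |x - y|) / (4π |x - y|)`. -/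
def kern (lam : ℝ) (x y : E3) : ℂ :=
  ((Real.exp (-(Real.sqrt (-lam) * ‖x - y‖)) / (4 * Real.pi * ‖x - y‖) : ℝ) : ℂ)

/-- `f` is Lipschitz continuous on `Σ`. -/
def IsLipschitz (f : E3 → ℂ) : Prop := ∃ K, LipschitzOnWith K f C.carrier

/-- On `Σ`, the function `k` is the regularized potential of `f`: for `x = σ(s)`,
`k x = lim_{δ ↘ 0} (∫_{Σ \ I_δ(x)} f(y) kern(x, y) dσ(y) + f(x) ln δ / (2π))`. -/
def IsRegularizedPotential (lam : ℝ) (f k : E3 → ℂ) : Prop :=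
  ∀ s : ℝ,
    (∀ δ > 0, IntegrableOn (fun y => f y * kern lam (C.σ s) y)
      (C.carrier \ C.arc s δ) C.arcLength) ∧
    Tendsto (fun δ : ℝ =>
      (∫ y in C.carrier \ C.arc s δ, f y * kern lam (C.σ s) y ∂C.arcLength) +
        f (C.σ s) * ((Real.log δ / (2 * Real.pi) : ℝ) : ℂ))
      (𝓝[>] 0) (𝓝 (k (C.σ s)))

theorem IsRegularizedPotential.add {C : ClosedCurve} {lam : ℝ} {f f' k k' : E3 → ℂ}
    (h : C.IsRegularizedPotential lam f k) (h' : C.IsRegularizedPotential lam f' k') :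
    C.IsRegularizedPotential lam (f + f') (k + k') := by
  intro s
  refine ⟨fun δ hδ => ?_, ?_⟩
  · have := ((h s).1 δ hδ).add ((h' s).1 δ hδ)
    refine this.congr (ae_of_all _ fun y => ?_)
    simp [add_mul]
  · refine ((h s).2.add (h' s).2).congr' ?_
    filter_upwards [self_mem_nhdsWithin] with δ hδ
    have := integral_add ((h s).1 δ hδ) ((h' s).1 δ hδ)
    simp only [Pi.add_apply, add_mul]
    rw [this]
    ring

theorem IsRegularizedPotential.smul {C : ClosedCurve} {lam : ℝ} {f k : E3 → ℂ} (c : ℂ)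
    (h : C.IsRegularizedPotential lam f k) :
    C.IsRegularizedPotential lam (c • f) (c • k) := by
  intro s
  refine ⟨fun δ hδ => ?_, ?_⟩
  · have := ((h s).1 δ hδ).const_mul c
    refine this.congr (ae_of_all _ fun y => ?_)
    simp [mul_assoc]
  · refine ((h s).2.const_mul c).congr fun δ => ?_
    simp only [Pi.smul_apply, smul_eq_mul, mul_assoc]
    rw [integral_const_mul]
    ring

theorem IsRegularizedPotential.zero {C : ClosedCurve} {lam : ℝ} :
    C.IsRegularizedPotential lam 0 0 := by
  intro s
  simp

/-- The graph of `B_lam`: pairs `(h, B_lam h)` with `h ∈ C^{0,1}(Σ)`. -/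
def traceGraph (lam : ℝ) : Submodule ℂ (C.L2 × C.L2) where
  carrier := {p | ∃ f k : E3 → ℂ, C.IsLipschitz f ∧ p.1 =ᵐ[C.arcLength] f ∧
    p.2 =ᵐ[C.arcLength] k ∧ C.IsRegularizedPotential lam f k}
  add_mem' := by
    rintro p q ⟨f, k, ⟨K, hK⟩, h1, h2, h3⟩ ⟨f', k', ⟨K', hK'⟩, h1', h2', h3'⟩
    exact ⟨f + f', k + k', ⟨K + K', hK.add hK'⟩, (Lp.coeFn_add _ _).trans (h1.add h1'),
      (Lp.coeFn_add _ _).trans (h2.add h2'), h3.add h3'⟩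
  zero_mem' := ⟨0, 0, ⟨0, (LipschitzWith.const 0).lipschitzOnWith⟩,
    Lp.coeFn_zero _ _ _, Lp.coeFn_zero _ _ _, .zero⟩
  smul_mem' := by
    rintro c p ⟨f, k, ⟨K, hK⟩, h1, h2, h3⟩
    refine ⟨c • f, c • k, ⟨‖c‖₊ * K, ?_⟩, (Lp.coeFn_smul _ _).trans (h1.const_smul c),
      (Lp.coeFn_smul _ _).trans (h2.const_smul c), h3.smul c⟩
    exact (lipschitzWith_smul c).comp_lipschitzOnWith hK

/-- The operator `B_lam` in `L²(Σ)` on Lipschitz functions. -/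
def traceOp (lam : ℝ) : C.L2 →ₗ.[ℂ] C.L2 := (C.traceGraph lam).toLinearPMap

/-- The closure of `B_lam`. -/
def traceOpClosure (lam : ℝ) : C.L2 →ₗ.[ℂ] C.L2 := (C.traceOp lam).closure

/-- Two continuous functions on `Σ` that agree almost everywhere agree on `Σ`. -/
theorem eqOn_of_ae_eq {f g : E3 → ℂ} (hf : ContinuousOn f C.carrier)
    (hg : ContinuousOn g C.carrier) (h : f =ᵐ[C.arcLength] g) : EqOn f g C.carrier := by
  have hσ : Continuous C.σ := C.contDiff.continuous
  have h1 : (f ∘ C.σ) =ᵐ[volume.restrict (Icc 0 C.L)] (g ∘ C.σ) := by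
    rw [← restrict_Ico_eq_restrict_Icc]
    exact ae_of_ae_map hσ.aemeasurable h
  have hfc : Continuous (f ∘ C.σ) := hf.comp_continuous hσ fun s => mem_range_self s
  have hgc : Continuous (g ∘ C.σ) := hg.comp_continuous hσ fun s => mem_range_self s
  have h2 := Measure.eqOn_Icc_of_ae_eq volume C.L_pos.ne h1 hfc.continuousOn hgc.continuousOn
  rintro _ ⟨s, rfl⟩
  obtain ⟨t, ht, hst⟩ := C.periodic.exists_mem_Ico₀ C.L_pos s
  rw [hst]
  exact h2 (Ico_subset_Icc_self ht)

/-- `B_lam` is single-valued. -/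
theorem traceOp_graph (lam : ℝ) : (C.traceOp lam).graph = C.traceGraph lam := by
  apply Submodule.toLinearPMap_graph_eq
  rintro ⟨h, k'⟩ ⟨f, k, ⟨K, hK⟩, h1, h2, h3⟩ (rfl : h = 0)
  have hf : EqOn f 0 C.carrier :=
    C.eqOn_of_ae_eq hK.continuousOn continuousOn_const
      (h1.symm.trans (Lp.coeFn_zero _ _ _))
  have hmeas : ∀ᵐ y ∂C.arcLength, y ∈ C.carrier := by
    have hσ : Continuous C.σ := C.contDiff.continuous
    have : MeasurableSet C.carrier := by
      have : C.carrier = C.σ '' Icc 0 C.L := by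
        refine subset_antisymm ?_ (image_subset_range _ _)
        rintro _ ⟨s, rfl⟩
        obtain ⟨t, ht, hst⟩ := C.periodic.exists_mem_Ico₀ C.L_pos s
        exact ⟨t, Ico_subset_Icc_self ht, hst.symm⟩
      rw [this]
      exact (isCompact_Icc.image hσ).measurableSet
    exact (ae_map_iff hσ.aemeasurable this).2 (ae_of_all _ fun s => mem_range_self s)
  have hk : ∀ s, k (C.σ s) = 0 := by
    intro s
    refine tendsto_nhds_unique (h3 s).2 (tendsto_const_nhds.congr fun δ => ?_)
    rw [hf (mem_range_self s), integral_eq_zero_of_ae]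
    · simp
    · refine ae_restrict_of_ae ?_
      filter_upwards [hmeas] with y hy
      simp [hf hy]
  rw [Lp.eq_zero_iff_ae_eq_zero]
  refine h2.trans ?_
  filter_upwards [hmeas] with y hy
  obtain ⟨s, rfl⟩ := hy
  exact hk s

/-- `t` is the generalized trace `u|_Σ` of `u = u_c + γ_lam h`, where `u_c ∈ H²(ℝ³)` and
`h ∈ dom (closure of B_lam)`: `t = u_c|_Σ + (closure of B_lam) h`. -/
def IsGenTrace (lam : ℝ) (u : L2E3) (t : C.L2) : Prop :=
  ∃ u_c ∈ sobolevH2, ∃ h : (C.traceOpClosure lam).domain, ∃ t_c : C.L2,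
    C.IsTrace u_c t_c ∧ u = u_c + C.gammaField lam h ∧ t = t_c + C.traceOpClosure lam h

/-- `f ∈ L²(ℝ³)` equals `𝒜_α u = -Δ u - (1/α) u|_Σ δ_Σ`, where the generalized trace is taken
with respect to the decomposition with parameter `lam`. -/
def IsDeltaAction (lam α : ℝ) (u f : L2E3) : Prop :=
  ∃ t : C.L2, C.IsGenTrace lam u t ∧
    (f : 𝓢'(E3, ℂ)) = -Δ (u : 𝓢'(E3, ℂ)) - ((1 / α : ℝ) : ℂ) • C.deltaDist t

theorem IsTrace.add {C : ClosedCurve} {u v : L2E3} {t t' : C.L2} (h : C.IsTrace u t)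
    (h' : C.IsTrace v t') : C.IsTrace (u + v) (t + t') := by
  obtain ⟨g, hg, h1, h2⟩ := h
  obtain ⟨g', hg', h1', h2'⟩ := h'
  exact ⟨g + g', hg.add hg', (Lp.coeFn_add _ _).trans (h1.add h1'),
    (Lp.coeFn_add _ _).trans (h2.add h2')⟩

theorem IsTrace.smul {C : ClosedCurve} {u : L2E3} {t : C.L2} (c : ℂ) (h : C.IsTrace u t) :
    C.IsTrace (c • u) (c • t) := by
  obtain ⟨g, hg, h1, h2⟩ := h
  exact ⟨c • g, hg.const_smul c, (Lp.coeFn_smul _ _).trans (h1.const_smul c),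
    (Lp.coeFn_smul _ _).trans (h2.const_smul c)⟩

theorem IsTrace.zero {C : ClosedCurve} : C.IsTrace 0 0 :=
  ⟨0, continuous_const, Lp.coeFn_zero _ _ _, Lp.coeFn_zero _ _ _⟩

/-- The graph of `-Δ_{Σ,α}`: all pairs `(u, 𝒜_α u)` for which the generalized trace of `u` is
defined and `𝒜_α u` belongs to `L²(ℝ³)`. -/
def deltaGraph (lam α : ℝ) : Submodule ℂ (L2E3 × L2E3) where
  carrier := {p | C.IsDeltaAction lam α p.1 p.2}
  add_mem' := by
    rintro ⟨u, f⟩ ⟨v, g⟩ ⟨t, ⟨uc, huc, h, tc, h1, h2, h3⟩, h4⟩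
      ⟨t', ⟨uc', huc', h', tc', h1', h2', h3'⟩, h4'⟩
    refine ⟨t + t', ⟨uc + uc', sobolevH2.add_mem huc huc', h + h', tc + tc', h1.add h1', ?_, ?_⟩,
      ?_⟩
    · simp only at h2 h2'
      simp only [Prod.mk_add_mk, h2, h2', Submodule.coe_add, map_add]
      abel
    · rw [h3, h3', LinearPMap.map_add]
      abel
    · simp only [deltaDist, ← Lp.toTemperedDistributionCLM_apply, ← laplacianCLM_apply]
        at h4 h4' ⊢
      simp only [Prod.mk_add_mk, map_add, h4, h4', smul_add]
      abel
  zero_mem' := by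
    refine ⟨0, ⟨0, sobolevH2.zero_mem, 0, 0, .zero, ?_, ?_⟩, ?_⟩
    · simp
    · simp [LinearPMap.map_zero]
    · simp only [deltaDist, ← Lp.toTemperedDistributionCLM_apply, ← laplacianCLM_apply,
        Prod.fst_zero, Prod.snd_zero, map_zero, neg_zero]
      ext φ
      change (0 : ℂ) = 0 - ((1 / α : ℝ) : ℂ) • (0 : ℂ)
      rw [smul_zero, sub_zero]
  smul_mem' := by
    rintro c ⟨u, f⟩ ⟨t, ⟨uc, huc, h, tc, h1, h2, h3⟩, h4⟩
    refine ⟨c • t, ⟨c • uc, sobolevH2.smul_mem c huc, c • h, c • tc, h1.smul c, ?_, ?_⟩, ?_⟩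
    · simp only at h2
      simp only [Prod.smul_mk, h2, Submodule.coe_smul, map_smul, smul_add]
    · rw [h3, LinearPMap.map_smul, smul_add]
    · simp only [deltaDist, ← Lp.toTemperedDistributionCLM_apply, ← laplacianCLM_apply] at h4 ⊢
      simp only [Prod.smul_mk, map_smul, h4, smul_sub, smul_neg]
      rw [smul_comm c]

/-- The Schrödinger operator `-Δ_{Σ,α}` with `δ`-interaction of strength `1/α` supported on `Σ`,
built with the auxiliary parameter `lam < 0`. -/
def deltaOp (lam α : ℝ) : L2E3 →ₗ.[ℂ] L2E3 := (C.deltaGraph lam α).toLinearPMap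

end ClosedCurve

end

noncomputable section

/-! ### Graphs, inverses and resolvents of unbounded operators -/

namespace UnboundedOp

section Graph

variable {H : Type*} [NormedAddCommGroup H] [InnerProductSpace ℂ H]

/-! The interaction is a singular perturbation of the free Laplacian, and the theorem follows from
Krein's resolvent formula once the boundary operator is understood. Unbounded operators are handled
through their graphs throughout.

Free side. In Fourier space (-Δ - λ)⁻¹ is multiplication by (4π²|ξ|² - λ)⁻¹, which is square
integrable on ℝ³. Hence the value of (-Δ - λ)⁻¹f at x is the inner product of f with a vector
`greenVec lam x` of L² that depends continuously on x. This yields the traces on Σ, identifies γ_λ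
as the adjoint of f ↦ ((-Δ - λ)⁻¹f)|_Σ, and makes that map compact.

Krein's formula. Since Σ is a Lebesgue null set, a distribution hδ_Σ that lies in L²(ℝ³) vanishes
(`eq_zero_of_coe_eq_deltaDist`). Separating the L² part of -Δ_{Σ,α}u = f from its part on Σ turns it
into (α - B)h = γ_λ*(f - λu) and u = (-Δ - λ)⁻¹(f - λu) + γ_λh, with B the closure of B_λ
(`isDeltaAction_iff`). The correspondence of kernels and the resolvent formula can be read off from
this.

Boundary operator. Because Σ is C², the kernel differs from 1/(4πd), with d the distance along Σ, by
a bounded symmetric kernel. The regularized operator with kernel 1/(4πd) commutes with rotations of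
the circle, so it is diagonal in the Fourier basis; B_λ, being symmetric and diagonal plus bounded
on characters, is essentially selfadjoint. Symmetrizing gives ⟨h, B_λh⟩ = -½∬|h(x) - h(y)|² k(x, y)
+ ∫V_λ|h|², where k is the kernel and V_λ = B_λ1, and V_λ tends to -∞ uniformly as λ → -∞
(`exists_lam_forall_potentialOne_le`). So for very negative λ the operator α - B is strictly
positive; Krein's formula then supplies a selfadjoint resolvent at a real point, and -Δ_{Σ,α} is
selfadjoint. At fixed λ the inverse of α - B has norm at most 1/(α - β), with β an upper bound of B,
which gives the norm resolvent limit.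

Change of parameter. On Lipschitz functions B_λ - B_μ = (λ - μ)γ_λ*γ_μ. For the kernels this says
that a difference of two Yukawa potentials is the Fourier transform of a product of two symbols,
which is proved by writing both as Laplace transforms of the heat kernel. The identity yields
independence of λ; since the difference is compact, the Fredholm alternative carries invertibility
of α - B to every negative point of the resolvent set.

Essential spectrum. The resolvent difference is compact, so off [0,∞) the spectrum of -Δ_{Σ,α} is
discrete, while singular sequences of -Δ remain singular for the perturbed operator. -/

theorem mem_graph_subScalar {A : H →ₗ.[ℂ] H} {z : ℂ} {u v : H} :
    (u, v) ∈ (subScalar A z).graph ↔ (u, v + z • u) ∈ A.graph := by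
  rw [LinearPMap.mem_graph_iff, LinearPMap.mem_graph_iff]
  constructor
  · rintro ⟨y, rfl, rfl⟩
    refine ⟨y, rfl, ?_⟩
    change A y = -(z • (y : H)) + A y + z • (y : H)
    abel
  · rintro ⟨y, rfl, h⟩
    refine ⟨y, rfl, ?_⟩
    change -(z • (y : H)) + A y = v
    rw [h]
    simp

theorem mem_graph_scalarSub {A : H →ₗ.[ℂ] H} {z : ℂ} {u v : H} :
    (u, v) ∈ (scalarSub z A).graph ↔ (u, z • u - v) ∈ A.graph := by
  rw [LinearPMap.mem_graph_iff, LinearPMap.mem_graph_iff]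
  constructor
  · rintro ⟨y, rfl, rfl⟩
    refine ⟨y, rfl, ?_⟩
    change A y = z • (y : H) - (z • (y : H) + -A y)
    abel
  · rintro ⟨y, rfl, h⟩
    refine ⟨y, rfl, ?_⟩
    change z • (y : H) + -A y = v
    rw [h]
    simp

theorem mem_kernel {T : H →ₗ.[ℂ] H} {u : H} : u ∈ kernel T ↔ (u, 0) ∈ T.graph := by
  rw [kernel, LinearPMap.mem_graph_iff, Submodule.mem_map]
  constructor
  · rintro ⟨y, hy, rfl⟩
    exact ⟨y, rfl, hy⟩
  · rintro ⟨y, rfl, hy⟩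
    exact ⟨y, hy, rfl⟩

theorem IsBoundedInverse.eq {T : H →ₗ.[ℂ] H} {R R' : H →L[ℂ] H} (h : IsBoundedInverse T R)
    (h' : IsBoundedInverse T R') : R = R' := by
  ext v
  exact (h' _ _).1 ((h _ _).2 rfl)

theorem IsBoundedInverse.boundedInverse_eq {T : H →ₗ.[ℂ] H} {R : H →L[ℂ] H}
    (h : IsBoundedInverse T R) : boundedInverse T = R := by
  have hex : ∃ R, IsBoundedInverse T R := ⟨R, h⟩
  rw [boundedInverse, dif_pos hex]
  exact hex.choose_spec.eq h

theorem IsBoundedInverse.apply_eq_zero {T : H →ₗ.[ℂ] H} {R : H →L[ℂ] H}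
    (h : IsBoundedInverse T R) {v : H} (hv : R v = 0) : v = 0 :=
  T.graph_fst_eq_zero_snd ((h 0 v).2 hv.symm) rfl

theorem IsBoundedInverse.kernel_eq_bot {T : H →ₗ.[ℂ] H} {R : H →L[ℂ] H}
    (h : IsBoundedInverse T R) : kernel T = ⊥ := by
  rw [Submodule.eq_bot_iff]
  intro u hu
  rw [(h u 0).1 (mem_kernel.1 hu), map_zero]

theorem isBoundedInverse_resolvent {A : H →ₗ.[ℂ] H} {z : ℂ} (hz : z ∈ resolventSet A) :
    IsBoundedInverse (subScalar A z) (resolvent A z) := by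
  obtain ⟨R, hR⟩ := hz
  rw [resolvent, hR.boundedInverse_eq]
  exact hR

theorem IsBoundedInverse.resolvent_eq {A : H →ₗ.[ℂ] H} {z : ℂ} {R : H →L[ℂ] H}
    (h : IsBoundedInverse (subScalar A z) R) : resolvent A z = R :=
  h.boundedInverse_eq

/-- Change of the spectral parameter. -/
theorem isBoundedInverse_subScalar_of_isUnit {A : H →ₗ.[ℂ] H} {z₀ z : ℂ} {R : H →L[ℂ] H}
    (h : IsBoundedInverse (subScalar A z₀) R) (hu : IsUnit (1 - (z - z₀) • R)) :
    IsBoundedInverse (subScalar A z) (Ring.inverse (1 - (z - z₀) • R) * R) := by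
  intro u v
  have h1 : (u, v) ∈ (subScalar A z).graph ↔ u = R (v + (z - z₀) • u) := by
    rw [mem_graph_subScalar, ← h, mem_graph_subScalar]
    simp only [sub_smul, add_sub, sub_add_cancel]
  have h2 : u = R (v + (z - z₀) • u) ↔ (1 - (z - z₀) • R) u = R v := by
    simp only [map_add, map_smul, sub_apply, smul_apply,
      one_apply_eq_self]
    exact sub_eq_iff_eq_add.symm
  rw [h1, h2]
  set U := 1 - (z - z₀) • R with hU
  constructor
  · intro h
    have := congrArg (⇑(Ring.inverse U)) h
    rw [← mul_apply_eq_comp, Ring.inverse_mul_cancel _ hu] at this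
    simpa using this
  · rintro rfl
    rw [← mul_apply_eq_comp, ← mul_assoc, Ring.mul_inverse_cancel _ hu, one_mul]

/-- The first resolvent identity, as invertibility of `1 - (z - z₀) (A - z₀)⁻¹`. -/
theorem resolvent_apply_eq {A : H →ₗ.[ℂ] H} {z₀ z : ℂ} {R S : H →L[ℂ] H}
    (h : IsBoundedInverse (subScalar A z₀) R) (h' : IsBoundedInverse (subScalar A z) S) (v : H) :
    R v = S (v - (z - z₀) • R v) := by
  rw [← h', mem_graph_subScalar]
  have := (h (R v) v).2 rfl
  rw [mem_graph_subScalar] at this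
  convert this using 2
  module

theorem resolvent_identity {A : H →ₗ.[ℂ] H} {z₀ z : ℂ} {R S : H →L[ℂ] H}
    (h : IsBoundedInverse (subScalar A z₀) R) (h' : IsBoundedInverse (subScalar A z) S) :
    S = R + (z - z₀) • (S * R) := by
  ext v
  have := resolvent_apply_eq h h' v
  simp only [map_sub, map_smul] at this
  change S v = R v + (z - z₀) • S (R v)
  rw [eq_sub_iff_add_eq] at this
  exact this.symm

/-- The inverse is explicit, 1 + (z - z₀)S; the two orders of the resolvent identity verify the two
products. -/
theorem isUnit_of_isBoundedInverse {A : H →ₗ.[ℂ] H} {z₀ z : ℂ} {R S : H →L[ℂ] H}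
    (h : IsBoundedInverse (subScalar A z₀) R) (h' : IsBoundedInverse (subScalar A z) S) :
    IsUnit (1 - (z - z₀) • R) := by
  have h1 := resolvent_identity h h'
  have h2 := resolvent_identity h' h
  refine ⟨⟨1 - (z - z₀) • R, 1 + (z - z₀) • S, ?_, ?_⟩, rfl⟩
  · rw [sub_mul, mul_add, mul_one, one_mul, smul_mul_assoc, mul_add, mul_one, mul_smul_comm]
    linear_combination (norm := module) (z₀ - z) • h2
  · rw [add_mul, mul_sub, mul_one, one_mul, smul_mul_assoc, mul_sub, mul_one, mul_smul_comm]
    linear_combination (norm := module) (z - z₀) • h1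

/-- Trades spectral questions about an unbounded operator for invertibility in the Banach algebra of
bounded operators, at the cost of one known resolvent R. -/
theorem mem_resolventSet_iff_isUnit {A : H →ₗ.[ℂ] H} {z₀ z : ℂ} {R : H →L[ℂ] H}
    (h : IsBoundedInverse (subScalar A z₀) R) :
    z ∈ resolventSet A ↔ IsUnit (1 - (z - z₀) • R) :=
  ⟨fun ⟨_, h'⟩ => isUnit_of_isBoundedInverse h h',
    fun hu => ⟨_, isBoundedInverse_subScalar_of_isUnit h hu⟩⟩

/-- If the difference of two resolvents is compact at one point, it is compact at all points. -/
theorem isCompactOperator_resolvent_sub {A A₀ : H →ₗ.[ℂ] H} {z₀ z : ℂ} {R R₀ S S₀ : H →L[ℂ] H}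
    (hR : IsBoundedInverse (subScalar A z₀) R) (hR₀ : IsBoundedInverse (subScalar A₀ z₀) R₀)
    (hS : IsBoundedInverse (subScalar A z) S) (hS₀ : IsBoundedInverse (subScalar A₀ z) S₀)
    (hc : IsCompactOperator (R - R₀)) : IsCompactOperator (S - S₀) := by
  have h1 := resolvent_identity hR hS
  have h3 := resolvent_identity hS₀ hR₀
  have h4 := resolvent_identity hR₀ hS₀
  -- The outer factors transport the resolvents from z₀ to z: (1 + (z - z₀)S)R = S and R₀(1 + (z -
  -- z₀)S₀) = S₀. The difference at z is thus the compact difference at z₀ between bounded factors.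
  have key : S - S₀ = (1 + (z - z₀) • S) * ((R - R₀) * (1 + (z - z₀) • S₀)) := by
    have h3' : R₀ * S₀ * (z - z₀) • (1 : H →L[ℂ] H) = S₀ - R₀ := by
      rw [mul_smul_comm, mul_one]
      nth_rewrite 2 [h3]
      have : (z₀ - z) = -(z - z₀) := by ring
      rw [this, neg_smul]
      abel
    have e1 : (1 + (z - z₀) • S) * R = S := by
      rw [add_mul, one_mul, smul_mul_assoc]; exact h1.symm
    have e2 : R₀ * (1 + (z - z₀) • S₀) = S₀ := by
      rw [mul_add, mul_one, mul_smul_comm]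
      rw [mul_smul_comm, mul_one] at h3'
      rw [h3']; abel
    rw [sub_mul, e2, mul_sub, ← mul_assoc, e1, mul_add, mul_one, add_mul, one_mul]
    simp only [mul_smul_comm, smul_mul_assoc]
    abel
  rw [key]
  exact (hc.comp_clm (1 + (z - z₀) • S₀)).clm_comp (1 + (z - z₀) • S)

/-- Convergence at one point is enough: the resolvent at z is a fixed expression in the one at z₀,
invertibility is an open condition, and inversion is continuous at a unit. -/
theorem normResolventTendsto_of_tendsto [CompleteSpace H] {ι : Type*} {A : ι → H →ₗ.[ℂ] H}
    {l : Filter ι} {A₀ : H →ₗ.[ℂ] H} {z₀ : ℂ} {R : ι → H →L[ℂ] H} {R₀ : H →L[ℂ] H}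
    (hR : ∀ᶠ i in l, IsBoundedInverse (subScalar (A i) z₀) (R i))
    (hR₀ : IsBoundedInverse (subScalar A₀ z₀) R₀) (hlim : Tendsto R l (𝓝 R₀)) :
    NormResolventTendsto A l A₀ := by
  intro z hz
  have hu₀ := (mem_resolventSet_iff_isUnit hR₀).1 hz
  have ht : Tendsto (fun i => 1 - (z - z₀) • R i) l (𝓝 (1 - (z - z₀) • R₀)) :=
    (hlim.const_smul _).const_sub _
  have hu : ∀ᶠ i in l, IsUnit (1 - (z - z₀) • R i) :=
    ht.eventually (hu₀.unit.nhds)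
  refine ⟨?_, ?_⟩
  · filter_upwards [hR, hu] with i h1 h2
    exact (mem_resolventSet_iff_isUnit h1).2 h2
  · rw [(isBoundedInverse_subScalar_of_isUnit hR₀ hu₀).resolvent_eq]
    have hinv : Tendsto (fun i => Ring.inverse (1 - (z - z₀) • R i)) l
        (𝓝 (Ring.inverse (1 - (z - z₀) • R₀))) :=
      (NormedRing.inverse_continuousAt hu₀.unit).tendsto.comp ht
    refine (hinv.mul hlim).congr' ?_
    filter_upwards [hR, hu] with i h1 h2
    exact (isBoundedInverse_subScalar_of_isUnit h1 h2).resolvent_eq.symm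

end Graph

/-! ### Selfadjointness through graphs, and inverses of semibounded operators -/

section SelfAdjoint

variable {H : Type*} [NormedAddCommGroup H] [InnerProductSpace ℂ H] [CompleteSpace H]

theorem inner_eq_of_mem_graph {B : H →ₗ.[ℂ] H} (hB : IsSelfAdjoint B) {h k h' k' : H}
    (h1 : (h, k) ∈ B.graph) (h2 : (h', k') ∈ B.graph) : inner ℂ k h' = inner ℂ h k' := by
  have := LinearPMap.adjoint_graph_eq_graph_adjoint hB.dense_domain
  rw [LinearPMap.isSelfAdjoint_def.1 hB] at this
  rw [this, Submodule.mem_adjoint_iff] at h2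
  exact sub_eq_zero.1 (h2 h k h1)

/-- The maximality half of selfadjointness: whatever pairs like an element of the adjoint already
lies in the graph. -/
theorem mem_graph_of_forall_inner {B : H →ₗ.[ℂ] H} (hB : IsSelfAdjoint B) {x y : H}
    (h : ∀ h k : H, (h, k) ∈ B.graph → inner ℂ k x = inner ℂ h y) : (x, y) ∈ B.graph := by
  have := LinearPMap.adjoint_graph_eq_graph_adjoint hB.dense_domain
  rw [LinearPMap.isSelfAdjoint_def.1 hB] at this
  rw [this, Submodule.mem_adjoint_iff]
  exact fun a b hab => sub_eq_zero.2 (h a b hab)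

theorem isSelfAdjoint_of_graph {A : H →ₗ.[ℂ] H} (hd : Dense (A.domain : Set H))
    (h : ∀ x y : H, (x, y) ∈ A.graph ↔
      ∀ h k : H, (h, k) ∈ A.graph → inner ℂ k x = inner ℂ h y) : IsSelfAdjoint A := by
  rw [LinearPMap.isSelfAdjoint_def]
  apply LinearPMap.eq_of_eq_graph
  rw [LinearPMap.adjoint_graph_eq_graph_adjoint hd]
  ext ⟨x, y⟩
  rw [Submodule.mem_adjoint_iff, h]
  simp only [sub_eq_zero]

/-- A symmetric, densely defined operator whose adjoint is contained in its closure is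
essentially selfadjoint. -/
theorem isSelfAdjoint_closure {A : H →ₗ.[ℂ] H} (hd : Dense (A.domain : Set H))
    (hsymm : ∀ h k h' k' : H, (h, k) ∈ A.graph → (h', k') ∈ A.graph →
      inner ℂ k h' = inner ℂ h k')
    (hmax : ∀ x y : H, (∀ h k : H, (h, k) ∈ A.graph → inner ℂ k x = inner ℂ h y) →
      (x, y) ∈ A.graph.topologicalClosure) :
    A.graph.topologicalClosure = A.closure.graph ∧ IsSelfAdjoint A.closure := by
  have hle : A ≤ A.adjoint := by
    apply LinearPMap.le_of_le_graph
    rintro ⟨x, y⟩ hxy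
    rw [LinearPMap.adjoint_graph_eq_graph_adjoint hd, Submodule.mem_adjoint_iff]
    exact fun a b hab => sub_eq_zero.2 (hsymm a b x y hab hxy)
  have hcl : A.IsClosable :=
    (LinearPMap.adjoint_isClosed hd).isClosable.leIsClosable hle
  have hgr := hcl.graph_closure_eq_closure_graph
  refine ⟨hgr, isSelfAdjoint_of_graph (hd.mono A.le_closure.1) fun x y => ⟨fun hxy h k hk => ?_,
    fun hxy => ?_⟩⟩
  · have hcl1 : ∀ p ∈ A.graph.topologicalClosure, ∀ q ∈ A.graph,
        inner ℂ p.2 q.1 = inner ℂ p.1 q.2 := by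
      intro p hp q hq
      have hc : IsClosed {p : H × H | inner ℂ p.2 q.1 = inner ℂ p.1 q.2} :=
        isClosed_eq (by fun_prop) (by fun_prop)
      exact hc.closure_subset_iff.2 (fun p hp => hsymm p.1 p.2 q.1 q.2 hp hq) hp
    have hcl2 : ∀ p ∈ A.graph.topologicalClosure, ∀ q ∈ A.graph.topologicalClosure,
        inner ℂ p.2 q.1 = inner ℂ p.1 q.2 := by
      intro p hp q hq
      have hc : IsClosed {q : H × H | inner ℂ p.2 q.1 = inner ℂ p.1 q.2} :=
        isClosed_eq (by fun_prop) (by fun_prop)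
      exact hc.closure_subset_iff.2 (fun q hq => hcl1 p hp q hq) hq
    rw [← hgr] at hk hxy
    exact hcl2 _ hk _ hxy
  · rw [← hgr]
    exact hmax x y fun h k hk => hxy h k (LinearPMap.le_graph_of_le A.le_closure hk)

/-- An operator with a selfadjoint bounded resolvent at a real point is selfadjoint. -/
theorem isSelfAdjoint_of_isBoundedInverse {A : H →ₗ.[ℂ] H} {lam : ℝ} {R : H →L[ℂ] H}
    (h : IsBoundedInverse (subScalar A lam) R) (hR : IsSelfAdjoint R) : IsSelfAdjoint A := by
  have hRs : ∀ x y, inner ℂ (R x) y = inner ℂ x (R y) := fun x y => by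
    rw [← ContinuousLinearMap.adjoint_inner_right,
      ContinuousLinearMap.isSelfAdjoint_iff'.1 hR]
  have hgraph : ∀ u f : H, (u, f) ∈ A.graph ↔ u = R (f - (lam : ℂ) • u) := fun u f => by
    rw [← h, mem_graph_subScalar, sub_add_cancel]
  have hrange : ∀ v, R v ∈ A.domain := fun v =>
    LinearPMap.mem_domain_iff.2 ⟨_, mem_graph_subScalar.1 ((h (R v) v).2 rfl)⟩
  -- For v orthogonal to the domain, testing with R(Rv) gives ‖Rv‖² = 0, so Rv = 0 and v = 0.
  have hd : Dense (A.domain : Set H) := by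
    rw [Submodule.dense_iff_topologicalClosure_eq_top, Submodule.topologicalClosure_eq_top_iff,
      Submodule.eq_bot_iff]
    intro v hv
    apply h.apply_eq_zero
    rw [Submodule.mem_orthogonal] at hv
    have := hv (R (R v)) (hrange _)
    rw [hRs] at this
    exact inner_self_eq_zero.1 this
  refine isSelfAdjoint_of_graph hd fun x y => ⟨fun hxy a b hab => ?_, fun hxy => ?_⟩
  · rw [hgraph] at hxy hab
    have h1 : inner ℂ (b - (lam : ℂ) • a) x = inner ℂ a (y - (lam : ℂ) • x) := by
      conv_lhs => rw [hxy, ← hRs]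
      rw [← hab]
    simp only [inner_sub_left, inner_sub_right, inner_smul_left, inner_smul_right,
      Complex.conj_ofReal] at h1
    simpa using h1
  · rw [hgraph]
    refine ext_inner_left ℂ fun v => ?_
    have hg := mem_graph_subScalar.1 ((h (R v) v).2 rfl)
    have := hxy _ _ hg
    rw [inner_add_left, inner_smul_left, Complex.conj_ofReal] at this
    rw [← hRs, inner_sub_right, inner_smul_right, ← this]
    ring

/-- A selfadjoint operator that is bounded above by `β` has a bounded inverse of `a - B` for
all `a > β`. -/
theorem exists_isBoundedInverse_scalarSub {B : H →ₗ.[ℂ] H} (hB : IsSelfAdjoint B) {β a : ℝ}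
    (hβ : ∀ h k : H, (h, k) ∈ B.graph → (inner ℂ h k).re ≤ β * ‖h‖ ^ 2) (ha : β < a) :
    ∃ Q : H →L[ℂ] H, IsBoundedInverse (scalarSub (a : ℂ) B) Q ∧ ‖Q‖ ≤ (a - β)⁻¹ ∧
      IsSelfAdjoint Q := by
  have hpos : 0 < a - β := sub_pos.2 ha
  set T := scalarSub (a : ℂ) B with hT
  -- From (a - β)‖h‖² ≤ Re⟨h, g⟩ and Cauchy–Schwarz. This one bound gives injectivity, a closed
  -- range and the norm of the inverse.
  have hbd : ∀ h g : H, (h, g) ∈ T.graph → (a - β) * ‖h‖ ≤ ‖g‖ := by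
    intro h g hg
    rw [hT, mem_graph_scalarSub] at hg
    have h1 := hβ _ _ hg
    rw [inner_sub_right, inner_smul_right, inner_self_eq_norm_sq_to_K] at h1
    have h2 : (inner ℂ h g).re ≤ ‖h‖ * ‖g‖ := (Complex.re_le_norm _).trans (norm_inner_le_norm _ _)
    have h3 : (((a : ℂ) * ((‖h‖ : ℝ) : ℂ) ^ 2 - inner ℂ h g)).re
        = a * ‖h‖ ^ 2 - (inner ℂ h g).re := by
      rw [Complex.sub_re, ← Complex.ofReal_pow, ← Complex.ofReal_mul, Complex.ofReal_re]
    rw [show (RCLike.ofReal ‖h‖ : ℂ) = ((‖h‖ : ℝ) : ℂ) from rfl, h3] at h1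
    rcases eq_or_lt_of_le (norm_nonneg h) with h0 | h0
    · rw [← h0]; simp
    · have : (a - β) * ‖h‖ * ‖h‖ ≤ ‖g‖ * ‖h‖ := by nlinarith
      exact le_of_mul_le_mul_right this h0
  have hcl : IsClosed (T.graph : Set (H × H)) := by
    have : (T.graph : Set (H × H)) = (fun p : H × H => (p.1, (a : ℂ) • p.1 - p.2)) ⁻¹' B.graph := by
      ext ⟨u, v⟩
      exact mem_graph_scalarSub
    rw [this]
    exact hB.isClosed.preimage (by fun_prop)
  have hinj : ∀ h g h' : H, (h, g) ∈ T.graph → (h', g) ∈ T.graph → h = h' := by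
    intro h g h' h1 h2
    have h3 := T.graph.sub_mem h1 h2
    have h4 := hbd (h - h') (g - g) h3
    rw [sub_self, norm_zero] at h4
    have : ‖h - h'‖ ≤ 0 := by nlinarith [norm_nonneg (h - h')]
    exact sub_eq_zero.1 (norm_le_zero_iff.1 this)
  have hsurj : ∀ g : H, ∃ h, (h, g) ∈ T.graph := by
    set W : Submodule ℂ H := T.graph.map (LinearMap.snd ℂ H H) with hW
    have hWcl : IsClosed (W : Set H) := by
      apply IsSeqClosed.isClosed
      intro g g0 hg hlim
      choose p hp hp2 using fun n => Submodule.mem_map.1 (hg n)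
      have hp2' : ∀ n, (p n).2 = g n := hp2
      have hcau : CauchySeq fun n => (p n).1 := by
        rw [Metric.cauchySeq_iff]
        intro ε hε
        obtain ⟨N, hN⟩ := Metric.cauchySeq_iff.1 hlim.cauchySeq ((a - β) * ε) (by positivity)
        refine ⟨N, fun m hm n hn => ?_⟩
        have h1 := hbd _ _ (T.graph.sub_mem (hp m) (hp n))
        have h2 := hN m hm n hn
        rw [dist_eq_norm] at h2 ⊢
        change (a - β) * ‖(p m).1 - (p n).1‖ ≤ ‖(p m).2 - (p n).2‖ at h1
        rw [hp2', hp2'] at h1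
        exact lt_of_mul_lt_mul_left (h1.trans_lt h2) hpos.le
      obtain ⟨h0, hh0⟩ := cauchySeq_tendsto_of_complete hcau
      refine Submodule.mem_map.2 ⟨(h0, g0), ?_, rfl⟩
      refine hcl.mem_of_tendsto (f := fun n => ((p n).1, g n)) (b := atTop)
        (hh0.prodMk_nhds hlim) (Eventually.of_forall fun n => ?_)
      rw [← hp2' n]
      exact hp n
    -- A vector k orthogonal to the range satisfies Bk = ak by maximality of B, and injectivity then
    -- forces k = 0.
    have hWtop : W = ⊤ := by
      have : CompleteSpace W := hWcl.completeSpace_coe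
      rw [← Submodule.orthogonal_eq_bot_iff, Submodule.eq_bot_iff]
      intro k hk
      rw [Submodule.mem_orthogonal] at hk
      have hmem : (k, (a : ℂ) • k) ∈ B.graph := by
        refine mem_graph_of_forall_inner hB fun h b hb => ?_
        have h1 : (h, (a : ℂ) • h - b) ∈ T.graph := by
          rw [hT, mem_graph_scalarSub, sub_sub_cancel]; exact hb
        have h2 := hk _ (Submodule.mem_map.2 ⟨_, h1, rfl⟩)
        rw [LinearMap.snd_apply, inner_sub_left, inner_smul_left, Complex.conj_ofReal,
          sub_eq_zero] at h2
        rw [inner_smul_right, h2]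
      have h0 : (k, (0 : H)) ∈ T.graph := by
        rw [hT, mem_graph_scalarSub, sub_zero]; exact hmem
      exact hinj _ _ _ h0 T.graph.zero_mem
    intro g
    obtain ⟨p, hp, rfl⟩ := Submodule.mem_map.1 (hWtop ▸ Submodule.mem_top : g ∈ W)
    exact ⟨p.1, hp⟩
  choose q hq using hsurj
  have hbound : ∀ g, ‖q g‖ ≤ (a - β)⁻¹ * ‖g‖ := fun g => by
    rw [inv_mul_eq_div, le_div_iff₀ hpos, mul_comm]
    exact hbd _ _ (hq g)
  set Q : H →L[ℂ] H := LinearMap.mkContinuous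
    { toFun := q
      map_add' := fun x y => hinj _ _ _ (hq _) (T.graph.add_mem (hq x) (hq y))
      map_smul' := fun c x => hinj _ _ _ (hq _) (T.graph.smul_mem c (hq x)) } _ hbound with hQdef
  have hQ : IsBoundedInverse T Q := fun u v =>
    ⟨fun huv => hinj _ _ _ huv (hq v), fun h => h ▸ hq v⟩
  refine ⟨Q, hQ, LinearMap.mkContinuous_norm_le _ (by positivity) _, ?_⟩
  rw [ContinuousLinearMap.isSelfAdjoint_iff']
  symm
  rw [ContinuousLinearMap.eq_adjoint_iff]
  intro x y
  have h1 := mem_graph_scalarSub.1 (hq x)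
  have h2 := mem_graph_scalarSub.1 (hq y)
  have h3 := inner_eq_of_mem_graph hB h1 h2
  rw [inner_sub_left, inner_sub_right, inner_smul_left, inner_smul_right,
    Complex.conj_ofReal] at h3
  change inner ℂ (q x) y = inner ℂ x (q y)
  linear_combination h3

/-- If two selfadjoint operators differ by a bounded compact perturbation and `a - B₀` is
boundedly invertible, then `a - B` is boundedly invertible as soon as it is injective. -/
theorem exists_isBoundedInverse_of_kernel_eq_bot {B B₀ : H →ₗ.[ℂ] H} {a : ℂ}
    {S Q : H →L[ℂ] H} (hS : IsCompactOperator S) (hQ : IsBoundedInverse (scalarSub a B₀) Q)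
    (hBB : ∀ h k : H, (h, k) ∈ B.graph ↔ (h, k - S h) ∈ B₀.graph)
    (hker : kernel (scalarSub a B) = ⊥) :
    ∃ Q' : H →L[ℂ] H, IsBoundedInverse (scalarSub a B) Q' := by
  have hgr : ∀ h g : H, (h, g) ∈ (scalarSub a B).graph ↔ (1 - Q * S) h = Q g := by
    intro h g
    have : (h, g) ∈ (scalarSub a B).graph ↔ h = Q (g + S h) := by
      rw [← hQ, mem_graph_scalarSub, mem_graph_scalarSub, hBB, sub_sub]
    rw [this, map_add]
    simp only [sub_apply, one_apply_eq_self,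
      mul_apply_eq_comp]
    exact sub_eq_iff_eq_add.symm
  have hc : IsCompactOperator (Q * S) := hS.clm_comp Q
  -- Fredholm alternative for the compact operator QS at 1: an eigenvector would lie in the kernel
  -- of a - B.
  have hu : IsUnit (1 - Q * S) := by
    rcases hc.hasEigenvalue_or_mem_resolventSet (one_ne_zero (α := ℂ)) with h | h
    · exfalso
      obtain ⟨v, hv⟩ := h.exists_hasEigenvector
      refine hv.2 ?_
      have h1 : (Q * S) v = v := by simpa using hv.apply_eq_smul
      have h2 : v ∈ kernel (scalarSub a B) := by
        rw [mem_kernel, hgr, map_zero, sub_apply, one_apply_eq_self, h1,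
          sub_self]
      rw [hker] at h2
      exact h2
    · rw [spectrum.mem_resolventSet_iff] at h
      simpa using h
  refine ⟨Ring.inverse (1 - Q * S) * Q, fun h g => ?_⟩
  rw [hgr]
  constructor
  · intro e
    rw [mul_apply_eq_comp, ← e, ← mul_apply_eq_comp,
      Ring.inverse_mul_cancel _ hu, one_apply_eq_self]
  · rintro rfl
    rw [← mul_apply_eq_comp, ← mul_assoc, Ring.mul_inverse_cancel _ hu, one_mul]

end SelfAdjoint

end UnboundedOp

end

noncomputable section

/-! ### Compact perturbations of the resolvent and the essential spectrum -/

namespace UnboundedOp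

variable {H : Type*} [NormedAddCommGroup H] [InnerProductSpace ℂ H]

theorem mem_kernel_subScalar_iff {A : H →ₗ.[ℂ] H} {z₀ z : ℂ} {R : H →L[ℂ] H}
    (h : IsBoundedInverse (subScalar A z₀) R) {v : H} :
    v ∈ kernel (subScalar A z) ↔ (1 - (z - z₀) • R) v = 0 := by
  have : v ∈ kernel (subScalar A z) ↔ v = R ((z - z₀) • v) := by
    rw [mem_kernel, mem_graph_subScalar, ← h, mem_graph_subScalar]
    simp [sub_smul]
  rw [this, map_smul]
  exact sub_eq_zero.symm

theorem mem_kernel_subScalar_graph {A : H →ₗ.[ℂ] H} {z : ℂ} {v : H} :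
    v ∈ kernel (subScalar A z) ↔ (v, z • v) ∈ A.graph := by
  rw [mem_kernel, mem_graph_subScalar, zero_add]

/-- Applied to eigenvectors of A at w, the right side is a compact image plus a term that vanishes
as w → z. With z in the resolvent set of A₀ this gives compactness of families of eigenvectors. -/
theorem one_sub_smul_apply_eq {A : H →ₗ.[ℂ] H} {z₀ z w : ℂ} {R R₀ : H →L[ℂ] H} {v : H}
    (hv : v ∈ kernel (subScalar A w)) (hR : IsBoundedInverse (subScalar A z₀) R) :
    (1 - (z - z₀) • R₀) v = (z - z₀) • (R - R₀) v + (w - z) • R v := by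
  have h := (mem_kernel_subScalar_iff hR).1 hv
  simp only [sub_apply, one_apply_eq_self, smul_apply] at h ⊢
  linear_combination (norm := module) h

theorem eq_inverse_apply {A : H →ₗ.[ℂ] H} {z₀ z w : ℂ} {R R₀ : H →L[ℂ] H} {v : H}
    (hv : v ∈ kernel (subScalar A w)) (hR : IsBoundedInverse (subScalar A z₀) R)
    (hu : IsUnit (1 - (z - z₀) • R₀)) :
    v = Ring.inverse (1 - (z - z₀) • R₀) ((z - z₀) • (R - R₀) v + (w - z) • R v) := by
  rw [← one_sub_smul_apply_eq hv hR, ← mul_apply_eq_comp, Ring.inverse_mul_cancel _ hu,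
    one_apply_eq_self]

theorem isClosed_kernel_subScalar {A : H →ₗ.[ℂ] H} {z₀ : ℂ} {R : H →L[ℂ] H}
    (hR : IsBoundedInverse (subScalar A z₀) R) (z : ℂ) :
    IsClosed (kernel (subScalar A z) : Set H) := by
  have : (kernel (subScalar A z) : Set H) =
      ⇑(1 - (z - z₀) • R : H →L[ℂ] H) ⁻¹' {0} := by
    ext v
    exact mem_kernel_subScalar_iff hR
  rw [this]
  exact isClosed_singleton.preimage (ContinuousLinearMap.continuous _)

variable [CompleteSpace H]

/-- A compact operator maps orthonormal sequences to null sequences. -/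
theorem tendsto_zero_of_isCompactOperator {K : H →L[ℂ] H} (hK : IsCompactOperator K)
    {v : ℕ → H} (hv : Orthonormal ℂ v) : Tendsto (fun n => K (v n)) atTop (𝓝 0) := by
  obtain ⟨C, hC, hCK⟩ := hK.image_closedBall_subset_compact (f := (K : H →ₗ[ℂ] H)) 1
  refine tendsto_of_subseq_tendsto fun ns hns => ?_
  have hmem : ∀ n, K (v (ns n)) ∈ C := fun n =>
    hCK ⟨v (ns n), by simp [hv.1], rfl⟩
  obtain ⟨y, -, φ, hφ, hlim⟩ := hC.tendsto_subseq hmem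
  refine ⟨φ, ?_⟩
  -- Bessel's inequality makes an orthonormal sequence weakly null, which forces any subsequential
  -- limit y of the images to satisfy ⟨y, y⟩ = 0.
  have hw : Tendsto (fun n => inner ℂ (v n) (K.adjoint y)) atTop (𝓝 0) := by
    have := (hv.inner_products_summable (K.adjoint y)).tendsto_cofinite_zero
    rw [Nat.cofinite_eq_atTop] at this
    rw [tendsto_zero_iff_norm_tendsto_zero]
    have h2 := this.sqrt
    simpa [Real.sqrt_sq] using h2
  have h1 : Tendsto (fun n => inner ℂ (K (v (ns (φ n)))) y) atTop (𝓝 (inner ℂ y y)) :=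
    hlim.inner tendsto_const_nhds
  have h2 : Tendsto (fun n => inner ℂ (K (v (ns (φ n)))) y) atTop (𝓝 0) := by
    refine (hw.comp (hns.comp hφ.tendsto_atTop)).congr fun n => ?_
    exact ContinuousLinearMap.adjoint_inner_right K _ _
  have hy : y = 0 := inner_self_eq_zero.1 (tendsto_nhds_unique h1 h2)
  rw [hy] at hlim
  exact hlim

/-! ### Weyl's theorem away from the spectrum of the unperturbed operator -/

section Perturbation

variable {A A₀ : H →ₗ.[ℂ] H} {z₀ : ℂ} {R R₀ : H →L[ℂ] H}

/-- Outside the spectrum of `A₀`, the spectrum of `A` consists of eigenvalues. -/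
theorem kernel_ne_bot_of_mem_spectrum
    (hR : IsBoundedInverse (subScalar A z₀) R) (hR₀ : IsBoundedInverse (subScalar A₀ z₀) R₀)
    (hc : IsCompactOperator (R - R₀)) {z : ℂ} (hz : z ∈ spectrum A) (hz₀ : z ∈ resolventSet A₀) :
    kernel (subScalar A z) ≠ ⊥ := by
  intro hker
  have hu := (mem_resolventSet_iff_isUnit hR₀).1 hz₀
  set V := Ring.inverse (1 - (z - z₀) • R₀) with hV
  set W := (z - z₀) • (V * (R - R₀)) with hW
  have hWc : IsCompactOperator W := (hc.clm_comp V).smul (z - z₀)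
  -- Splitting off the invertible factor that belongs to A₀ leaves 1 minus a compact operator, to
  -- which the Fredholm alternative applies.
  have hfac : (1 - (z - z₀) • R₀) * (1 - W) = 1 - (z - z₀) • R := by
    rw [mul_sub, hW, mul_smul_comm, ← mul_assoc, Ring.mul_inverse_cancel _ hu, one_mul, mul_one,
      smul_sub]
    abel
  rcases hWc.hasEigenvalue_or_mem_resolventSet (one_ne_zero (α := ℂ)) with h | h
  · obtain ⟨v, hv⟩ := h.exists_hasEigenvector
    refine hv.2 ?_
    have h1 : W v = v := by simpa using hv.apply_eq_smul
    have h2 : v ∈ kernel (subScalar A z) := by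
      have h3 : (1 - W) v = 0 := by rw [sub_apply, h1, one_apply_eq_self, sub_self]
      rw [mem_kernel_subScalar_iff hR, ← hfac, mul_apply_eq_comp, h3, map_zero]
    rw [hker] at h2
    exact h2
  · rw [spectrum.mem_resolventSet_iff, map_one] at h
    exact hz ((mem_resolventSet_iff_isUnit hR).2 (hfac ▸ hu.mul h))

theorem isOpen_resolventSet (hR₀ : IsBoundedInverse (subScalar A₀ z₀) R₀) :
    IsOpen (resolventSet A₀) := by
  have : resolventSet A₀ = (fun z : ℂ => 1 - (z - z₀) • R₀) ⁻¹' {x | IsUnit x} := by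
    ext z
    exact mem_resolventSet_iff_isUnit hR₀
  rw [this]
  exact Units.isOpen.preimage (by fun_prop)

theorem conj_eq_of_mem_kernel (hA : IsSelfAdjoint A) {z : ℂ} {v : H} (hv0 : v ≠ 0)
    (hv : v ∈ kernel (subScalar A z)) : (starRingEnd ℂ) z = z := by
  have h := mem_kernel_subScalar_graph.1 hv
  have h1 := inner_eq_of_mem_graph hA h h
  rw [inner_smul_left, inner_smul_right] at h1
  exact mul_right_cancel₀ (inner_self_ne_zero.2 hv0) h1

theorem inner_eq_zero_of_mem_kernel (hA : IsSelfAdjoint A) {z w : ℂ} (hzw : z ≠ w) {v u : H}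
    (hv : v ∈ kernel (subScalar A z)) (hu : u ∈ kernel (subScalar A w)) :
    inner ℂ v u = 0 := by
  by_cases hv0 : v = 0
  · simp [hv0]
  have h1 := inner_eq_of_mem_graph hA (mem_kernel_subScalar_graph.1 hv)
    (mem_kernel_subScalar_graph.1 hu)
  rw [inner_smul_left, inner_smul_right, conj_eq_of_mem_kernel hA hv0 hv] at h1
  have h2 : (z - w) * inner ℂ v u = 0 := by linear_combination h1
  exact (mul_eq_zero.1 h2).resolve_left (sub_ne_zero.2 hzw)

/-- On the kernel the compact operator W acts as the identity, so the identity of the kernel is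
compact. -/
theorem finiteDimensional_kernel_subScalar
    (hR : IsBoundedInverse (subScalar A z₀) R) (hR₀ : IsBoundedInverse (subScalar A₀ z₀) R₀)
    (hc : IsCompactOperator (R - R₀)) {z : ℂ} (hz₀ : z ∈ resolventSet A₀) :
    FiniteDimensional ℂ (kernel (subScalar A z)) := by
  have hu := (mem_resolventSet_iff_isUnit hR₀).1 hz₀
  set N := kernel (subScalar A z) with hN
  set W := (z - z₀) • (Ring.inverse (1 - (z - z₀) • R₀) * (R - R₀)) with hW
  have hWc : IsCompactOperator W := (hc.clm_comp _).smul (z - z₀)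
  have hWid : ∀ v : N, W (v : H) = v := fun v => by
    have h := eq_inverse_apply (z := z) v.2 hR hu
    rw [sub_self, zero_smul, add_zero, map_smul] at h
    exact h.symm
  have hcl : IsClosed (N : Set H) := isClosed_kernel_subScalar hR z
  have h1 : IsCompactOperator (Set.codRestrict (W ∘ N.subtypeL) N
      fun v => by rw [Function.comp_apply, Submodule.subtypeL_apply, hWid]; exact v.2) :=
    (hWc.comp_clm N.subtypeL).codRestrict _ hcl
  apply FiniteDimensional.of_isCompactOperator_id
  have h2 : Set.codRestrict (W ∘ N.subtypeL) N
      (fun v => by rw [Function.comp_apply, Submodule.subtypeL_apply, hWid]; exact v.2) = id := by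
    funext v
    exact Subtype.ext (hWid v)
  rwa [h2] at h1

/-- Outside the spectrum of `A₀`, the spectrum of `A` is discrete. -/
theorem mem_discreteSpectrum (hA : IsSelfAdjoint A)
    (hR : IsBoundedInverse (subScalar A z₀) R) (hR₀ : IsBoundedInverse (subScalar A₀ z₀) R₀)
    (hc : IsCompactOperator (R - R₀)) {z : ℂ} (hz : z ∈ spectrum A) (hz₀ : z ∈ resolventSet A₀) :
    z ∈ discreteSpectrum A := by
  refine ⟨kernel_ne_bot_of_mem_spectrum hR hR₀ hc hz hz₀,
    finiteDimensional_kernel_subScalar hR hR₀ hc hz₀, ?_⟩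
  by_contra! hcon
  have hu := (mem_resolventSet_iff_isUnit hR₀).1 hz₀
  obtain ⟨r, hr, hball⟩ := Metric.isOpen_iff.1 (isOpen_resolventSet hR₀) z hz₀
  -- If z were not isolated, nearby spectral points would be eigenvalues w n ≠ z. Their unit
  -- eigenvectors have a convergent subsequence, whose limit is a unit eigenvector at z although it
  -- is orthogonal to every v n.
  have hseq : ∀ n : ℕ, ∃ w v, w ≠ z ∧ ‖w - z‖ < 1 / ((n : ℝ) + 1) ∧ ‖v‖ = 1 ∧
      v ∈ kernel (subScalar A w) := by
    intro n
    obtain ⟨w, hw, hwz, hlt⟩ := hcon (min r (1 / ((n : ℝ) + 1))) (by positivity)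
    have hw₀ : w ∈ resolventSet A₀ :=
      hball (by rw [Metric.mem_ball, dist_eq_norm]; exact hlt.trans_le (min_le_left _ _))
    obtain ⟨v, hv, hv0⟩ := Submodule.exists_mem_ne_zero_of_ne_bot
      (kernel_ne_bot_of_mem_spectrum hR hR₀ hc hw hw₀)
    refine ⟨w, ((‖v‖ : ℂ)⁻¹) • v, hwz, hlt.trans_le (min_le_right _ _), ?_,
      Submodule.smul_mem _ _ hv⟩
    rw [norm_smul, norm_inv, Complex.norm_real, norm_norm, inv_mul_cancel₀ (norm_ne_zero_iff.2 hv0)]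
  choose w v hwz hwlt hv1 hvk using hseq
  have hw : Tendsto w atTop (𝓝 z) := by
    rw [tendsto_iff_norm_sub_tendsto_zero]
    exact squeeze_zero (fun _ => norm_nonneg _) (fun n => (hwlt n).le)
      tendsto_one_div_add_atTop_nhds_zero_nat
  obtain ⟨C, hC, hCK⟩ :=
    hc.image_closedBall_subset_compact (f := ((R - R₀ : H →L[ℂ] H) : H →ₗ[ℂ] H)) 1
  have hmem : ∀ n, (R - R₀) (v n) ∈ C := fun n => hCK ⟨v n, by simp [hv1], rfl⟩
  obtain ⟨y, -, φ, hφ, hlim⟩ := hC.tendsto_subseq hmem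
  have hsmall : Tendsto (fun n => (w (φ n) - z) • R (v (φ n))) atTop (𝓝 0) := by
    rw [tendsto_zero_iff_norm_tendsto_zero]
    have h1 : Tendsto (fun n => ‖w (φ n) - z‖ * ‖R‖) atTop (𝓝 0) := by
      have := (tendsto_iff_norm_sub_tendsto_zero.1 (hw.comp hφ.tendsto_atTop)).mul_const ‖R‖
      simpa using this
    refine squeeze_zero (fun _ => norm_nonneg _) (fun n => ?_) h1
    rw [norm_smul]
    gcongr
    simpa [hv1] using R.le_opNorm (v (φ n))
  set x := Ring.inverse (1 - (z - z₀) • R₀) ((z - z₀) • y + 0) with hx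
  have hvlim : Tendsto (fun n => v (φ n)) atTop (𝓝 x) := by
    have h1 : Tendsto (fun n => Ring.inverse (1 - (z - z₀) • R₀)
        ((z - z₀) • (R - R₀) (v (φ n)) + (w (φ n) - z) • R (v (φ n)))) atTop (𝓝 x) :=
      ((ContinuousLinearMap.continuous _).tendsto _).comp ((hlim.const_smul _).add hsmall)
    exact h1.congr fun n => (eq_inverse_apply (hvk _) hR hu).symm
  have hxk : x ∈ kernel (subScalar A z) := by
    rw [mem_kernel_subScalar_iff hR]
    have h1 : Tendsto (fun n => (1 - (z - z₀) • R) (v (φ n))) atTop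
        (𝓝 ((1 - (z - z₀) • R) x)) := ((ContinuousLinearMap.continuous _).tendsto _).comp hvlim
    refine tendsto_nhds_unique h1 (hsmall.congr fun n => ?_)
    rw [one_sub_smul_apply_eq (hvk (φ n)) hR, sub_self]
    simp
  have hx1 : ‖x‖ = 1 := by
    have := hvlim.norm
    simp only [hv1] at this
    exact (tendsto_nhds_unique this tendsto_const_nhds)
  have hx0 : inner ℂ x x = 0 := by
    have h1 : Tendsto (fun n => inner ℂ (v (φ n)) x) atTop (𝓝 (inner ℂ x x)) :=
      hvlim.inner tendsto_const_nhds
    refine tendsto_nhds_unique h1 (tendsto_const_nhds.congr fun n => ?_)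
    exact (inner_eq_zero_of_mem_kernel hA (hwz _) (hvk _) hxk).symm
  rw [inner_self_eq_zero] at hx0
  rw [hx0, norm_zero] at hx1
  exact zero_ne_one hx1

end Perturbation

/-- A selfadjoint operator has real spectrum. -/
theorem mem_resolventSet_of_im_ne_zero {A : H →ₗ.[ℂ] H} {lam : ℝ} {R : H →L[ℂ] H}
    (hR : IsBoundedInverse (subScalar A lam) R) (hRs : IsSelfAdjoint R) {z : ℂ} (hz : z.im ≠ 0) :
    z ∈ resolventSet A := by
  rw [mem_resolventSet_iff_isUnit hR]
  have hne : z - lam ≠ 0 := fun h => hz (by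
    have := congrArg Complex.im h
    simpa using this)
  by_contra hcon
  -- A spectral point z of A corresponds to the spectral point (z - λ)⁻¹ of the selfadjoint R, which
  -- has to be real.
  have hmem : (z - lam)⁻¹ ∈ _root_.spectrum ℂ R := by
    rw [spectrum.mem_iff]
    intro hu
    apply hcon
    have h2 : 1 - (z - lam) • R = (z - lam) • (algebraMap ℂ (H →L[ℂ] H) (z - lam)⁻¹ - R) := by
      rw [smul_sub, Algebra.algebraMap_eq_smul_one, smul_smul, mul_inv_cancel₀ hne, one_smul]
    rw [h2]
    exact hu.smul (Units.mk0 _ hne)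
  have h3 := hRs.mem_spectrum_eq_re hmem
  have h4 : ((z - lam)⁻¹).im = 0 := by rw [h3]; simp
  rw [Complex.inv_im] at h4
  simp only [Complex.sub_im, Complex.ofReal_im, sub_zero, div_eq_zero_iff, neg_eq_zero,
    map_eq_zero] at h4
  rcases h4 with h4 | h4
  · exact hz h4
  · exact hne h4

/-- A singular sequence for `A₀` at a real point shows that this point belongs to the essential
spectrum of `A`. -/
theorem mem_essentialSpectrum {A : H →ₗ.[ℂ] H} {lam : ℝ} {R R₀ : H →L[ℂ] H}
    (hR : IsBoundedInverse (subScalar A lam) R) (hRs : IsSelfAdjoint R)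
    (hc : IsCompactOperator (R - R₀)) {x : ℝ} {v : ℕ → H} (hv : Orthonormal ℂ v)
    (hlim : Tendsto (fun n => (1 - ((x : ℂ) - lam) • R₀) (v n)) atTop (𝓝 0)) :
    (x : ℂ) ∈ essentialSpectrum A := by
  have hlimR : Tendsto (fun n => (1 - ((x : ℂ) - lam) • R) (v n)) atTop (𝓝 0) := by
    have h1 := hlim.sub ((tendsto_zero_of_isCompactOperator hc hv).const_smul ((x : ℂ) - lam))
    rw [smul_zero, sub_zero] at h1
    refine h1.congr fun n => ?_
    simp only [sub_apply, one_apply_eq_self, smul_apply]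
    module
  have hnot : ¬ Tendsto v atTop (𝓝 0) := fun h => by
    have := h.norm
    simp only [hv.1, norm_zero] at this
    exact one_ne_zero (tendsto_nhds_unique tendsto_const_nhds this)
  refine ⟨fun hres => hnot ?_, fun hdisc => hnot ?_⟩
  · have hu := (mem_resolventSet_iff_isUnit hR).1 hres
    have h1 := ((Ring.inverse (1 - ((x : ℂ) - lam) • R)).continuous.tendsto 0).comp hlimR
    rw [map_zero] at h1
    refine h1.congr fun n => ?_
    rw [Function.comp_apply, ← mul_apply_eq_comp, Ring.inverse_mul_cancel _ hu, one_apply_eq_self]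
  · obtain ⟨-, hfin, ε, hε, hiso⟩ := hdisc
    -- If x = λ, the defect in `hlim` is v itself, which does not tend to 0.
    have hne : x - lam ≠ 0 := fun h => hnot (by
      have h2 : (x : ℂ) - lam = 0 := by rw [← Complex.ofReal_sub, h, Complex.ofReal_zero]
      simpa [h2] using hlim)
    set w : ℝ := (x - lam)⁻¹ with hw
    have hw0 : w ≠ 0 := inv_ne_zero hne
    -- The map t ↦ λ + t⁻¹ takes nonzero spectral points of R to spectral points of A, so the
    -- isolation of x passes to w = (x - λ)⁻¹.
    have hspec : ∀ᶠ t in 𝓝 w, t ∈ _root_.spectrum ℝ R → t = w := by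
      have hcont : Tendsto (fun t : ℝ => t⁻¹) (𝓝 w) (𝓝 w⁻¹) := tendsto_inv₀ hw0
      have hev := (Metric.tendsto_nhds.1 hcont) ε hε
      filter_upwards [hev, isOpen_ne.mem_nhds hw0] with t ht ht0 hts
      by_contra htw
      have h1 : ((lam + t⁻¹ : ℝ) : ℂ) ∈ spectrum A := by
        intro hres
        have hu := (mem_resolventSet_iff_isUnit hR).1 hres
        rw [spectrum.mem_iff] at hts
        apply hts
        have h2 : algebraMap ℝ (H →L[ℂ] H) t - R
            = (t : ℂ) • (1 - (((lam + t⁻¹ : ℝ) : ℂ) - lam) • R) := by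
          have ht0' : (t : ℂ) ≠ 0 := by exact_mod_cast ht0
          rw [smul_sub, smul_smul, Algebra.algebraMap_eq_smul_one]
          push_cast
          rw [add_sub_cancel_left, mul_inv_cancel₀ ht0', one_smul]
          rfl
        rw [h2]
        exact hu.smul (Units.mk0 (t : ℂ) (by exact_mod_cast ht0))
      have h3 := hiso _ h1 (by
        intro h
        have h' : lam + t⁻¹ = x := by exact_mod_cast h
        apply htw
        rw [hw, ← h', add_sub_cancel_left, inv_inv])
      rw [← Complex.ofReal_sub, Complex.norm_real, Real.norm_eq_abs] at h3
      rw [Real.dist_eq, hw, inv_inv] at ht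
      have h4 : lam + t⁻¹ - x = t⁻¹ - (x - lam) := by ring
      rw [h4] at h3
      exact absurd ht (not_lt.2 h3)
    set S := _root_.spectrum ℝ R with hS
    -- As w is isolated in the spectrum of R, both f and g are continuous there. By functional
    -- calculus f(R) maps into the finite-dimensional kernel, hence is compact, and g(R) inverts R -
    -- w on the complement. Writing v = f(R)v + g(R)(R - w)v shows that the singular sequence would
    -- tend to 0.
    set f : ℝ → ℝ := fun t => if t = w then 1 else 0 with hf
    set g : ℝ → ℝ := fun t => if t = w then 0 else (t - w)⁻¹ with hg
    have hloc : ∀ t ∈ S, t ≠ w → ∀ᶠ s in 𝓝[S] t, s ≠ w := fun t _ htw =>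
      nhdsWithin_le_nhds (isOpen_ne.mem_nhds htw)
    have hlocw : ∀ᶠ s in 𝓝[S] w, s = w := by
      filter_upwards [nhdsWithin_le_nhds hspec, self_mem_nhdsWithin] with s h1 h2 using h1 h2
    have hfc : ContinuousOn f S := by
      intro t ht
      by_cases htw : t = w
      · subst htw
        refine ContinuousWithinAt.congr_of_eventuallyEq (f := fun _ => 1) continuousWithinAt_const
          ?_ (by simp [hf])
        filter_upwards [hlocw] with s hs
        simp [hf, hs]
      · refine ContinuousWithinAt.congr_of_eventuallyEq (f := fun _ => 0) continuousWithinAt_const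
          ?_ (by simp [hf, htw])
        filter_upwards [hloc t ht htw] with s hs
        simp [hf, hs]
    have hgc : ContinuousOn g S := by
      intro t ht
      by_cases htw : t = w
      · subst htw
        refine ContinuousWithinAt.congr_of_eventuallyEq (f := fun _ => 0) continuousWithinAt_const
          ?_ (by simp [hg])
        filter_upwards [hlocw] with s hs
        simp [hg, hs]
      · refine ContinuousWithinAt.congr_of_eventuallyEq (f := fun s => (s - w)⁻¹)
          (ContinuousWithinAt.inv₀ (by fun_prop) (sub_ne_zero.2 htw)) ?_ (by simp [hg, htw])
        filter_upwards [hloc t ht htw] with s hs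
        simp [hg, hs]
    have hRw : cfc (fun t : ℝ => t - w) R = R - algebraMap ℝ _ w := by
      rw [cfc_sub (fun t => t) (fun _ => w) R, cfc_id' ℝ R, cfc_const w R]
    have hPker : (R - algebraMap ℝ _ w) * cfc f R = 0 := by
      rw [← hRw, ← cfc_mul (fun t : ℝ => t - w) f R (by fun_prop) hfc]
      have : (fun t : ℝ => (t - w) * f t) = fun _ => 0 := by
        ext t
        by_cases htw : t = w <;> simp [hf, htw]
      rw [this, cfc_const_zero]
    have hGid : cfc g R * (R - algebraMap ℝ _ w) = 1 - cfc f R := by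
      rw [← hRw, ← cfc_mul g (fun t : ℝ => t - w) R hgc (by fun_prop)]
      have : (fun t : ℝ => g t * (t - w)) = fun t => 1 - f t := by
        ext t
        by_cases htw : t = w
        · simp [hf, hg, htw]
        · simp [hf, hg, htw, sub_ne_zero.2 htw]
      rw [this, cfc_sub (fun _ => (1 : ℝ)) f R (by fun_prop) hfc, cfc_const_one ℝ R]
    have hRw' : ∀ u, (R - algebraMap ℝ (H →L[ℂ] H) w) u
        = -(w : ℂ) • (1 - ((x : ℂ) - lam) • R) u := by
      intro u
      have h1 : (w : ℂ) * ((x : ℂ) - lam) = 1 := by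
        rw [← Complex.ofReal_sub, ← Complex.ofReal_mul, hw, inv_mul_cancel₀ hne,
          Complex.ofReal_one]
      rw [Algebra.algebraMap_eq_smul_one]
      simp only [sub_apply, one_apply_eq_self, smul_apply]
      rw [smul_sub, smul_smul, neg_mul, h1]
      simp only [neg_smul, one_smul, sub_neg_eq_add]
      rw [add_comm, ← sub_eq_add_neg]
      rfl
    set N := kernel (subScalar A (x : ℂ)) with hN
    have hPN : ∀ u, cfc f R u ∈ N := by
      intro u
      rw [hN, mem_kernel_subScalar_iff hR]
      have h1 := hRw' (cfc f R u)
      rw [← mul_apply_eq_comp, hPker] at h1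
      have h2 : (-(w : ℂ)) ≠ 0 := neg_ne_zero.2 (by exact_mod_cast hw0)
      exact (smul_eq_zero.1 h1.symm).resolve_left h2
    have hPc : IsCompactOperator ⇑(cfc f R : H →L[ℂ] H) := by
      have : ProperSpace N := FiniteDimensional.proper ℂ N
      have h1 : IsCompactOperator ((cfc f R).codRestrict N hPN) :=
        isCompactOperator_of_locallyCompactSpace_dom _
      exact h1.clm_comp N.subtypeL
    have h1 := tendsto_zero_of_isCompactOperator hPc hv
    have h2 : Tendsto (fun n => cfc g R ((R - algebraMap ℝ (H →L[ℂ] H) w) (v n))) atTop (𝓝 0) := by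
      have h3 : Tendsto (fun n => (R - algebraMap ℝ (H →L[ℂ] H) w) (v n)) atTop (𝓝 0) := by
        have := hlimR.const_smul (-(w : ℂ))
        rw [smul_zero] at this
        exact this.congr fun n => (hRw' _).symm
      have := ((cfc g R).continuous.tendsto 0).comp h3
      rwa [map_zero] at this
    have h4 := h1.add h2
    rw [add_zero] at h4
    refine h4.congr fun n => ?_
    rw [← mul_apply_eq_comp, hGid, sub_apply, one_apply_eq_self]
    abel

end UnboundedOp

end

noncomputable section

/-! ### The free Laplacian in Fourier space -/

open FourierTransform UnboundedOp
open scoped ContDiff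

theorem ae_eq_of_forall_schwartz {μ : Measure E3} {f g : E3 → ℂ}
    (hf : LocallyIntegrable f μ) (hg : LocallyIntegrable g μ)
    (h : ∀ φ : 𝓢(E3, ℂ), ∫ x, φ x • f x ∂μ = ∫ x, φ x • g x ∂μ) : f =ᵐ[μ] g := by
  refine ae_eq_of_integral_contDiff_smul_eq hf hg fun φ hφ hφc => ?_
  have hg₁ : HasCompactSupport (Complex.ofRealCLM ∘ φ) := hφc.comp_left rfl
  have hg₂ : ContDiff ℝ ∞ (Complex.ofRealCLM ∘ φ) := by fun_prop
  simpa using h (hg₁.toSchwartzMap hg₂)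

theorem locallyIntegrable_coe {μ : Measure E3} [IsLocallyFiniteMeasure μ] (u : Lp ℂ 2 μ) :
    LocallyIntegrable u μ := (Lp.memLp u).locallyIntegrable one_le_two

theorem locallyIntegrable_mul_coe {g : E3 → ℂ} (hg : Continuous g) (u : L2E3) :
    LocallyIntegrable (fun ξ => g ξ * u ξ) volume :=
  (locallyIntegrable_coe u).continuous_smul hg

/-- Multiplication of an `L²` function by a function of temperate growth. -/
theorem smulLeftCLM_eq_iff {g : E3 → ℂ} (hg : g.HasTemperateGrowth) {u w : L2E3} :
    smulLeftCLM ℂ g (u : 𝓢'(E3, ℂ)) = (w : 𝓢'(E3, ℂ)) ↔ w =ᵐ[volume] fun ξ => g ξ * u ξ := by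
  have key : ∀ φ : 𝓢(E3, ℂ), smulLeftCLM ℂ g (u : 𝓢'(E3, ℂ)) φ = ∫ ξ, φ ξ • (g ξ * u ξ) := by
    intro φ
    rw [smulLeftCLM_apply_apply, Lp.toTemperedDistribution_apply]
    refine integral_congr_ae (ae_of_all _ fun ξ => ?_)
    simp only [SchwartzMap.smulLeftCLM_apply_apply hg, smul_eq_mul]
    ring
  constructor
  · intro h
    refine ae_eq_of_forall_schwartz (locallyIntegrable_coe w)
      (locallyIntegrable_mul_coe hg.1.continuous u) fun φ => ?_
    rw [← key, h, Lp.toTemperedDistribution_apply]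
  · intro h
    ext φ
    rw [key, Lp.toTemperedDistribution_apply]
    refine integral_congr_ae ?_
    filter_upwards [h] with ξ hξ
    rw [hξ]

theorem fourier_laplacian (u : 𝓢'(E3, ℂ)) :
    𝓕 (-Δ u) = smulLeftCLM ℂ (fun ξ : E3 => ((4 * Real.pi ^ 2 * ‖ξ‖ ^ 2 : ℝ) : ℂ)) (𝓕 u) := by
  rw [laplacian_eq_fourierMultiplierCLM, neg_smul, neg_neg, fourierMultiplierCLM_apply]
  have h1 : (fun ξ : E3 => ((4 * Real.pi ^ 2 * ‖ξ‖ ^ 2 : ℝ) : ℂ))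
      = ((4 * Real.pi ^ 2 : ℝ) : ℂ) • fun ξ : E3 => ((‖ξ‖ ^ 2 : ℝ) : ℂ) := by
    ext ξ
    simp
  rw [h1, smulLeftCLM_smul (by fun_prop), ← Complex.coe_smul, FourierTransform.fourier_smul,
    fourier_fourierInv_eq]
  norm_num [mul_pow]

theorem coe_toTemperedDistribution_injective {u v : L2E3}
    (h : (u : 𝓢'(E3, ℂ)) = (v : 𝓢'(E3, ℂ))) : u = v :=
  toTemperedDistribution_injective h

theorem eq_neg_laplacian_iff {u f : L2E3} :
    (f : 𝓢'(E3, ℂ)) = -Δ (u : 𝓢'(E3, ℂ)) ↔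
      (𝓕 f : L2E3) =ᵐ[volume] fun ξ => ((4 * Real.pi ^ 2 * ‖ξ‖ ^ 2 : ℝ) : ℂ) * (𝓕 u : L2E3) ξ := by
  rw [← smulLeftCLM_eq_iff (by fun_prop), ← Lp.fourier_toTemperedDistribution_eq,
    ← Lp.fourier_toTemperedDistribution_eq, ← fourier_laplacian]
  constructor
  · intro h
    rw [h]
  · intro h
    have := congrArg (fun x => 𝓕⁻ x) h
    simpa only [fourierInv_fourier_eq] using this.symm

theorem mem_sobolevH2_of_laplacian {u f : L2E3} (h : (f : 𝓢'(E3, ℂ)) = -Δ (u : 𝓢'(E3, ℂ))) :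
    u ∈ sobolevH2 := by
  change MemSobolev 2 2 (u : 𝓢'(E3, ℂ))
  rw [memSobolev_iff_exists_smulLeftCLM_fourier]
  -- With f = -Δu one has (1 + |ξ|²)û = û + (4π²)⁻¹f̂, which is square integrable.
  refine ⟨𝓕 u + ((4 * Real.pi ^ 2 : ℝ) : ℂ)⁻¹ • 𝓕 f, ?_⟩
  rw [Lp.fourier_toTemperedDistribution_eq, smulLeftCLM_eq_iff (by fun_prop)]
  filter_upwards [eq_neg_laplacian_iff.1 h,
    Lp.coeFn_add (𝓕 u) (((4 * Real.pi ^ 2 : ℝ) : ℂ)⁻¹ • 𝓕 f),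
    Lp.coeFn_smul (((4 * Real.pi ^ 2 : ℝ) : ℂ)⁻¹) (𝓕 f : L2E3)] with ξ h1 h2 h3
  rw [h2, Pi.add_apply, h3, Pi.smul_apply, h1]
  have hpi : (Real.pi : ℂ) ≠ 0 := by exact_mod_cast Real.pi_ne_zero
  simp only [smul_eq_mul]
  norm_num
  field_simp

/-- The condition u ∈ H² is automatic here: u and Δu in L² already imply it. -/
theorem mem_graph_freeLaplacian {u f : L2E3} :
    (u, f) ∈ freeLaplacian.graph ↔ (f : 𝓢'(E3, ℂ)) = -Δ (u : 𝓢'(E3, ℂ)) := by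
  rw [LinearPMap.mem_graph_iff]
  constructor
  · rintro ⟨y, rfl, rfl⟩
    exact (exists_laplacian_of_mem_sobolevH2 y.2).choose_spec
  · intro h
    refine ⟨⟨u, mem_sobolevH2_of_laplacian h⟩, rfl, coe_toTemperedDistribution_injective ?_⟩
    rw [h]
    exact (exists_laplacian_of_mem_sobolevH2 (mem_sobolevH2_of_laplacian h)).choose_spec

/-- The symbol `(4π²|ξ|² - lam)⁻¹` of the resolvent of the free Laplacian. -/
def resolventSymbol (lam : ℝ) (ξ : E3) : ℝ := (4 * Real.pi ^ 2 * ‖ξ‖ ^ 2 - lam)⁻¹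

/-! ### Size and integrability of the resolvent symbol -/

section Symbol

variable {lam : ℝ}

theorem symbol_denom_pos (hlam : lam < 0) (ξ : E3) : 0 < 4 * Real.pi ^ 2 * ‖ξ‖ ^ 2 - lam := by
  have : 0 ≤ 4 * Real.pi ^ 2 * ‖ξ‖ ^ 2 := by positivity
  linarith

theorem resolventSymbol_pos (hlam : lam < 0) (ξ : E3) : 0 < resolventSymbol lam ξ :=
  inv_pos.2 (symbol_denom_pos hlam ξ)

theorem continuous_resolventSymbol (hlam : lam < 0) : Continuous (resolventSymbol lam) :=
  Continuous.inv₀ (by fun_prop) fun ξ => (symbol_denom_pos hlam ξ).ne'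

theorem resolventSymbol_le (hlam : lam < 0) (ξ : E3) : resolventSymbol lam ξ ≤ (-lam)⁻¹ := by
  refine inv_anti₀ (by linarith) ?_
  have : 0 ≤ 4 * Real.pi ^ 2 * ‖ξ‖ ^ 2 := by positivity
  linarith

theorem resolventSymbol_le_bracket (hlam : lam < 0) (ξ : E3) :
    resolventSymbol lam ξ ≤ (min 1 (-lam))⁻¹ * (1 + ‖ξ‖ ^ 2)⁻¹ := by
  have h0 : 0 < min 1 (-lam) := lt_min one_pos (by linarith)
  rw [resolventSymbol, ← mul_inv]
  refine inv_anti₀ (by positivity) ?_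
  have hpi : 1 ≤ 4 * Real.pi ^ 2 := by nlinarith [Real.pi_gt_three]
  have h1 : min 1 (-lam) ≤ 1 := min_le_left _ _
  have h2 : min 1 (-lam) ≤ -lam := min_le_right _ _
  nlinarith [sq_nonneg ‖ξ‖]

/-- The square decays like |ξ|⁻⁴, and 4 > 3. This use of the dimension is what puts Green's
function, and hence the range of γ_λ, into L². -/
theorem memLp_resolventSymbol (hlam : lam < 0) : MemLp (resolventSymbol lam) 2 volume := by
  have hbr : MemLp (fun ξ : E3 => (1 + ‖ξ‖ ^ 2)⁻¹) 2 volume := by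
    rw [memLp_two_iff_integrable_sq (by fun_prop)]
    have := integrable_rpow_neg_one_add_norm_sq (μ := (volume : Measure E3)) (r := 4)
      (by simp; norm_num)
    refine this.congr (ae_of_all _ fun ξ => ?_)
    change (1 + ‖ξ‖ ^ 2) ^ (-4 / 2 : ℝ) = ((1 + ‖ξ‖ ^ 2)⁻¹) ^ 2
    rw [show (-4 / 2 : ℝ) = -((2 : ℕ) : ℝ) by norm_num, Real.rpow_neg (by positivity),
      Real.rpow_natCast, inv_pow]
  refine (hbr.const_mul (min 1 (-lam))⁻¹).mono
    (continuous_resolventSymbol hlam).aestronglyMeasurable (ae_of_all _ fun ξ => ?_)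
  rw [Real.norm_of_nonneg (resolventSymbol_pos hlam ξ).le]
  exact (resolventSymbol_le_bracket hlam ξ).trans (le_abs_self _)

theorem memLp_top_resolventSymbol (hlam : lam < 0) :
    MemLp (fun ξ => (resolventSymbol lam ξ : ℂ)) ∞ (volume : Measure E3) := by
  refine memLp_top_of_bound (Complex.continuous_ofReal.comp
    (continuous_resolventSymbol hlam)).aestronglyMeasurable (-lam)⁻¹ (ae_of_all _ fun ξ => ?_)
  rw [Complex.norm_real, Real.norm_of_nonneg (resolventSymbol_pos hlam ξ).le]
  exact resolventSymbol_le hlam ξ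

end Symbol

open Classical in
/-- Multiplication by the resolvent symbol. -/
def symbolMul (lam : ℝ) : L2E3 →L[ℂ] L2E3 :=
  if hlam : lam < 0 then
    (ContinuousLinearMap.mul ℂ ℂ).holderL volume ∞ 2 2 ((memLp_top_resolventSymbol hlam).toLp _)
  else 0

theorem coeFn_symbolMul {lam : ℝ} (hlam : lam < 0) (f : L2E3) :
    symbolMul lam f =ᵐ[volume] fun ξ => (resolventSymbol lam ξ : ℂ) * f ξ := by
  rw [symbolMul, dif_pos hlam]
  filter_upwards [(ContinuousLinearMap.mul ℂ ℂ).coeFn_holder (r := 2)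
    ((memLp_top_resolventSymbol hlam).toLp _) f, (memLp_top_resolventSymbol hlam).coeFn_toLp]
    with ξ h1 h2
  change ((ContinuousLinearMap.mul ℂ ℂ).holder 2
    ((memLp_top_resolventSymbol hlam).toLp _) f) ξ = _
  rw [h1, h2]
  rfl

/-- The Fourier transform on `L²(ℝ³)` as a bounded operator. -/
def fourierL2 : L2E3 ≃ₗᵢ[ℂ] L2E3 := Lp.fourierTransformₗᵢ E3 ℂ

theorem fourierL2_apply (f : L2E3) : fourierL2 f = 𝓕 f := rfl

/-- The resolvent of the free Laplacian, as a Fourier multiplier. -/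
def freeResolvent (lam : ℝ) : L2E3 →L[ℂ] L2E3 :=
  (fourierL2.symm.toContinuousLinearEquiv : L2E3 →L[ℂ] L2E3) ∘L symbolMul lam ∘L
    (fourierL2.toContinuousLinearEquiv : L2E3 →L[ℂ] L2E3)

theorem freeResolvent_apply (lam : ℝ) (f : L2E3) :
    freeResolvent lam f = fourierL2.symm (symbolMul lam (fourierL2 f)) := rfl

theorem fourierL2_freeResolvent (lam : ℝ) (f : L2E3) :
    fourierL2 (freeResolvent lam f) = symbolMul lam (fourierL2 f) := by
  rw [freeResolvent_apply, LinearIsometryEquiv.apply_symm_apply]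

theorem isBoundedInverse_freeResolvent {lam : ℝ} (hlam : lam < 0) :
    IsBoundedInverse (subScalar freeLaplacian lam) (freeResolvent lam) := by
  intro u v
  rw [mem_graph_subScalar, mem_graph_freeLaplacian, eq_neg_laplacian_iff, ← fourierL2_apply,
    ← fourierL2_apply, map_add, map_smul, ← fourierL2.injective.eq_iff, fourierL2_freeResolvent,
    Lp.ext_iff]
  have h1 := Lp.coeFn_add (fourierL2 v) ((lam : ℂ) • fourierL2 u)
  have h2 := Lp.coeFn_smul (lam : ℂ) (fourierL2 u)
  have h3 := coeFn_symbolMul hlam (fourierL2 v)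
  have hne : ∀ ξ : E3, ((4 * Real.pi ^ 2 * ‖ξ‖ ^ 2 - lam : ℝ) : ℂ) ≠ 0 := fun ξ => by
    exact_mod_cast (symbol_denom_pos hlam ξ).ne'
  constructor
  · intro h
    filter_upwards [h, h1, h2, h3] with ξ h h1 h2 h3
    rw [h1, Pi.add_apply, h2, Pi.smul_apply, smul_eq_mul] at h
    rw [h3, resolventSymbol, Complex.ofReal_inv, eq_inv_mul_iff_mul_eq₀ (hne ξ)]
    push_cast at h ⊢
    linear_combination -h
  · intro h
    filter_upwards [h, h1, h2, h3] with ξ h h1 h2 h3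
    rw [h3, resolventSymbol, Complex.ofReal_inv, eq_inv_mul_iff_mul_eq₀ (hne ξ)] at h
    rw [h1, Pi.add_apply, h2, Pi.smul_apply, smul_eq_mul]
    push_cast at h ⊢
    linear_combination -h

theorem symbolMul_inner {lam : ℝ} (hlam : lam < 0) (f g : L2E3) :
    inner ℂ (symbolMul lam f) g = inner ℂ f (symbolMul lam g) := by
  rw [L2.inner_def, L2.inner_def]
  refine integral_congr_ae ?_
  filter_upwards [coeFn_symbolMul hlam f, coeFn_symbolMul hlam g] with ξ h1 h2
  rw [h1, h2]
  simp only [RCLike.inner_apply, map_mul, Complex.conj_ofReal]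
  ring

theorem isSelfAdjoint_freeResolvent {lam : ℝ} (hlam : lam < 0) :
    IsSelfAdjoint (freeResolvent lam) := by
  rw [ContinuousLinearMap.isSelfAdjoint_iff']
  symm
  rw [ContinuousLinearMap.eq_adjoint_iff]
  intro f g
  rw [← fourierL2.inner_map_map, ← fourierL2.inner_map_map f, fourierL2_freeResolvent,
    fourierL2_freeResolvent, symbolMul_inner hlam]

end

noncomputable section

/-! ### The Yukawa potential as a superposition of heat kernels -/

/-- The antiderivative `∫₀ˣ exp (-s²) ds` of the Gaussian. -/
def gaussPrimitive (x : ℝ) : ℝ := ∫ s in (0 : ℝ)..x, Real.exp (-s ^ 2)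

theorem hasDerivAt_gaussPrimitive (x : ℝ) :
    HasDerivAt gaussPrimitive (Real.exp (-x ^ 2)) x :=
  (Continuous.integral_hasStrictDerivAt (by fun_prop) 0 x).hasDerivAt

theorem gaussPrimitive_neg (x : ℝ) : gaussPrimitive (-x) = -gaussPrimitive x := by
  have h := intervalIntegral.integral_comp_neg (a := 0) (b := x) fun s : ℝ => Real.exp (-s ^ 2)
  rw [neg_zero] at h
  rw [gaussPrimitive, intervalIntegral.integral_symm, ← h]
  simp [gaussPrimitive]

theorem tendsto_gaussPrimitive_atTop :
    Tendsto gaussPrimitive atTop (𝓝 (√Real.pi / 2)) := by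
  have h1 : Integrable fun s : ℝ => Real.exp (-s ^ 2) := by
    simpa using integrable_exp_neg_mul_sq one_pos
  have h2 := intervalIntegral_tendsto_integral_Ioi 0 h1.integrableOn tendsto_id
  have h3 := integral_gaussian_Ioi 1
  simp only [neg_mul, one_mul, div_one] at h3
  rw [h3] at h2
  exact h2

theorem tendsto_gaussPrimitive_atBot :
    Tendsto gaussPrimitive atBot (𝓝 (-(√Real.pi / 2))) := by
  have := (tendsto_gaussPrimitive_atTop.comp tendsto_neg_atBot_atTop).neg
  refine this.congr fun x => ?_
  rw [Function.comp_apply, gaussPrimitive_neg, neg_neg]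

/-- A primitive of `t ↦ -(r / 2) t^{-3/2} exp (-r² / (4 t) - κ² t)`. -/
def heatPrimitive (r κ t : ℝ) : ℝ :=
  Real.exp (κ * r) * gaussPrimitive (r / 2 * (√t)⁻¹ + κ * √t) +
    Real.exp (-(κ * r)) * gaussPrimitive (r / 2 * (√t)⁻¹ - κ * √t)

theorem hasDerivAt_heatPrimitive (r κ : ℝ) {t : ℝ} (ht : 0 < t) :
    HasDerivAt (heatPrimitive r κ)
      (-(r / 2) * ((t * √t)⁻¹ * Real.exp (-r ^ 2 / (4 * t) - κ ^ 2 * t))) t := by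
  have hs : 0 < √t := Real.sqrt_pos.2 ht
  have hss : √t ^ 2 = t := Real.sq_sqrt ht.le
  have h1 : HasDerivAt (fun t => √t) (1 / (2 * √t)) t := Real.hasDerivAt_sqrt ht.ne'
  have h2 : HasDerivAt (fun t => (√t)⁻¹) (-(1 / (2 * √t)) / √t ^ 2) t := h1.inv hs.ne'
  have hp := (h2.const_mul (r / 2)).add (h1.const_mul κ)
  have hq := (h2.const_mul (r / 2)).sub (h1.const_mul κ)
  have h3 := (((hasDerivAt_gaussPrimitive _).comp t hp).const_mul (Real.exp (κ * r))).add
    (((hasDerivAt_gaussPrimitive _).comp t hq).const_mul (Real.exp (-(κ * r))))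
  refine h3.congr_deriv ?_
  simp only [Pi.add_apply, Pi.sub_apply]
  -- Completing the square: (r/(2√t) ± κ√t)² = r²/(4t) ± κr + κ²t. The prefactor exp(±κr) removes
  -- the cross term.
  have e1 : Real.exp (κ * r) * Real.exp (-(r / 2 * (√t)⁻¹ + κ * √t) ^ 2)
      = Real.exp (-r ^ 2 / (4 * t) - κ ^ 2 * t) := by
    rw [← Real.exp_add]
    congr 1
    have : (r / 2 * (√t)⁻¹ + κ * √t) ^ 2 = r ^ 2 / (4 * √t ^ 2) + κ * r + κ ^ 2 * √t ^ 2 := by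
      field_simp; ring
    rw [this, hss]
    ring
  have e2 : Real.exp (-(κ * r)) * Real.exp (-(r / 2 * (√t)⁻¹ - κ * √t) ^ 2)
      = Real.exp (-r ^ 2 / (4 * t) - κ ^ 2 * t) := by
    rw [← Real.exp_add]
    congr 1
    have : (r / 2 * (√t)⁻¹ - κ * √t) ^ 2 = r ^ 2 / (4 * √t ^ 2) - κ * r + κ ^ 2 * √t ^ 2 := by
      field_simp; ring
    rw [this, hss]
    ring
  rw [← mul_assoc, ← mul_assoc, e1, e2, hss]
  field_simp
  ring

theorem tendsto_heatPrimitive_atTop (r : ℝ) {κ : ℝ} (hκ : 0 < κ) :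
    Tendsto (heatPrimitive r κ) atTop
      (𝓝 (Real.exp (κ * r) * (√Real.pi / 2) + Real.exp (-(κ * r)) * -(√Real.pi / 2))) := by
  have h1 : Tendsto (fun t : ℝ => r / 2 * (√t)⁻¹) atTop (𝓝 0) := by
    simpa using (tendsto_inv_atTop_zero.comp Real.tendsto_sqrt_atTop).const_mul (r / 2)
  have h2 : Tendsto (fun t : ℝ => κ * √t) atTop atTop :=
    Real.tendsto_sqrt_atTop.const_mul_atTop hκ
  refine ((tendsto_gaussPrimitive_atTop.comp (h1.add_atTop h2)).const_mul _).add
    ((tendsto_gaussPrimitive_atBot.comp ?_).const_mul _)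
  simp only [sub_eq_add_neg]
  exact h1.add_atBot (tendsto_neg_atTop_atBot.comp h2)

theorem tendsto_heatPrimitive_zero {r : ℝ} (hr : 0 < r) (κ : ℝ) :
    Tendsto (heatPrimitive r κ) (𝓝[>] 0)
      (𝓝 (Real.exp (κ * r) * (√Real.pi / 2) + Real.exp (-(κ * r)) * (√Real.pi / 2))) := by
  have h0 : Tendsto (fun t : ℝ => √t) (𝓝[>] 0) (𝓝[>] 0) := by
    refine tendsto_nhdsWithin_iff.2 ⟨?_, ?_⟩
    · have := (Real.continuous_sqrt.tendsto 0).mono_left (nhdsWithin_le_nhds (s := Ioi 0))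
      simpa using this
    · filter_upwards [self_mem_nhdsWithin] with t ht using Real.sqrt_pos.2 ht
  have h1 : Tendsto (fun t : ℝ => r / 2 * (√t)⁻¹) (𝓝[>] 0) atTop :=
    (tendsto_inv_nhdsGT_zero.comp h0).const_mul_atTop (by positivity)
  have h2 : Tendsto (fun t : ℝ => κ * √t) (𝓝[>] 0) (𝓝 0) := by
    have := (h0.mono_right nhdsWithin_le_nhds).const_mul κ
    simpa using this
  refine ((tendsto_gaussPrimitive_atTop.comp (h1.atTop_add h2)).const_mul _).add
    ((tendsto_gaussPrimitive_atTop.comp ?_).const_mul _)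
  simp only [sub_eq_add_neg]
  exact h1.atTop_add (C := -0) h2.neg

/-- The Laplace transform of the heat kernel in dimension three. -/
theorem integral_heat {r κ : ℝ} (hr : 0 < r) (hκ : 0 < κ) :
    IntegrableOn (fun t : ℝ => (t * √t)⁻¹ * Real.exp (-r ^ 2 / (4 * t) - κ ^ 2 * t)) (Ioi 0) ∧
      ∫ t in Ioi (0 : ℝ), (t * √t)⁻¹ * Real.exp (-r ^ 2 / (4 * t) - κ ^ 2 * t)
        = 2 * √Real.pi * Real.exp (-(κ * r)) / r := by
  set l := Real.exp (κ * r) * (√Real.pi / 2) + Real.exp (-(κ * r)) * (√Real.pi / 2) with hl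
  -- Giving the primitive its limit as value at 0 makes it continuous on [0,∞). As its derivative
  -- has constant sign, integrability and the value of the integral follow from the limits at 0 and
  -- ∞.
  set G : ℝ → ℝ := Function.update (heatPrimitive r κ) 0 l with hG
  have hG0 : G 0 = l := Function.update_self ..
  have hcont : ContinuousWithinAt G (Ici 0) 0 := by
    rw [← continuousWithinAt_sdiff_self, Ici_sdiff_left, ContinuousWithinAt, hG0]
    refine (tendsto_heatPrimitive_zero hr κ).congr' ?_
    filter_upwards [self_mem_nhdsWithin] with t ht
    rw [hG, Function.update_of_ne (ne_of_gt ht)]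
  have hderiv : ∀ t ∈ Ioi (0 : ℝ), HasDerivAt G
      (-(r / 2) * ((t * √t)⁻¹ * Real.exp (-r ^ 2 / (4 * t) - κ ^ 2 * t))) t := by
    intro t ht
    refine (hasDerivAt_heatPrimitive r κ ht).congr_of_eventuallyEq ?_
    filter_upwards [Ioi_mem_nhds ht] with s hs
    rw [hG, Function.update_of_ne (ne_of_gt hs)]
  have hneg : ∀ t ∈ Ioi (0 : ℝ),
      -(r / 2) * ((t * √t)⁻¹ * Real.exp (-r ^ 2 / (4 * t) - κ ^ 2 * t)) ≤ 0 := by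
    intro t ht
    have : 0 ≤ (t * √t)⁻¹ * Real.exp (-r ^ 2 / (4 * t) - κ ^ 2 * t) := by
      have : 0 < t := ht
      positivity
    nlinarith
  have hlim : Tendsto G atTop (𝓝 (Real.exp (κ * r) * (√Real.pi / 2) +
      Real.exp (-(κ * r)) * -(√Real.pi / 2))) := by
    refine (tendsto_heatPrimitive_atTop r hκ).congr' ?_
    filter_upwards [Ioi_mem_atTop 0] with t ht
    rw [hG, Function.update_of_ne (ne_of_gt ht)]
  have h1 := integrableOn_Ioi_deriv_of_nonpos hcont hderiv hneg hlim
  have h2 := integral_Ioi_of_hasDerivAt_of_nonpos hcont hderiv hneg hlim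
  constructor
  · refine (h1.const_mul (-(r / 2))⁻¹).congr (ae_of_all _ fun t => ?_)
    dsimp only
    rw [inv_mul_cancel_left₀]
    linarith [hr]
  · rw [integral_const_mul, hG0, hl] at h2
    rw [eq_div_iff hr.ne']
    linear_combination -2 * h2

end

noncomputable section

open FourierTransform UnboundedOp
open scoped ContDiff RealInnerProductSpace

/-! ### Green's function of the free Laplacian -/

/-- The Yukawa potential `exp(-√(-lam) r) / (4π r)`. -/
def yukawa (lam r : ℝ) : ℝ := Real.exp (-(Real.sqrt (-lam) * r)) / (4 * Real.pi * r)

/-- The heat kernel `(4πt)^{-3/2} exp (-r² / (4t))`. -/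
def heatKernel (r t : ℝ) : ℝ :=
  (4 * Real.pi * t * √(4 * Real.pi * t))⁻¹ * Real.exp (-r ^ 2 / (4 * t))

theorem heatKernel_mul_exp (r lam : ℝ) (t : ℝ) :
    heatKernel r t * Real.exp (lam * t) = (8 * Real.pi * √Real.pi)⁻¹ *
      ((t * √t)⁻¹ * Real.exp (-r ^ 2 / (4 * t) - (-lam) * t)) := by
  have h4 : √(4 * Real.pi * t) = 2 * √Real.pi * √t := by
    rw [Real.sqrt_mul (by positivity), Real.sqrt_mul (by norm_num),
      show (4 : ℝ) = 2 ^ 2 by norm_num, Real.sqrt_sq (by norm_num)]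
  rw [heatKernel, h4, mul_assoc, ← Real.exp_add]
  have h5 : -r ^ 2 / (4 * t) + lam * t = -r ^ 2 / (4 * t) - (-lam) * t := by ring
  rw [h5, ← mul_assoc (8 * Real.pi * √Real.pi)⁻¹, ← mul_inv]
  congr 2
  ring

theorem integral_heatKernel {r lam : ℝ} (hr : 0 < r) (hlam : lam < 0) :
    IntegrableOn (fun t => heatKernel r t * Real.exp (lam * t)) (Ioi 0) ∧
      ∫ t in Ioi (0 : ℝ), heatKernel r t * Real.exp (lam * t) = yukawa lam r := by
  have hκ : 0 < √(-lam) := Real.sqrt_pos.2 (by linarith)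
  have hsq : √(-lam) ^ 2 = -lam := Real.sq_sqrt (by linarith)
  obtain ⟨h1, h2⟩ := integral_heat hr hκ
  rw [hsq] at h1 h2
  simp only [heatKernel_mul_exp]
  refine ⟨h1.const_mul _, ?_⟩
  rw [integral_const_mul, h2, yukawa]
  have : 0 < √Real.pi := Real.sqrt_pos.2 Real.pi_pos
  field_simp
  norm_num

theorem fourierInv_gaussian (v : E3) {t : ℝ} (ht : 0 < t) :
    ∫ ξ : E3, (Real.fourierChar ⟪ξ, v⟫ : ℂ) * (Real.exp (-(4 * Real.pi ^ 2 * ‖ξ‖ ^ 2) * t) : ℝ)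
      = (heatKernel ‖v‖ t : ℝ) := by
  have hb : 0 < (((4 * Real.pi ^ 2 * t : ℝ) : ℂ)).re := by
    rw [Complex.ofReal_re]; positivity
  -- The inverse transform at v is the forward transform at -v.
  have h := fourier_gaussian_innerProductSpace (V := E3) hb (-v)
  rw [Real.fourier_eq] at h
  have hl : ∫ ξ : E3, (Real.fourierChar ⟪ξ, v⟫ : ℂ) *
      (Real.exp (-(4 * Real.pi ^ 2 * ‖ξ‖ ^ 2) * t) : ℝ) =
      ∫ ξ : E3, Real.fourierChar (-⟪ξ, -v⟫) •
        Complex.exp (-((4 * Real.pi ^ 2 * t : ℝ) : ℂ) * (‖ξ‖ : ℂ) ^ 2) := by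
    refine integral_congr_ae (ae_of_all _ fun ξ => ?_)
    simp only [inner_neg_right, neg_neg, Circle.smul_def, smul_eq_mul]
    congr 1
    rw [Complex.ofReal_exp]
    congr 1
    push_cast
    ring
  rw [hl, h]
  have hx : ((Real.pi : ℂ) / ((4 * Real.pi ^ 2 * t : ℝ) : ℂ)) =
      (((4 * Real.pi * t)⁻¹ : ℝ) : ℂ) := by
    rw [← Complex.ofReal_div]
    congr 1
    field_simp
  have hpow : ((4 * Real.pi * t)⁻¹ : ℝ) ^ (3 / 2 : ℝ) =
      (4 * Real.pi * t * √(4 * Real.pi * t))⁻¹ := by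
    rw [show (3 / 2 : ℝ) = 1 + 1 / 2 by norm_num, Real.rpow_add (by positivity), Real.rpow_one,
      ← Real.sqrt_eq_rpow, Real.sqrt_inv, ← mul_inv]
  have hfin : ((Module.finrank ℝ E3 : ℂ) / 2) = ((3 / 2 : ℝ) : ℂ) := by
    simp
  rw [hfin, hx, ← Complex.ofReal_cpow (by positivity), hpow, heatKernel,
    Complex.ofReal_mul (4 * Real.pi * t * √(4 * Real.pi * t))⁻¹, Complex.ofReal_exp]
  congr 2
  rw [norm_neg]
  have hpi : (Real.pi : ℂ) ≠ 0 := by exact_mod_cast Real.pi_ne_zero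
  have htc : (t : ℂ) ≠ 0 := by exact_mod_cast ht.ne'
  push_cast
  field_simp

theorem integral_exp_symbol {lam : ℝ} (hlam : lam < 0) (ξ : E3) :
    IntegrableOn (fun t => Real.exp (-(4 * Real.pi ^ 2 * ‖ξ‖ ^ 2) * t) * Real.exp (lam * t))
      (Ioi 0) ∧
      ∫ t in Ioi (0 : ℝ), Real.exp (-(4 * Real.pi ^ 2 * ‖ξ‖ ^ 2) * t) * Real.exp (lam * t)
        = resolventSymbol lam ξ := by
  have hpos := symbol_denom_pos hlam ξ
  have heq : ∀ t : ℝ, Real.exp (-(4 * Real.pi ^ 2 * ‖ξ‖ ^ 2) * t) * Real.exp (lam * t)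
      = Real.exp (-(4 * Real.pi ^ 2 * ‖ξ‖ ^ 2 - lam) * t) := fun t => by
    rw [← Real.exp_add]
    congr 1
    ring
  simp only [heq]
  refine ⟨exp_neg_integrableOn_Ioi 0 hpos, ?_⟩
  rw [integral_exp_mul_Ioi (by linarith) 0, resolventSymbol]
  simp only [mul_zero, Real.exp_zero]
  rw [neg_div_neg_eq, one_div]

theorem resolventSymbol_sub {lam mu : ℝ} (hlam : lam < 0) (hmu : mu < 0) (ξ : E3) :
    resolventSymbol lam ξ - resolventSymbol mu ξ
      = (lam - mu) * (resolventSymbol lam ξ * resolventSymbol mu ξ) := by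
  have h1 := (symbol_denom_pos hlam ξ).ne'
  have h2 := (symbol_denom_pos hmu ξ).ne'
  rw [resolventSymbol, resolventSymbol]
  field_simp
  ring

theorem integrable_symbol_mul {lam mu : ℝ} (hlam : lam < 0) (hmu : mu < 0) :
    Integrable (fun ξ : E3 => resolventSymbol lam ξ * resolventSymbol mu ξ) :=
  (memLp_resolventSymbol hlam).integrable_mul (memLp_resolventSymbol hmu)

theorem integrable_symbol_mul_complex {lam mu : ℝ} (hlam : lam < 0) (hmu : mu < 0) :
    Integrable (fun ξ : E3 => ((resolventSymbol lam ξ * resolventSymbol mu ξ : ℝ) : ℂ)) :=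
  (integrable_symbol_mul hlam hmu).ofReal

/-- Both sides are superpositions over t > 0 of Gaussians with weight e^{λt} - e^{μt}, and Fubini
exchanges the ξ- and t-integrals. A single symbol is not integrable on ℝ³, whereas the product is;
for μ ≤ λ the weight is nonnegative, so absolute convergence is the integrability of that product.
-/
theorem fourierInv_symbol_of_le {lam mu : ℝ} (hlam : lam < 0) (hmu : mu < 0) (hle : mu ≤ lam)
    {v : E3} (hv : v ≠ 0) :
    ((lam - mu : ℝ) : ℂ) *
        ∫ ξ : E3, (Real.fourierChar ⟪ξ, v⟫ : ℂ) *
          ((resolventSymbol lam ξ * resolventSymbol mu ξ : ℝ) : ℂ)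
      = ((yukawa lam ‖v‖ - yukawa mu ‖v‖ : ℝ) : ℂ) := by
  have hv' : 0 < ‖v‖ := norm_pos_iff.2 hv
  set w : ℝ → ℝ := fun t => Real.exp (lam * t) - Real.exp (mu * t) with hw
  set g : E3 → ℝ → ℝ := fun ξ t => Real.exp (-(4 * Real.pi ^ 2 * ‖ξ‖ ^ 2) * t) * w t with hg
  have hwpos : ∀ t ∈ Ioi (0 : ℝ), 0 ≤ w t := fun t ht => by
    rw [hw]
    exact sub_nonneg.2 (Real.exp_le_exp.2 (mul_le_mul_of_nonneg_right hle (le_of_lt ht)))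
  have hgint : ∀ ξ, IntegrableOn (g ξ) (Ioi 0) := fun ξ => by
    have := (integral_exp_symbol hlam ξ).1.sub (integral_exp_symbol hmu ξ).1
    refine this.congr (ae_of_all _ fun t => ?_)
    simp only [hg, hw, Pi.sub_apply]
    ring
  have hgval : ∀ ξ, ∫ t in Ioi (0 : ℝ), g ξ t
      = (lam - mu) * (resolventSymbol lam ξ * resolventSymbol mu ξ) := fun ξ => by
    rw [← resolventSymbol_sub hlam hmu, ← (integral_exp_symbol hlam ξ).2,
      ← (integral_exp_symbol hmu ξ).2,
      ← integral_sub (integral_exp_symbol hlam ξ).1 (integral_exp_symbol hmu ξ).1]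
    refine integral_congr_ae (ae_of_all _ fun t => ?_)
    simp only [hg, hw]
    ring
  set G : E3 → ℝ → ℂ := fun ξ t => (Real.fourierChar ⟪ξ, v⟫ : ℂ) * (g ξ t : ℂ) with hG
  have hGc : Continuous (Function.uncurry G) := by
    simp only [hG, hg, hw]
    fun_prop
  have hnorm : ∀ ξ, ∀ t ∈ Ioi (0 : ℝ), ‖G ξ t‖ = g ξ t := fun ξ t ht => by
    simp only [hG, norm_mul, Circle.norm_coe, one_mul, Complex.norm_real]
    exact Real.norm_of_nonneg (mul_nonneg (Real.exp_pos _).le (hwpos t ht))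
  have hGint : Integrable (Function.uncurry G) (volume.prod (volume.restrict (Ioi (0 : ℝ)))) := by
    rw [integrable_prod_iff hGc.aestronglyMeasurable]
    refine ⟨ae_of_all _ fun ξ => ?_, ?_⟩
    · have h1 : Integrable (fun t => ((g ξ t : ℝ) : ℂ)) (volume.restrict (Ioi 0)) :=
        (hgint ξ).ofReal
      exact h1.const_mul (Real.fourierChar ⟪ξ, v⟫ : ℂ)
    · refine ((integrable_symbol_mul hlam hmu).const_mul (lam - mu)).congr
        (ae_of_all _ fun ξ => ?_)
      dsimp only
      rw [← hgval ξ]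
      exact setIntegral_congr_fun measurableSet_Ioi fun t ht => (hnorm ξ t ht).symm
  have hswap := integral_integral_swap hGint
  have hleft : ∫ ξ : E3, ∫ t in Ioi (0 : ℝ), G ξ t = ((lam - mu : ℝ) : ℂ) *
        ∫ ξ : E3, (Real.fourierChar ⟪ξ, v⟫ : ℂ) *
          ((resolventSymbol lam ξ * resolventSymbol mu ξ : ℝ) : ℂ) := by
    rw [← integral_const_mul]
    refine integral_congr_ae (ae_of_all _ fun ξ => ?_)
    simp only [hG]
    rw [integral_const_mul, integral_complex_ofReal, hgval]
    push_cast
    ring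
  have hright : ∫ t in Ioi (0 : ℝ), ∫ ξ : E3, G ξ t
      = ((yukawa lam ‖v‖ - yukawa mu ‖v‖ : ℝ) : ℂ) := by
    rw [← (integral_heatKernel hv' hlam).2, ← (integral_heatKernel hv' hmu).2,
      ← integral_sub (integral_heatKernel hv' hlam).1 (integral_heatKernel hv' hmu).1,
      ← integral_complex_ofReal]
    refine setIntegral_congr_fun measurableSet_Ioi fun t ht => ?_
    have h1 : ∀ ξ, G ξ t = (w t : ℂ) * ((Real.fourierChar ⟪ξ, v⟫ : ℂ) *
        (Real.exp (-(4 * Real.pi ^ 2 * ‖ξ‖ ^ 2) * t) : ℝ)) := fun ξ => by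
      simp only [hG, hg]
      push_cast
      ring
    simp only [h1]
    rw [integral_const_mul, fourierInv_gaussian v ht, hw]
    push_cast
    ring
  rw [← hleft, hswap, hright]

theorem fourierInv_symbol {lam mu : ℝ} (hlam : lam < 0) (hmu : mu < 0) {v : E3} (hv : v ≠ 0) :
    ((lam - mu : ℝ) : ℂ) *
        ∫ ξ : E3, (Real.fourierChar ⟪ξ, v⟫ : ℂ) *
          ((resolventSymbol lam ξ * resolventSymbol mu ξ : ℝ) : ℂ)
      = ((yukawa lam ‖v‖ - yukawa mu ‖v‖ : ℝ) : ℂ) := by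
  rcases le_total mu lam with h | h
  · exact fourierInv_symbol_of_le hlam hmu h hv
  · have h1 := fourierInv_symbol_of_le hmu hlam h hv
    simp only [mul_comm (resolventSymbol mu _)] at h1
    have h2 : ((lam - mu : ℝ) : ℂ) = -((mu - lam : ℝ) : ℂ) := by push_cast; ring
    rw [h2, neg_mul, h1]
    push_cast
    ring

end

noncomputable section

open FourierTransform UnboundedOp
open scoped ContDiff RealInnerProductSpace

/-! ### Green vectors -/

theorem integral_fourierInv_schwartz_mul (φ : 𝓢(E3, ℂ)) {w : E3 → ℂ} (hw : Integrable w) :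
    ∫ ξ, (𝓕⁻ φ) ξ • w ξ = ∫ x, φ x • ∫ ξ, (Real.fourierChar ⟪ξ, x⟫ : ℂ) * w ξ := by
  have h := VectorFourier.integral_fourierIntegral_smul_eq_flip (L := -innerₗ E3) (μ := volume)
    (ν := volume) Real.continuous_fourierChar
    (by simp only [LinearMap.neg_apply, innerₗ_apply_apply]; fun_prop) φ.integrable hw
  have h1 : ∀ ξ, VectorFourier.fourierIntegral Real.fourierChar volume (-innerₗ E3) φ ξ
      = (𝓕⁻ φ) ξ := fun ξ => by
    rw [SchwartzMap.fourierInv_coe, Real.fourierInv_eq]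
    simp [VectorFourier.fourierIntegral]
  have h2 : ∀ x, VectorFourier.fourierIntegral Real.fourierChar volume (-innerₗ E3).flip w x
      = ∫ ξ, (Real.fourierChar ⟪ξ, x⟫ : ℂ) * w ξ := fun x => by
    simp [VectorFourier.fourierIntegral, Circle.smul_def, real_inner_comm]
  simpa only [h1, h2] using h

theorem continuous_fourierInv_integral {w : E3 → ℂ} (hw : Integrable w) :
    Continuous fun x : E3 => ∫ ξ, (Real.fourierChar ⟪ξ, x⟫ : ℂ) * w ξ := by
  refine continuous_of_dominated (bound := fun ξ => ‖w ξ‖) (fun x => ?_) (fun x => ?_) hw.norm ?_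
  · exact (by fun_prop : Continuous fun ξ : E3 =>
      (Real.fourierChar ⟪ξ, x⟫ : ℂ)).aestronglyMeasurable.mul
      hw.1
  · exact ae_of_all _ fun ξ => by rw [norm_mul, Circle.norm_coe, one_mul]
  · exact ae_of_all _ fun ξ => by fun_prop

/-- Links the inverse transform on L², defined by extension, to the integral formula when w is also
in L¹; the two are compared against Schwartz functions. -/
theorem fourierL2_symm_ae_eq {w : L2E3} (hw : Integrable w) :
    fourierL2.symm w =ᵐ[volume] fun x => ∫ ξ, (Real.fourierChar ⟪ξ, x⟫ : ℂ) * w ξ := by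
  refine ae_eq_of_forall_schwartz (locallyIntegrable_coe _)
    (continuous_fourierInv_integral hw).locallyIntegrable fun φ => ?_
  rw [← integral_fourierInv_schwartz_mul φ hw]
  have h1 := Lp.fourierInv_toTemperedDistribution_eq w
  have h2 := congrArg (fun T : 𝓢'(E3, ℂ) => T φ) h1
  simp only [fourierInv_apply, Lp.toTemperedDistribution_apply] at h2
  exact h2.symm

/-- The Fourier transform of Green's function with pole `x`. -/
def greenSymbol (lam : ℝ) (x ξ : E3) : ℂ :=
  (Real.fourierChar (-⟪ξ, x⟫) : ℂ) * (resolventSymbol lam ξ : ℂ)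

theorem norm_greenSymbol {lam : ℝ} (hlam : lam < 0) (x ξ : E3) :
    ‖greenSymbol lam x ξ‖ = resolventSymbol lam ξ := by
  rw [greenSymbol, norm_mul, Circle.norm_coe, one_mul, Complex.norm_real,
    Real.norm_of_nonneg (resolventSymbol_pos hlam ξ).le]

theorem continuous_greenSymbol {lam : ℝ} (hlam : lam < 0) (x : E3) :
    Continuous (greenSymbol lam x) := by
  have := continuous_resolventSymbol hlam
  unfold greenSymbol
  fun_prop

theorem memLp_greenSymbol {lam : ℝ} (hlam : lam < 0) (x : E3) :
    MemLp (greenSymbol lam x) 2 volume := by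
  refine (memLp_resolventSymbol hlam).of_le (continuous_greenSymbol hlam x).aestronglyMeasurable
    (ae_of_all _ fun ξ => ?_)
  rw [norm_greenSymbol hlam, Real.norm_of_nonneg (resolventSymbol_pos hlam ξ).le]

open Classical in
/-- Green's function `(-Δ - lam)⁻¹ δ_x` as an element of `L²(ℝ³)`. -/
def greenVec (lam : ℝ) (x : E3) : L2E3 :=
  if hlam : lam < 0 then fourierL2.symm ((memLp_greenSymbol hlam x).toLp _) else 0

theorem fourierL2_greenVec {lam : ℝ} (hlam : lam < 0) (x : E3) :
    fourierL2 (greenVec lam x) =ᵐ[volume] greenSymbol lam x := by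
  rw [greenVec, dif_pos hlam, LinearIsometryEquiv.apply_symm_apply]
  exact (memLp_greenSymbol hlam x).coeFn_toLp

theorem inner_greenVec {lam : ℝ} (hlam : lam < 0) (x : E3) (f : L2E3) :
    inner ℂ (greenVec lam x) f = ∫ ξ, (Real.fourierChar ⟪ξ, x⟫ : ℂ) *
      ((resolventSymbol lam ξ : ℂ) * fourierL2 f ξ) := by
  rw [← fourierL2.inner_map_map, L2.inner_def]
  refine integral_congr_ae ?_
  filter_upwards [fourierL2_greenVec hlam x] with ξ h1
  rw [h1, RCLike.inner_apply, greenSymbol, map_mul, Complex.conj_ofReal, AddChar.map_neg_eq_inv,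
    Circle.coe_inv_eq_conj, Complex.conj_conj]
  ring

theorem inner_greenVec_greenVec {lam mu : ℝ} (hlam : lam < 0) (hmu : mu < 0) (x y : E3) :
    inner ℂ (greenVec lam x) (greenVec mu y) = ∫ ξ, (Real.fourierChar ⟪ξ, x - y⟫ : ℂ) *
      ((resolventSymbol lam ξ * resolventSymbol mu ξ : ℝ) : ℂ) := by
  rw [inner_greenVec hlam]
  refine integral_congr_ae ?_
  filter_upwards [fourierL2_greenVec hmu y] with ξ h1
  rw [h1, greenSymbol, inner_sub_right, sub_eq_add_neg, AddChar.map_add_eq_mul, Circle.coe_mul]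
  push_cast
  ring

/-- The bridge between the explicit kernel of the boundary operator and the abstract γ-field. Each
Yukawa potential is singular at x = y, so the diagonal is excluded. -/
theorem inner_greenVec_sub {lam mu : ℝ} (hlam : lam < 0) (hmu : mu < 0) {x y : E3} (hxy : x ≠ y) :
    ((lam - mu : ℝ) : ℂ) * inner ℂ (greenVec lam x) (greenVec mu y) =
      ClosedCurve.kern lam x y - ClosedCurve.kern mu x y := by
  rw [inner_greenVec_greenVec hlam hmu, fourierInv_symbol hlam hmu (sub_ne_zero.2 hxy)]
  simp [ClosedCurve.kern, yukawa]

/-- Fourier inversion shows that point evaluation after the resolvent is a bounded functional. The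
right side is the continuous representative from which traces are taken. -/
theorem freeResolvent_ae_eq {lam : ℝ} (hlam : lam < 0) (f : L2E3) :
    freeResolvent lam f =ᵐ[volume] fun x => inner ℂ (greenVec lam x) f := by
  have hae := coeFn_symbolMul hlam (fourierL2 f)
  have hint : Integrable (fun ξ => (resolventSymbol lam ξ : ℂ) * fourierL2 f ξ) :=
    (memLp_resolventSymbol hlam).ofReal.integrable_mul (Lp.memLp (fourierL2 f))
  rw [freeResolvent_apply]
  refine (fourierL2_symm_ae_eq (hint.congr hae.symm)).trans (ae_of_all _ fun x => ?_)
  dsimp only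
  rw [inner_greenVec hlam]
  refine integral_congr_ae ?_
  filter_upwards [hae] with ξ h1
  rw [h1]

theorem norm_greenVec {lam : ℝ} (hlam : lam < 0) (x : E3) :
    ‖greenVec lam x‖ = ‖greenVec lam 0‖ := by
  have h : ∀ x, inner ℂ (greenVec lam x) (greenVec lam x) =
      ∫ ξ, ((resolventSymbol lam ξ * resolventSymbol lam ξ : ℝ) : ℂ) := fun x => by
    rw [inner_greenVec_greenVec hlam hlam]
    simp
  have h1 := (h x).trans (h 0).symm
  rw [inner_self_eq_norm_sq_to_K, inner_self_eq_norm_sq_to_K] at h1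
  have h2 : ‖greenVec lam x‖ ^ 2 = ‖greenVec lam 0‖ ^ 2 := by exact_mod_cast h1
  exact (pow_left_inj₀ (norm_nonneg _) (norm_nonneg _) two_ne_zero).1 h2

theorem continuous_greenVec {lam : ℝ} (hlam : lam < 0) : Continuous (greenVec lam) := by
  have hc := continuous_fourierInv_integral (integrable_symbol_mul_complex hlam hlam)
  rw [continuous_iff_continuousAt]
  intro x
  rw [ContinuousAt, tendsto_iff_norm_sub_tendsto_zero]
  -- All Green vectors have the same norm, so their distance is determined by their inner product, a
  -- continuous Fourier integral.
  have hsq : Tendsto (fun y => ‖greenVec lam y - greenVec lam x‖ ^ 2) (𝓝 x) (𝓝 0) := by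
    have h1 : ∀ y, ‖greenVec lam y - greenVec lam x‖ ^ 2 = 2 * ‖greenVec lam 0‖ ^ 2
        - 2 * (inner ℂ (greenVec lam y) (greenVec lam x)).re := fun y => by
      rw [@norm_sub_sq ℂ, norm_greenVec hlam y, norm_greenVec hlam x]
      simp only [RCLike.re_to_complex]
      ring
    have h2 : Continuous fun y => 2 * ‖greenVec lam 0‖ ^ 2
        - 2 * (inner ℂ (greenVec lam y) (greenVec lam x)).re := by
      simp only [inner_greenVec_greenVec hlam hlam]
      have := hc.comp (continuous_id.sub (continuous_const (y := x)))
      exact continuous_const.sub (continuous_const.mul (Complex.continuous_re.comp this))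
    simp only [h1]
    have h3 := h2.tendsto x
    rwa [← h1 x, sub_self, norm_zero, zero_pow two_ne_zero] at h3
  have := hsq.sqrt
  simpa [Real.sqrt_sq] using this

/-! ### A singular sequence for the free Laplacian -/

/-- The open spherical shell of inner radius `r + 1 / (n + 2)` and outer radius
`r + 1 / (n + 1)`. -/
def shell (r : ℝ) (n : ℕ) : Set E3 :=
  {ξ | r + 1 / ((n : ℝ) + 2) < ‖ξ‖ ∧ ‖ξ‖ < r + 1 / ((n : ℝ) + 1)}

theorem isOpen_shell (r : ℝ) (n : ℕ) : IsOpen (shell r n) :=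
  (isOpen_lt continuous_const continuous_norm).inter (isOpen_lt continuous_norm continuous_const)

theorem measure_shell_ne_top (r : ℝ) (n : ℕ) : volume (shell r n) ≠ ⊤ := by
  refine ((measure_mono fun ξ hξ => ?_).trans_lt
    (measure_ball_lt_top (x := (0 : E3)) (r := r + 1 / ((n : ℝ) + 1)))).ne
  rw [mem_ball_zero_iff]
  exact hξ.2

theorem measure_shell_pos {r : ℝ} (hr : 0 ≤ r) (n : ℕ) : 0 < volume (shell r n) := by
  refine (isOpen_shell r n).measure_pos _ ?_
  have hn : (0 : ℝ) ≤ n := n.cast_nonneg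
  have hlt : r + 1 / ((n : ℝ) + 2) < r + 1 / ((n : ℝ) + 1) := by
    gcongr
    norm_num
  obtain ⟨t, ht1, ht2⟩ := exists_between hlt
  have ht0 : 0 ≤ t := by
    have : (0 : ℝ) < 1 / ((n : ℝ) + 2) := by positivity
    linarith
  refine ⟨EuclideanSpace.single 0 t, ?_⟩
  simp only [shell, mem_ofPred_eq, PiLp.norm_single, Real.norm_of_nonneg ht0]
  exact ⟨ht1, ht2⟩

theorem disjoint_shell (r : ℝ) {m n : ℕ} (hmn : m < n) : Disjoint (shell r m) (shell r n) := by
  rw [Set.disjoint_left]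
  rintro ξ ⟨h1, -⟩ ⟨-, h2⟩
  have h3 : (m : ℝ) + 1 ≤ n := by exact_mod_cast hmn
  have h4 : 1 / ((n : ℝ) + 1) ≤ 1 / ((m : ℝ) + 2) := by
    apply one_div_le_one_div_of_le <;> [positivity; linarith]
  linarith

/-- The indicator function of a shell in `L²`. -/
def shellVec (r : ℝ) (n : ℕ) : L2E3 :=
  indicatorConstLp 2 (isOpen_shell r n).measurableSet (measure_shell_ne_top r n) (1 : ℂ)

theorem shellVec_ne_zero {r : ℝ} (hr : 0 ≤ r) (n : ℕ) : shellVec r n ≠ 0 := by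
  rw [← norm_ne_zero_iff, shellVec, norm_indicatorConstLp two_ne_zero ENNReal.ofNat_ne_top,
    norm_one,
    one_mul]
  exact (Real.rpow_pos_of_pos (ENNReal.toReal_pos (measure_shell_pos hr n).ne'
    (measure_shell_ne_top r n)) _).ne'

theorem inner_shellVec (r : ℝ) {m n : ℕ} (hmn : m ≠ n) :
    inner ℂ (shellVec r m) (shellVec r n) = 0 := by
  have hd : Disjoint (shell r m) (shell r n) := by
    rcases lt_or_gt_of_ne hmn with h | h
    · exact disjoint_shell r h
    · exact (disjoint_shell r h).symm
  rw [L2.inner_def]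
  refine integral_eq_zero_of_ae ?_
  filter_upwards [indicatorConstLp_coeFn (p := 2) (hs := (isOpen_shell r m).measurableSet)
    (hμs := measure_shell_ne_top r m) (c := (1 : ℂ)),
    indicatorConstLp_coeFn (p := 2) (hs := (isOpen_shell r n).measurableSet)
    (hμs := measure_shell_ne_top r n) (c := (1 : ℂ))] with ξ h1 h2
  rw [shellVec, shellVec, h1, h2, RCLike.inner_apply]
  by_cases hξ : ξ ∈ shell r m
  · simp [Set.disjoint_left.1 hd hξ]
  · simp [hξ]

/-- On the shell 1 - (4π²r² - λ)s = 4π²(|ξ|² - r²)s, where s is the symbol. Here s ≤ 1/(-λ), and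
|ξ|² - r² = (|ξ| - r)(|ξ| + r) ≤ (2r + 1)/(n + 1). -/
theorem norm_shellVec_le {r lam : ℝ} (hr : 0 ≤ r) (hlam : lam < 0) (n : ℕ) :
    ‖shellVec r n - (((4 * Real.pi ^ 2 * r ^ 2 : ℝ) : ℂ) - lam) • symbolMul lam (shellVec r n)‖ ≤
      4 * Real.pi ^ 2 * (2 * r + 1) * (-lam)⁻¹ * (1 / ((n : ℝ) + 1)) * ‖shellVec r n‖ := by
  refine Lp.norm_le_mul_norm_of_ae_le_mul ?_
  filter_upwards [indicatorConstLp_coeFn (p := 2) (hs := (isOpen_shell r n).measurableSet)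
    (hμs := measure_shell_ne_top r n) (c := (1 : ℂ)), coeFn_symbolMul hlam (shellVec r n),
    Lp.coeFn_sub (shellVec r n) ((((4 * Real.pi ^ 2 * r ^ 2 : ℝ) : ℂ) - lam) •
      symbolMul lam (shellVec r n)),
    Lp.coeFn_smul (((4 * Real.pi ^ 2 * r ^ 2 : ℝ) : ℂ) - lam) (symbolMul lam (shellVec r n))]
    with ξ h1 h2 h3 h4
  rw [h3, Pi.sub_apply, h4, Pi.smul_apply, h2]
  change shellVec r n ξ = _ at h1
  rw [h1]
  by_cases hξ : ξ ∈ shell r n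
  · simp only [indicator_of_mem hξ, mul_one, norm_one, smul_eq_mul]
    have hpos := symbol_denom_pos hlam ξ
    have heq : (1 : ℂ) - (((4 * Real.pi ^ 2 * r ^ 2 : ℝ) : ℂ) - lam) * (resolventSymbol lam ξ : ℂ)
        = ((4 * Real.pi ^ 2 * (‖ξ‖ ^ 2 - r ^ 2) * resolventSymbol lam ξ : ℝ) : ℂ) := by
      have h5 : (4 * Real.pi ^ 2 * ‖ξ‖ ^ 2 - lam) * resolventSymbol lam ξ = 1 :=
        mul_inv_cancel₀ hpos.ne'
      have h6 : ((4 * Real.pi ^ 2 * ‖ξ‖ ^ 2 - lam : ℝ) : ℂ) * (resolventSymbol lam ξ : ℂ) = 1 := by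
        exact_mod_cast h5
      rw [← h6]
      push_cast
      ring
    have hn1 : 1 / ((n : ℝ) + 1) ≤ 1 := by
      rw [div_le_one (by positivity)]
      linarith [(n.cast_nonneg : (0 : ℝ) ≤ n)]
    have hn2 : 0 < 1 / ((n : ℝ) + 2) := by positivity
    have hn0 : 0 < 1 / ((n : ℝ) + 1) := by positivity
    have hrξ : r ≤ ‖ξ‖ := by linarith [hξ.1]
    have hle : ‖ξ‖ ^ 2 - r ^ 2 ≤ (2 * r + 1) * (1 / ((n : ℝ) + 1)) := by
      have := hξ.2
      nlinarith [norm_nonneg ξ]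
    have hge : 0 ≤ ‖ξ‖ ^ 2 - r ^ 2 := by nlinarith
    rw [heq, Complex.norm_real, Real.norm_of_nonneg (by
      have := (resolventSymbol_pos hlam ξ).le
      positivity)]
    calc 4 * Real.pi ^ 2 * (‖ξ‖ ^ 2 - r ^ 2) * resolventSymbol lam ξ
        ≤ 4 * Real.pi ^ 2 * ((2 * r + 1) * (1 / ((n : ℝ) + 1))) * (-lam)⁻¹ := by
          have := (resolventSymbol_pos hlam ξ).le
          gcongr
          exact resolventSymbol_le hlam ξ
      _ = _ := by ring
  · simp [hξ]

/-- Normalized indicators of disjoint shells shrinking to the sphere 4π²|ξ|² = x in Fourier space.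
The outer shells make the construction work also for x = 0. -/
theorem exists_singular_sequence {x lam : ℝ} (hx : 0 ≤ x) (hlam : lam < 0) :
    ∃ v : ℕ → L2E3, Orthonormal ℂ v ∧
      Tendsto (fun n => (1 - ((x : ℂ) - lam) • freeResolvent lam) (v n)) atTop (𝓝 0) := by
  set r : ℝ := √x / (2 * Real.pi) with hrdef
  have hr : 0 ≤ r := by positivity
  have hxr : 4 * Real.pi ^ 2 * r ^ 2 = x := by
    rw [hrdef, div_pow, Real.sq_sqrt hx]
    field_simp
    ring
  set w : ℕ → L2E3 := fun n => ((‖shellVec r n‖⁻¹ : ℝ) : ℂ) • shellVec r n with hw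
  have hw1 : ∀ n, ‖w n‖ = 1 := fun n => by
    rw [hw, norm_smul, Complex.norm_real, norm_inv, norm_norm,
      inv_mul_cancel₀ (norm_ne_zero_iff.2 (shellVec_ne_zero hr n))]
  refine ⟨fun n => fourierL2.symm (w n), ⟨fun n => ?_, fun m n hmn => ?_⟩, ?_⟩
  · rw [LinearIsometryEquiv.norm_map, hw1]
  · dsimp only
    rw [LinearIsometryEquiv.inner_map_map, hw, inner_smul_left, inner_smul_right,
      inner_shellVec r hmn, mul_zero, mul_zero]
  · have hb : ∀ n : ℕ, ‖(1 - ((x : ℂ) - lam) • freeResolvent lam) (fourierL2.symm (w n))‖ ≤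
        4 * Real.pi ^ 2 * (2 * r + 1) * (-lam)⁻¹ * (1 / ((n : ℝ) + 1)) := fun n => by
      have h1 : (1 - ((x : ℂ) - lam) • freeResolvent lam) (fourierL2.symm (w n))
          = ((‖shellVec r n‖⁻¹ : ℝ) : ℂ) • fourierL2.symm (shellVec r n -
            (((4 * Real.pi ^ 2 * r ^ 2 : ℝ) : ℂ) - lam) • symbolMul lam (shellVec r n)) := by
        simp only [sub_apply, one_apply_eq_self, smul_apply, freeResolvent_apply,
          LinearIsometryEquiv.apply_symm_apply, hw, map_smul, map_sub, hxr]
      rw [h1, norm_smul, LinearIsometryEquiv.norm_map, Complex.norm_real, norm_inv, norm_norm,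
        inv_mul_le_iff₀ (norm_pos_iff.2 (shellVec_ne_zero hr n))]
      exact (norm_shellVec_le hr hlam n).trans_eq (mul_comm _ _)
    refine squeeze_zero_norm hb ?_
    have := (tendsto_one_div_add_atTop_nhds_zero_nat (𝕜 := ℝ)).const_mul
      (4 * Real.pi ^ 2 * (2 * r + 1) * (-lam)⁻¹)
    rwa [mul_zero] at this

end

noncomputable section

open FourierTransform UnboundedOp
open scoped ContDiff RealInnerProductSpace

/-! ### The trace of the free resolvent on a finite measure -/

theorem greenVec_sub {lam mu : ℝ} (hlam : lam < 0) (hmu : mu < 0) (x : E3) :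
    greenVec lam x - greenVec mu x = ((lam - mu : ℝ) : ℂ) • freeResolvent lam (greenVec mu x) := by
  rw [← fourierL2.injective.eq_iff, map_sub, map_smul, fourierL2_freeResolvent, Lp.ext_iff]
  filter_upwards [fourierL2_greenVec hlam x, fourierL2_greenVec hmu x,
    coeFn_symbolMul hlam (fourierL2 (greenVec mu x)),
    Lp.coeFn_sub (fourierL2 (greenVec lam x)) (fourierL2 (greenVec mu x)),
    Lp.coeFn_smul ((lam - mu : ℝ) : ℂ) (symbolMul lam (fourierL2 (greenVec mu x)))]
    with ξ h1 h2 h3 h4 h5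
  rw [h4, Pi.sub_apply, h5, Pi.smul_apply, h3, h1, h2, greenSymbol, greenSymbol, smul_eq_mul]
  have h6 : (resolventSymbol lam ξ : ℂ) - resolventSymbol mu ξ
      = ((lam - mu : ℝ) : ℂ) * (resolventSymbol lam ξ * resolventSymbol mu ξ) := by
    exact_mod_cast resolventSymbol_sub hlam hmu ξ
  rw [← mul_sub, h6]
  ring

variable (ν : Measure E3) [IsFiniteMeasure ν]

theorem memLp_inner_greenVec {lam : ℝ} (hlam : lam < 0) (f : L2E3) :
    MemLp (fun x => inner ℂ (greenVec lam x) f) 2 ν := by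
  refine MemLp.of_bound ((continuous_greenVec hlam).inner continuous_const).aestronglyMeasurable
    (‖greenVec lam 0‖ * ‖f‖) (ae_of_all _ fun x => ?_)
  rw [← norm_greenVec hlam x]
  exact norm_inner_le_norm _ _

open Classical in
/-- The map `f ↦ (-Δ - lam)⁻¹ f |_Σ`, as a map to `L²(ν)`. -/
def resolventTrace (lam : ℝ) : L2E3 →L[ℂ] Lp ℂ 2 ν :=
  if hlam : lam < 0 then
    LinearMap.mkContinuous
      { toFun := fun f => (memLp_inner_greenVec ν hlam f).toLp _
        map_add' := fun f g => by
          rw [← MemLp.toLp_add]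
          exact MemLp.toLp_congr _ _ (ae_of_all _ fun x => inner_add_right _ _ _)
        map_smul' := fun c f => by
          rw [RingHom.id_apply, ← MemLp.toLp_const_smul]
          exact MemLp.toLp_congr _ _ (ae_of_all _ fun x => inner_smul_right _ _ _) }
      (ν.real univ ^ (2 : ℝ≥0∞).toReal⁻¹ * ‖greenVec lam 0‖) fun f => by
        rw [mul_assoc]
        refine Lp.norm_le_of_ae_bound (by positivity) ?_
        filter_upwards [(memLp_inner_greenVec ν hlam f).coeFn_toLp] with x hx
        change ‖(memLp_inner_greenVec ν hlam f).toLp _ x‖ ≤ _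
        rw [hx, ← norm_greenVec hlam x]
        exact norm_inner_le_norm _ _
  else 0

theorem coeFn_resolventTrace {lam : ℝ} (hlam : lam < 0) (f : L2E3) :
    resolventTrace ν lam f =ᵐ[ν] fun x => inner ℂ (greenVec lam x) f := by
  rw [resolventTrace, dif_pos hlam]
  exact (memLp_inner_greenVec ν hlam f).coeFn_toLp

theorem resolventTrace_eq_add {lam mu : ℝ} (hlam : lam < 0) (hmu : mu < 0) (f : L2E3) :
    resolventTrace ν lam f = resolventTrace ν mu f +
      ((lam - mu : ℝ) : ℂ) • resolventTrace ν mu (freeResolvent lam f) := by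
  rw [Lp.ext_iff]
  filter_upwards [coeFn_resolventTrace ν hlam f, coeFn_resolventTrace ν hmu f,
    coeFn_resolventTrace ν hmu (freeResolvent lam f),
    Lp.coeFn_add (resolventTrace ν mu f)
      (((lam - mu : ℝ) : ℂ) • resolventTrace ν mu (freeResolvent lam f)),
    Lp.coeFn_smul ((lam - mu : ℝ) : ℂ) (resolventTrace ν mu (freeResolvent lam f))]
    with x h1 h2 h3 h4 h5
  rw [h4, Pi.add_apply, h5, Pi.smul_apply, h1, h2, h3, smul_eq_mul]
  have h6 : greenVec lam x = greenVec mu x +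
      ((lam - mu : ℝ) : ℂ) • freeResolvent lam (greenVec mu x) := by
    rw [← greenVec_sub hlam hmu]
    abel
  have h7 := (ContinuousLinearMap.isSelfAdjoint_iff_isSymmetric.1
    (isSelfAdjoint_freeResolvent hlam))
    (greenVec mu x) f
  simp only [ContinuousLinearMap.coe_coe] at h7
  rw [h6, inner_add_left, inner_smul_left, h7, Complex.conj_ofReal]

theorem inner_adjoint_resolventTrace {mu : ℝ} (hmu : mu < 0) (g : L2E3)
    (h : Lp ℂ 2 ν) : inner ℂ g ((resolventTrace ν mu).adjoint h) =
      ∫ y, inner ℂ g (greenVec mu y) * h y ∂ν := by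
  rw [ContinuousLinearMap.adjoint_inner_right, L2.inner_def]
  refine integral_congr_ae ?_
  filter_upwards [coeFn_resolventTrace ν hmu g] with y hy
  rw [hy, RCLike.inner_apply, inner_conj_symm, mul_comm]

/-- The diagonal y = x, where the kernel identity fails, is negligible because points have measure
zero. -/
theorem coeFn_resolventTrace_adjoint [NullSingletonClass ν] {lam mu : ℝ}
    (hlam : lam < 0) (hmu : mu < 0)
    (h : Lp ℂ 2 ν) :
    (((lam - mu : ℝ) : ℂ) • resolventTrace ν lam ((resolventTrace ν mu).adjoint h) : Lp ℂ 2 ν)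
      =ᵐ[ν] fun x => ∫ y, (ClosedCurve.kern lam x y - ClosedCurve.kern mu x y) * h y ∂ν := by
  filter_upwards [coeFn_resolventTrace ν hlam ((resolventTrace ν mu).adjoint h),
    Lp.coeFn_smul ((lam - mu : ℝ) : ℂ) (resolventTrace ν lam ((resolventTrace ν mu).adjoint h))]
    with x h1 h2
  rw [h2, Pi.smul_apply, h1, inner_adjoint_resolventTrace ν hmu, smul_eq_mul, ← integral_const_mul]
  refine integral_congr_ae ?_
  have hx : ∀ᵐ y ∂ν, y ≠ x := by
    rw [ae_iff]
    simp
  filter_upwards [hx] with y hy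
  rw [← mul_assoc, inner_greenVec_sub hlam hmu hy.symm]

theorem exists_simpleFunc_dist_lt {K : Set E3} (hK : IsCompact K) {δ : ℝ} (hδ : 0 < δ) :
    ∃ p : SimpleFunc E3 E3, ∀ y ∈ K, dist (p y) y < δ := by
  set e := TopologicalSpace.denseSeq E3
  have hcov : K ⊆ ⋃ n, Metric.ball (e n) δ := fun y _ => by
    obtain ⟨n, hn⟩ := (TopologicalSpace.denseRange_denseSeq E3).exists_dist_lt y hδ
    exact mem_iUnion.2 ⟨n, hn⟩
  obtain ⟨t, ht⟩ := hK.elim_finite_subcover _ (fun n => Metric.isOpen_ball) hcov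
  obtain ⟨N, hN⟩ := t.bddAbove
  refine ⟨SimpleFunc.nearestPt e N, fun y hy => ?_⟩
  obtain ⟨n, hn, hyn⟩ := mem_iUnion₂.1 (ht hy)
  have h1 := SimpleFunc.edist_nearestPt_le e y (hN hn)
  rw [edist_dist, edist_dist, ENNReal.ofReal_le_ofReal_iff dist_nonneg] at h1
  rw [Metric.mem_ball, dist_comm] at hyn
  exact h1.trans_lt hyn

/-- Replacing y by a nearby value of a simple function turns f ↦ ⟨`greenVec lam y`, f⟩ into a
finite-rank operator. Uniform continuity of the Green vectors makes the error small in operator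
norm. -/
theorem isCompactOperator_resolventTrace {lam : ℝ} (hlam : lam < 0) {K : Set E3}
    (hK : IsCompact K) (hν : ∀ᵐ y ∂ν, y ∈ K) : IsCompactOperator (resolventTrace ν lam) := by
  -- A thickening of K is used because the approximating values of the simple function need not lie
  -- in K.
  have huc : UniformContinuousOn (greenVec lam) (Metric.cthickening 1 K) :=
    hK.cthickening.uniformContinuousOn_of_continuous (continuous_greenVec hlam).continuousOn
  have key : ∀ ε > 0, ∃ S : L2E3 →L[ℂ] Lp ℂ 2 ν, IsCompactOperator S ∧
      ‖S - resolventTrace ν lam‖ ≤ ν.real univ ^ (2 : ℝ≥0∞).toReal⁻¹ * ε := by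
    intro ε hε
    obtain ⟨δ, hδ, hδε⟩ := Metric.uniformContinuousOn_iff.1 huc ε hε
    obtain ⟨p, hp⟩ := exists_simpleFunc_dist_lt hK (lt_min hδ one_pos)
    have hclose : ∀ y ∈ K, ‖greenVec lam (p y) - greenVec lam y‖ ≤ ε := fun y hy => by
      rw [← dist_eq_norm]
      refine (hδε _ ?_ _ (Metric.self_subset_cthickening K hy)
        ((hp y hy).trans_le (min_le_left _ _))).le
      exact Metric.mem_cthickening_of_dist_le _ y _ _ hy
        ((hp y hy).trans_le (min_le_right _ _)).le
    set ind : E3 → Lp ℂ 2 ν := fun z => indicatorConstLp 2 (p.measurableSet_fiber z)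
      (measure_ne_top ν _) (1 : ℂ) with hind
    set S : L2E3 →L[ℂ] Lp ℂ 2 ν :=
      ∑ z ∈ p.range, (innerSL ℂ (greenVec lam z)).smulRight (ind z) with hS
    have hSval : ∀ f, S f =ᵐ[ν] fun y => inner ℂ (greenVec lam (p y)) f := fun f => by
      have h1 : S f = ∑ z ∈ p.range, (inner ℂ (greenVec lam z) f : ℂ) • ind z := by
        simp [hS]
      rw [h1]
      have h2 : ∀ᵐ y ∂ν, ∀ z ∈ p.range, ((inner ℂ (greenVec lam z) f : ℂ) • ind z : Lp ℂ 2 ν) y =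
          inner ℂ (greenVec lam z) f * (p ⁻¹' {z}).indicator (fun _ => (1 : ℂ)) y := by
        rw [Finset.eventually_all]
        intro z _
        filter_upwards [Lp.coeFn_smul (inner ℂ (greenVec lam z) f : ℂ) (ind z),
          indicatorConstLp_coeFn (p := 2) (hs := p.measurableSet_fiber z)
            (hμs := measure_ne_top ν _) (c := (1 : ℂ))] with y h3 h4
        rw [h3, Pi.smul_apply, hind, h4, smul_eq_mul]
      filter_upwards [h2, Lp.coeFn_finsetSum p.range
        fun z => ((inner ℂ (greenVec lam z) f : ℂ) • ind z : Lp ℂ 2 ν)] with y h3 h4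
      rw [h4, Finset.sum_apply, Finset.sum_congr rfl h3, Finset.sum_eq_single (p y)]
      · simp
      · intro z _ hz
        rw [indicator_of_notMem (fun h => hz (by simpa using h.symm)), mul_zero]
      · intro h
        exact absurd (p.mem_range_self y) h
    refine ⟨S, ?_, ?_⟩
    · have : ∀ t : Finset E3, IsCompactOperator
          (∑ z ∈ t, (innerSL ℂ (greenVec lam z)).smulRight (ind z) : L2E3 →L[ℂ] Lp ℂ 2 ν) := by
        intro t
        classical
        induction t using Finset.induction_on with
        | empty => simpa using isCompactOperator_zero
        | insert a t ha ih =>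
          rw [Finset.sum_insert ha]
          refine IsCompactOperator.add ?_ ih
          exact (isCompactOperator_of_locallyCompactSpace_rng
            (ContinuousLinearMap.toSpanSingleton ℂ (ind a))).comp_clm (innerSL ℂ (greenVec lam a))
      exact this _
    · refine ContinuousLinearMap.opNorm_le_bound _ (by positivity) fun f => ?_
      rw [mul_assoc]
      refine Lp.norm_le_of_ae_bound (by positivity) ?_
      rw [sub_apply]
      filter_upwards [hSval f, coeFn_resolventTrace ν hlam f, Lp.coeFn_sub (S f)
        (resolventTrace ν lam f), hν] with y h1 h2 h3 hy
      rw [h3, Pi.sub_apply, h1, h2, ← inner_sub_left]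
      refine (norm_inner_le_norm _ _).trans ?_
      gcongr
      exact hclose y hy
  have hM : 0 ≤ ν.real univ ^ (2 : ℝ≥0∞).toReal⁻¹ := by positivity
  choose S hS1 hS2 using fun n : ℕ => key (1 / ((n : ℝ) + 1)) (by positivity)
  refine isCompactOperator_of_tendsto (l := atTop) (F := S) ?_ (Eventually.of_forall hS1)
  rw [tendsto_iff_norm_sub_tendsto_zero]
  refine squeeze_zero (fun _ => norm_nonneg _) hS2 ?_
  have := (tendsto_one_div_add_atTop_nhds_zero_nat (𝕜 := ℝ)).const_mul
    (ν.real univ ^ (2 : ℝ≥0∞).toReal⁻¹)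
  rwa [mul_zero] at this

/-- `(-Δ - lam)⁻¹ (h ν)` solves the distributional equation. -/
theorem adjoint_resolventTrace_solves {lam : ℝ} (hlam : lam < 0) (h : Lp ℂ 2 ν) :
    -Δ (((resolventTrace ν lam).adjoint h : L2E3) : 𝓢'(E3, ℂ)) -
      (lam : ℂ) • (((resolventTrace ν lam).adjoint h : L2E3) : 𝓢'(E3, ℂ)) = (h : 𝓢'(E3, ℂ)) := by
  set u : L2E3 := (resolventTrace ν lam).adjoint h with hu
  have hinj : ∀ S T : 𝓢'(E3, ℂ), 𝓕 S = 𝓕 T → S = T := fun S T hST => by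
    have := congrArg (fun x => 𝓕⁻ x) hST
    simpa only [fourierInv_fourier_eq] using this
  apply hinj
  have h1 : 𝓕 (-Δ (u : 𝓢'(E3, ℂ)) - (lam : ℂ) • (u : 𝓢'(E3, ℂ))) =
      𝓕 (-Δ (u : 𝓢'(E3, ℂ))) - (lam : ℂ) • 𝓕 (u : 𝓢'(E3, ℂ)) := by
    rw [sub_eq_add_neg, FourierAdd.fourier_add, FourierTransform.fourier_neg ((lam : ℂ) • _),
      FourierSMul.fourier_smul, sub_eq_add_neg]
  rw [h1, fourier_laplacian, Lp.fourier_toTemperedDistribution_eq]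
  ext ψ
  set g : E3 → ℂ := fun ξ => ((4 * Real.pi ^ 2 * ‖ξ‖ ^ 2 : ℝ) : ℂ) with hg
  have hgt : g.HasTemperateGrowth := by fun_prop
  set b : 𝓢(E3, ℂ) := SchwartzMap.smulLeftCLM ℂ g ψ - (lam : ℂ) • ψ with hb
  have hbval : ∀ ξ, b ξ = ((4 * Real.pi ^ 2 * ‖ξ‖ ^ 2 - lam : ℝ) : ℂ) * ψ ξ := fun ξ => by
    rw [hb, sub_apply, smul_apply, SchwartzMap.smulLeftCLM_apply_apply hgt]
    simp only [hg, smul_eq_mul]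
    push_cast
    ring
  have hL : (smulLeftCLM ℂ g ((𝓕 u : L2E3) : 𝓢'(E3, ℂ)) -
      (lam : ℂ) • ((𝓕 u : L2E3) : 𝓢'(E3, ℂ))) ψ = ((𝓕 u : L2E3) : 𝓢'(E3, ℂ)) b := by
    rw [hb, map_sub, map_smul, ← smulLeftCLM_apply_apply]
    rfl
  have hR : (𝓕 (h : 𝓢'(E3, ℂ))) ψ = (h : 𝓢'(E3, ℂ)) (𝓕 ψ) := fourier_apply _ _
  rw [hL, hR, Lp.toTemperedDistribution_apply, Lp.toTemperedDistribution_apply]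
  -- The pairing with ψ becomes an inner product with the conjugate of b = (4π²|ξ|² - λ)ψ. The
  -- adjoint then moves it to Σ, where the symbol cancels this factor and leaves the Fourier
  -- transform of ψ.
  set w : L2E3 := star (b.toLp 2) with hw
  have hwval : w =ᵐ[volume] fun ξ => star (b ξ) := by
    filter_upwards [Lp.coeFn_star (b.toLp 2 : L2E3), b.coeFn_toLp 2 volume] with ξ h1 h2
    rw [hw, h1, Pi.star_apply, h2]
  have e1 : ∫ ξ, b ξ • (𝓕 u : L2E3) ξ = inner ℂ w (fourierL2 u) := by
    rw [L2.inner_def]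
    refine integral_congr_ae ?_
    filter_upwards [hwval] with ξ h1
    rw [h1, RCLike.inner_apply, Complex.star_def, Complex.conj_conj, smul_eq_mul, mul_comm,
      fourierL2_apply]
  have e2 : inner ℂ w (fourierL2 u) = inner ℂ (resolventTrace ν lam (fourierL2.symm w)) h := by
    rw [← ContinuousLinearMap.adjoint_inner_right, ← hu,
      ← fourierL2.inner_map_map (fourierL2.symm w), LinearIsometryEquiv.apply_symm_apply]
  rw [e1, e2, L2.inner_def]
  refine integral_congr_ae ?_
  filter_upwards [coeFn_resolventTrace ν hlam (fourierL2.symm w)] with x h1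
  rw [h1, RCLike.inner_apply, smul_eq_mul, mul_comm]
  congr 1
  rw [inner_greenVec hlam, ← integral_conj, SchwartzMap.fourier_coe, Real.fourier_eq]
  refine integral_congr_ae ?_
  filter_upwards [hwval] with ξ h2
  rw [LinearIsometryEquiv.apply_symm_apply, h2, hbval]
  have h5 : ((resolventSymbol lam ξ : ℝ) : ℂ) *
      ((4 * Real.pi ^ 2 * ‖ξ‖ ^ 2 - lam : ℝ) : ℂ) = 1 := by
    rw [← Complex.ofReal_mul, resolventSymbol, inv_mul_cancel₀ (symbol_denom_pos hlam ξ).ne',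
      Complex.ofReal_one]
  simp only [Complex.star_def, map_mul, Complex.conj_conj, Complex.conj_ofReal, Circle.smul_def,
    smul_eq_mul, AddChar.map_neg_eq_inv, Circle.coe_inv_eq_conj]
  linear_combination ((starRingEnd ℂ) (Real.fourierChar ⟪ξ, x⟫ : ℂ) * ψ ξ) * h5

end

noncomputable section

open FourierTransform UnboundedOp
open scoped ContDiff RealInnerProductSpace

namespace ClosedCurve

variable (C : ClosedCurve)

/-! ### The curve as a null set -/

theorem continuous_σ : Continuous C.σ := C.contDiff.continuous

theorem carrier_eq_image : C.carrier = C.σ '' Icc 0 C.L := by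
  refine subset_antisymm ?_ (image_subset_range _ _)
  rintro _ ⟨s, rfl⟩
  obtain ⟨t, ht, hst⟩ := C.periodic.exists_mem_Ico₀ C.L_pos s
  exact ⟨t, Ico_subset_Icc_self ht, hst.symm⟩

theorem isCompact_carrier : IsCompact C.carrier := by
  rw [carrier_eq_image]
  exact isCompact_Icc.image C.continuous_σ

theorem ae_mem_carrier : ∀ᵐ y ∂C.arcLength, y ∈ C.carrier :=
  (ae_map_iff C.continuous_σ.aemeasurable C.isCompact_carrier.measurableSet).2
    (ae_of_all _ fun s => mem_range_self s)

instance : NullSingletonClass C.arcLength where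
  measure_singleton x := by
    rw [arcLength, Measure.map_apply C.continuous_σ.measurable (measurableSet_singleton x),
      Measure.restrict_apply (C.continuous_σ.measurable (measurableSet_singleton x))]
    refine Set.Subsingleton.measure_zero ?_ _
    rintro s ⟨hs, hs'⟩ t ⟨ht, ht'⟩
    exact C.injOn hs' ht' (hs.trans ht.symm)

/-- The curve is the image of a coordinate plane under the differentiable map x ↦ σ(x₀), and
differentiable maps send null sets to null sets. -/
theorem volume_carrier : volume C.carrier = 0 := by
  set p : E3 →L[ℝ] ℝ := EuclideanSpace.proj 0
  set q : E3 →ₗ[ℝ] ℝ := (EuclideanSpace.proj 1 : E3 →L[ℝ] ℝ).toLinearMap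
  have hq : volume (LinearMap.ker q : Set E3) = 0 := by
    refine Measure.addHaar_submodule _ _ fun h => ?_
    have h1 : EuclideanSpace.single (1 : Fin 3) (1 : ℝ) ∈ LinearMap.ker q := by
      rw [h]; trivial
    simp [q] at h1
  have hd : DifferentiableOn ℝ (fun x => C.σ (p x)) (LinearMap.ker q : Set E3) :=
    ((C.contDiff.differentiable two_ne_zero).comp p.differentiable).differentiableOn
  refine measure_mono_null ?_
    (addHaar_image_eq_zero_of_differentiableOn_of_addHaar_eq_zero volume hd hq)
  rintro _ ⟨s, rfl⟩
  refine ⟨EuclideanSpace.single 0 s, ?_, ?_⟩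
  · simp [q]
  · simp [p]

/-- A distribution `h δ_Σ` that belongs to `L²(ℝ³)` vanishes. -/
theorem eq_zero_of_coe_eq_deltaDist {g : L2E3} {h : C.L2}
    (hgh : (g : 𝓢'(E3, ℂ)) = C.deltaDist h) : g = 0 ∧ h = 0 := by
  have hU : IsOpen C.carrierᶜ := C.isCompact_carrier.isClosed.isOpen_compl
  -- Test functions supported off Σ do not see hδ_Σ, so g vanishes there, hence almost everywhere.
  have h1 : ∀ᵐ x, x ∈ C.carrierᶜ → g x = 0 := by
    refine hU.ae_eq_zero_of_integral_contDiff_smul_eq_zero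
      ((locallyIntegrable_coe g).locallyIntegrableOn _) fun φ hφ hφc hφs => ?_
    have hg₁ : HasCompactSupport (Complex.ofRealCLM ∘ φ) := hφc.comp_left rfl
    have hg₂ : ContDiff ℝ ∞ (Complex.ofRealCLM ∘ φ) := by fun_prop
    have h2 := congrArg (fun T : 𝓢'(E3, ℂ) => T (hg₁.toSchwartzMap hg₂)) hgh
    simp only [deltaDist, Lp.toTemperedDistribution_apply] at h2
    have h3 : ∫ x, (hg₁.toSchwartzMap hg₂) x • h x ∂C.arcLength = 0 := by
      refine integral_eq_zero_of_ae ?_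
      filter_upwards [C.ae_mem_carrier] with x hx
      have : φ x = 0 := image_eq_zero_of_notMem_tsupport fun hx' => hφs hx' hx
      simp [this]
    rw [h3] at h2
    simpa using h2
  have hg0 : g = 0 := by
    rw [Lp.eq_zero_iff_ae_eq_zero]
    have h2 : ∀ᵐ x, x ∈ C.carrierᶜ := by
      rw [ae_iff]
      simpa using C.volume_carrier
    filter_upwards [h1, h2] with x h3 h4 using h3 h4
  refine ⟨hg0, ?_⟩
  have hinj : Function.Injective (Lp.toTemperedDistributionCLM ℂ C.arcLength 2) :=
    LinearMap.ker_eq_bot.mp Lp.ker_toTemperedDistributionCLM_eq_bot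
  apply hinj
  rw [map_zero, Lp.toTemperedDistributionCLM_apply]
  rw [hg0, ← Lp.toTemperedDistributionCLM_apply, map_zero] at hgh
  exact hgh.symm

/-! ### The `γ`-field -/

variable {C}

theorem Solves.eq {lam : ℝ} (hlam : lam < 0) {h : C.L2} {u v : L2E3} (hu : C.Solves lam h u)
    (hv : C.Solves lam h v) : u = v := by
  have h1 : (u - v, (lam : ℂ) • (u - v)) ∈ freeLaplacian.graph := by
    rw [mem_graph_freeLaplacian]
    have h2 := hu.trans hv.symm
    simp only [← Lp.toTemperedDistributionCLM_apply, ← laplacianCLM_apply, map_sub, map_smul]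
      at h2 ⊢
    linear_combination (norm := module) -h2
  have h2 : (u - v, 0) ∈ (subScalar freeLaplacian (lam : ℂ)).graph := by
    rw [mem_graph_subScalar, zero_add]
    exact h1
  rw [isBoundedInverse_freeResolvent hlam, map_zero] at h2
  exact sub_eq_zero.1 h2

variable (C)

/-- The γ-field is defined by choice among solution operators; uniqueness of L² solutions identifies
it with the adjoint trace. -/
theorem gammaField_eq {lam : ℝ} (hlam : lam < 0) :
    C.gammaField lam = (resolventTrace C.arcLength lam).adjoint := by
  have hG : ∃ G : C.L2 →L[ℂ] L2E3, ∀ h, C.Solves lam h (G h) :=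
    ⟨_, adjoint_resolventTrace_solves C.arcLength hlam⟩
  rw [gammaField, dif_pos hG]
  ext1 h
  exact (hG.choose_spec h).eq hlam (adjoint_resolventTrace_solves C.arcLength hlam h)

theorem solves_iff {lam : ℝ} (hlam : lam < 0) (h : C.L2) (u : L2E3) :
    C.Solves lam h u ↔ u = C.gammaField lam h := by
  have h1 : C.Solves lam h (C.gammaField lam h) := by
    rw [gammaField_eq C hlam]
    exact adjoint_resolventTrace_solves C.arcLength hlam h
  exact ⟨fun hu => hu.eq hlam h1, fun hu => hu ▸ h1⟩

theorem gammaField_solves {lam : ℝ} (hlam : lam < 0) (h : C.L2) :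
    -Δ (C.gammaField lam h : 𝓢'(E3, ℂ)) - (lam : ℂ) • (C.gammaField lam h : 𝓢'(E3, ℂ))
      = C.deltaDist h :=
  (C.solves_iff hlam h _).2 rfl

theorem adjoint_gammaField {lam : ℝ} (hlam : lam < 0) :
    (C.gammaField lam).adjoint = resolventTrace C.arcLength lam := by
  rw [gammaField_eq C hlam, ContinuousLinearMap.adjoint_adjoint]

theorem isCompactOperator_adjoint_gammaField {lam : ℝ} (hlam : lam < 0) :
    IsCompactOperator (C.gammaField lam).adjoint := by
  rw [adjoint_gammaField C hlam]
  exact isCompactOperator_resolventTrace C.arcLength hlam C.isCompact_carrier C.ae_mem_carrier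

theorem gammaField_injective {lam : ℝ} (hlam : lam < 0) {h : C.L2}
    (hh : C.gammaField lam h = 0) : h = 0 := by
  have h1 := C.gammaField_solves hlam h
  rw [hh] at h1
  refine (C.eq_zero_of_coe_eq_deltaDist (g := 0) ?_).2
  rw [← h1]
  simp only [← Lp.toTemperedDistributionCLM_apply, ← laplacianCLM_apply, map_zero]
  simp

theorem adjoint_gammaField_apply_eq_add {lam mu : ℝ} (hlam : lam < 0) (hmu : mu < 0) (f : L2E3) :
    (C.gammaField lam).adjoint f = (C.gammaField mu).adjoint f +
      ((lam - mu : ℝ) : ℂ) • (C.gammaField mu).adjoint (freeResolvent lam f) := by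
  rw [adjoint_gammaField C hlam, adjoint_gammaField C hmu]
  exact resolventTrace_eq_add C.arcLength hlam hmu f

theorem gammaField_apply_eq_add {lam mu : ℝ} (hlam : lam < 0) (hmu : mu < 0) (h : C.L2) :
    C.gammaField lam h = C.gammaField mu h +
      ((lam - mu : ℝ) : ℂ) • freeResolvent lam (C.gammaField mu h) := by
  refine ext_inner_left ℂ fun f => ?_
  have h7 := (ContinuousLinearMap.isSelfAdjoint_iff_isSymmetric.1
    (isSelfAdjoint_freeResolvent hlam))
    f (C.gammaField mu h)
  simp only [ContinuousLinearMap.coe_coe] at h7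
  rw [← ContinuousLinearMap.adjoint_inner_left, C.adjoint_gammaField_apply_eq_add hlam hmu,
    inner_add_left, inner_add_right, inner_smul_left, inner_smul_right,
    ContinuousLinearMap.adjoint_inner_left, ContinuousLinearMap.adjoint_inner_left, h7,
    Complex.conj_ofReal]

theorem coeFn_adjoint_gammaField_gammaField {lam mu : ℝ} (hlam : lam < 0) (hmu : mu < 0)
    (h : C.L2) :
    (((lam - mu : ℝ) : ℂ) • (C.gammaField lam).adjoint (C.gammaField mu h) : C.L2)
      =ᵐ[C.arcLength] fun x => ∫ y, (kern lam x y - kern mu x y) * h y ∂C.arcLength := by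
  rw [adjoint_gammaField C hlam, gammaField_eq C hmu]
  exact coeFn_resolventTrace_adjoint C.arcLength hlam hmu h

/-! ### Traces -/

theorem isTrace_freeResolvent {lam : ℝ} (hlam : lam < 0) (f : L2E3) :
    C.IsTrace (freeResolvent lam f) ((C.gammaField lam).adjoint f) := by
  rw [adjoint_gammaField C hlam]
  exact ⟨_, (continuous_greenVec hlam).inner continuous_const, freeResolvent_ae_eq hlam f,
    coeFn_resolventTrace C.arcLength hlam f⟩

variable {C}

theorem IsTrace.eq {u : L2E3} {t t' : C.L2} (h : C.IsTrace u t) (h' : C.IsTrace u t') :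
    t = t' := by
  obtain ⟨g, hg, h1, h2⟩ := h
  obtain ⟨g', hg', h1', h2'⟩ := h'
  have : g = g' := (hg.ae_eq_iff_eq volume hg').1 (h1.symm.trans h1')
  rw [Lp.ext_iff]
  exact h2.trans (this ▸ h2'.symm)

theorem exists_eq_freeResolvent {lam : ℝ} (hlam : lam < 0) {u : L2E3} (hu : u ∈ sobolevH2) :
    ∃ f : L2E3, u = freeResolvent lam f ∧
      ((f + (lam : ℂ) • u : L2E3) : 𝓢'(E3, ℂ)) = -Δ (u : 𝓢'(E3, ℂ)) := by
  obtain ⟨g, hg⟩ := exists_laplacian_of_mem_sobolevH2 hu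
  refine ⟨g - (lam : ℂ) • u, ?_, ?_⟩
  · rw [← isBoundedInverse_freeResolvent hlam, mem_graph_subScalar, sub_add_cancel,
      mem_graph_freeLaplacian]
    exact hg
  · rw [sub_add_cancel]
    exact hg

theorem neg_laplacian_freeResolvent {lam : ℝ} (hlam : lam < 0) (f : L2E3) :
    ((f + (lam : ℂ) • freeResolvent lam f : L2E3) : 𝓢'(E3, ℂ)) =
      -Δ (freeResolvent lam f : 𝓢'(E3, ℂ)) := by
  rw [← mem_graph_freeLaplacian, ← mem_graph_subScalar, isBoundedInverse_freeResolvent hlam]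

theorem freeResolvent_mem_sobolevH2 {lam : ℝ} (hlam : lam < 0) (f : L2E3) :
    freeResolvent lam f ∈ sobolevH2 :=
  mem_sobolevH2_of_laplacian (neg_laplacian_freeResolvent hlam f)

theorem exists_isTrace {u : L2E3} (hu : u ∈ sobolevH2) : ∃ t : C.L2, C.IsTrace u t := by
  obtain ⟨f, hf, -⟩ := exists_eq_freeResolvent (lam := -1) (by norm_num) hu
  exact ⟨_, hf ▸ C.isTrace_freeResolvent (by norm_num) f⟩

/-- The action of the `δ`-operator in terms of the boundary operator. -/
theorem isDeltaAction_iff {lam α : ℝ} (hlam : lam < 0) (hα : α ≠ 0) {u f : L2E3} :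
    C.IsDeltaAction lam α u f ↔ ∃ h : C.L2,
      (h, (C.gammaField lam).adjoint (f - (lam : ℂ) • u)) ∈
        (scalarSub (α : ℂ) (C.traceOpClosure lam)).graph ∧
      u = freeResolvent lam (f - (lam : ℂ) • u) + C.gammaField lam h := by
  have hαc : (α : ℂ) ≠ 0 := by exact_mod_cast hα
  constructor
  · rintro ⟨t, ⟨uc, huc, h, tc, htc, hu, ht⟩, hf⟩
    obtain ⟨g, hg, hg'⟩ := exists_eq_freeResolvent hlam huc
    have hsol := C.gammaField_solves hlam h
    -- Here g = (-Δ - λ)u_c. The left side is in L² and the right side lives on Σ, so both vanish.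
    -- This gives u_c = (-Δ - λ)⁻¹(f - λu) and t = αh.
    have h1 : ((f - (lam : ℂ) • u - g : L2E3) : 𝓢'(E3, ℂ)) =
        C.deltaDist ((h : C.L2) - ((1 / α : ℝ) : ℂ) • t) := by
      simp only [deltaDist] at hsol hf ⊢
      rw [hu] at hf ⊢
      simp only [← Lp.toTemperedDistributionCLM_apply, ← laplacianCLM_apply, map_sub, map_smul,
        map_add] at hsol hf hg' ⊢
      linear_combination (norm := module) hf - hg' + hsol
    obtain ⟨h2, h3⟩ := C.eq_zero_of_coe_eq_deltaDist h1
    have h2' := sub_eq_zero.1 h2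
    refine ⟨h, ?_, ?_⟩
    · have htc' : tc = (C.gammaField lam).adjoint (f - (lam : ℂ) • u) := by
        rw [h2']
        exact htc.eq (hg ▸ C.isTrace_freeResolvent hlam g)
      rw [mem_graph_scalarSub, ← htc']
      have h4 : (α : ℂ) • (h : C.L2) - tc = C.traceOpClosure lam h := by
        have h5 : (α : ℂ) • (h : C.L2) = t := by
          rw [sub_eq_zero.1 h3, smul_smul]
          push_cast
          rw [mul_one_div_cancel hαc, one_smul]
        rw [h5, ht, add_sub_cancel_left]
      rw [h4]
      exact LinearPMap.mem_graph _ h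
    · rw [h2', ← hg]
      exact hu
  · rintro ⟨h, hh, hu⟩
    rw [mem_graph_scalarSub, LinearPMap.mem_graph_iff] at hh
    obtain ⟨h', rfl, hh'⟩ := hh
    refine ⟨(α : ℂ) • (h' : C.L2), ⟨_, freeResolvent_mem_sobolevH2 hlam (f - (lam : ℂ) • u), h', _,
      C.isTrace_freeResolvent hlam _, hu, ?_⟩, ?_⟩
    · rw [hh']
      exact (add_sub_cancel _ _).symm
    · have hsol := C.gammaField_solves hlam h'
      have hR := neg_laplacian_freeResolvent hlam (f - (lam : ℂ) • u)
      have h1 : ((1 / α : ℝ) : ℂ) • C.deltaDist ((α : ℂ) • (h' : C.L2)) = C.deltaDist h' := by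
        simp only [deltaDist, ← Lp.toTemperedDistributionCLM_apply, map_smul]
        rw [smul_smul]
        push_cast
        rw [one_div_mul_cancel hαc, one_smul]
      rw [h1, ← hsol]
      set r := freeResolvent lam (f - (lam : ℂ) • u)
      have h2 : (u : 𝓢'(E3, ℂ)) = ((r + C.gammaField lam h' : L2E3) : 𝓢'(E3, ℂ)) := by rw [← hu]
      have h3 : (Δ (u : 𝓢'(E3, ℂ)) : 𝓢'(E3, ℂ)) =
          Δ ((r + C.gammaField lam h' : L2E3) : 𝓢'(E3, ℂ)) := by rw [← hu]
      simp only [← Lp.toTemperedDistributionCLM_apply, ← laplacianCLM_apply, map_sub, map_smul,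
        map_add] at hR h2 h3 ⊢
      linear_combination (norm := module) hR + h3 + (lam : ℂ) • h2

end ClosedCurve

end

noncomputable section

open UnboundedOp

namespace ClosedCurve

variable (C : ClosedCurve)

/-! ### Geometry of the curve -/

theorem σ_eq_iff {a b : ℝ} : C.σ a = C.σ b ↔ ((a : ℝ) : AddCircle C.L) = (b : AddCircle C.L) := by
  constructor
  · intro h
    have h1 : ∀ a, C.σ (toIcoMod C.L_pos 0 a) = C.σ a := fun a => by
      rw [toIcoMod]
      exact C.periodic.sub_zsmul_eq _
    have h2 : toIcoMod C.L_pos 0 a = toIcoMod C.L_pos 0 b := by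
      refine C.injOn ?_ ?_ ((h1 a).trans (h.trans (h1 b).symm))
      · simpa using toIcoMod_mem_Ico C.L_pos 0 a
      · simpa using toIcoMod_mem_Ico C.L_pos 0 b
    have h3 : ∀ a : ℝ, ((toIcoMod C.L_pos 0 a : ℝ) : AddCircle C.L) = (a : AddCircle C.L) :=
      fun a => by
        rw [toIcoMod, AddCircle.coe_sub, AddCircle.coe_zsmul, AddCircle.coe_period, smul_zero,
          sub_zero]
    rw [← h3 a, h2, h3 b]
  · intro h
    rw [QuotientAddGroup.eq, AddSubgroup.mem_zmultiples_iff] at h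
    obtain ⟨n, hn⟩ := h
    have : b = a + n • C.L := by linarith
    rw [this]
    exact (C.periodic.zsmul n a).symm

theorem differentiable_σ : Differentiable ℝ C.σ := C.contDiff.differentiable two_ne_zero

theorem norm_sub_le (a b : ℝ) : ‖C.σ a - C.σ b‖ ≤ |a - b| := by
  have := Convex.norm_image_sub_le_of_norm_deriv_le (f := C.σ) (C := 1) (s := univ)
    (x := b) (y := a)
    (fun x _ => C.differentiable_σ x) (fun x _ => (C.norm_deriv x).le) convex_univ trivial trivial
  simpa using this

/-- Second order Taylor estimate, where the C² assumption enters: the mean value inequality is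
applied to the derivative of σ and then to σ minus its tangent line. Periodicity makes the bound A
of the second derivative uniform in s. -/
theorem exists_norm_sub_sub_le : ∃ A : ℝ, 0 ≤ A ∧ ∀ s t : ℝ, |t| ≤ C.L →
    ‖C.σ (s + t) - C.σ s - t • deriv C.σ s‖ ≤ A * t ^ 2 := by
  have hL := C.L_pos
  have hd1 : ContDiff ℝ 1 (deriv C.σ) := C.contDiff.deriv'
  have hd1' : Differentiable ℝ (deriv C.σ) := hd1.differentiable one_ne_zero
  have hc : Continuous (deriv (deriv C.σ)) := hd1.continuous_deriv le_rfl
  -- This interval contains s + t for all s ∈ [0, L) and |t| ≤ L.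
  obtain ⟨A, hA⟩ := (isCompact_Icc (a := -C.L) (b := 2 * C.L)).exists_bound_of_continuousOn
    hc.continuousOn
  have hA0 : 0 ≤ A := (norm_nonneg _).trans (hA 0 ⟨by linarith, by linarith⟩)
  have key : ∀ s ∈ Ico 0 C.L, ∀ t : ℝ, |t| ≤ C.L →
      ‖C.σ (s + t) - C.σ s - t • deriv C.σ s‖ ≤ A * t ^ 2 := by
    intro s hs t ht
    have hsub : ∀ x, |x - s| ≤ |t| → x ∈ Icc (-C.L) (2 * C.L) := fun x hx => by
      have := abs_le.1 (hx.trans ht)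
      exact ⟨by linarith [hs.1], by linarith [hs.2]⟩
    have hball : ∀ x, x ∈ Metric.closedBall s |t| ↔ |x - s| ≤ |t| := fun x => by
      rw [Metric.mem_closedBall, Real.dist_eq]
    have h1 : ∀ x ∈ Metric.closedBall s |t|, ‖deriv C.σ x - deriv C.σ s‖ ≤ A * |t| := by
      intro x hx
      have := Convex.norm_image_sub_le_of_norm_deriv_le (f := deriv C.σ) (C := A)
        (s := Metric.closedBall s |t|) (x := s) (y := x) (fun x _ => hd1' x)
        (fun y hy => hA y (hsub y ((hball y).1 hy))) (convex_closedBall _ _)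
        (Metric.mem_closedBall_self (abs_nonneg t)) hx
      refine this.trans ?_
      rw [Real.norm_eq_abs]
      exact mul_le_mul_of_nonneg_left ((hball x).1 hx) hA0
    have h2 := Convex.norm_image_sub_le_of_norm_deriv_le
      (f := fun x => C.σ x - (x - s) • deriv C.σ s) (C := A * |t|)
      (s := Metric.closedBall s |t|) (x := s) (y := s + t)
      (fun x _ => (C.differentiable_σ x).sub (by fun_prop))
      (fun x hx => by
        have hd : HasDerivAt (fun x => C.σ x - (x - s) • deriv C.σ s)
            (deriv C.σ x - (1 : ℝ) • deriv C.σ s) x :=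
          (C.differentiable_σ x).hasDerivAt.sub
            (((hasDerivAt_id x).sub_const s).smul_const (deriv C.σ s))
        rw [hd.deriv, one_smul]
        exact h1 x hx) (convex_closedBall _ _)
      (Metric.mem_closedBall_self (abs_nonneg t)) (by rw [hball]; simp)
    have h3 : A * |t| * ‖s + t - s‖ = A * t ^ 2 := by
      rw [add_sub_cancel_left, Real.norm_eq_abs, mul_assoc, abs_mul_abs_self, sq]
    rw [h3] at h2
    refine le_trans (le_of_eq ?_) h2
    congr 1
    simp only [add_sub_cancel_left, sub_self, zero_smul, sub_zero]
    abel
  refine ⟨A, hA0, fun s t ht => ?_⟩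
  have hs := toIcoMod_mem_Ico C.L_pos 0 s
  rw [zero_add] at hs
  have h := key _ hs t ht
  have hper' : Function.Periodic (deriv C.σ) C.L := fun x => by
    rw [← deriv_comp_add_const]
    congr 1
    exact funext C.periodic
  have h1 : C.σ (toIcoMod C.L_pos 0 s + t) = C.σ (s + t) := by
    rw [toIcoMod, sub_add_eq_add_sub]
    exact C.periodic.sub_zsmul_eq _
  have h2 : C.σ (toIcoMod C.L_pos 0 s) = C.σ s := C.periodic.sub_zsmul_eq _
  have h3 : deriv C.σ (toIcoMod C.L_pos 0 s) = deriv C.σ s := hper'.sub_zsmul_eq _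
  rwa [h1, h2, h3] at h

theorem σ_add_ne {s t : ℝ} (ht0 : t ≠ 0) (ht : |t| < C.L) : C.σ (s + t) ≠ C.σ s := by
  intro h
  rw [σ_eq_iff, QuotientAddGroup.eq, AddSubgroup.mem_zmultiples_iff] at h
  obtain ⟨n, hn⟩ := h
  have h1 : t = -(n : ℝ) * C.L := by
    rw [zsmul_eq_mul] at hn
    linarith
  have hL := C.L_pos
  rw [h1, abs_mul, abs_neg, abs_of_pos hL] at ht
  have h2 : |(n : ℝ)| < 1 := by
    by_contra! hcon
    nlinarith
  have h3 : n = 0 := by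
    rw [← Int.abs_lt_one_iff]
    exact_mod_cast h2
  rw [h3] at h1
  simp at h1
  exact ht0 h1

/-- On a closed `C²`-curve, the reciprocals of chord length and arc length differ by a bounded
amount. -/
theorem exists_inv_norm_sub_le : ∃ K : ℝ, 0 ≤ K ∧ ∀ s t : ℝ, t ≠ 0 → |t| ≤ C.L / 2 →
    ‖C.σ (s + t) - C.σ s‖⁻¹ ≤ |t|⁻¹ + K := by
  have hL := C.L_pos
  obtain ⟨A, hA0, hA⟩ := C.exists_norm_sub_sub_le
  -- For |t| < η the quadratic error is at most |t|/2, so the chord is at least |t|/2. For η ≤ |t| ≤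
  -- L/2 injectivity and compactness bound the reciprocal chord.
  obtain ⟨η, hη0, hη⟩ : ∃ η > 0, (A + 1) * η = 1 / 2 :=
    ⟨(2 * (A + 1))⁻¹, by positivity, by field_simp⟩
  set S : Set (ℝ × ℝ) := Icc 0 C.L ×ˢ (Icc (-(C.L / 2)) (C.L / 2) ∩ {t | η ≤ |t|}) with hS
  have hScpt : IsCompact S := by
    refine isCompact_Icc.prod (isCompact_Icc.inter_right ?_)
    exact isClosed_le continuous_const continuous_abs
  have hcont : ContinuousOn (fun p : ℝ × ℝ => ‖C.σ (p.1 + p.2) - C.σ p.1‖⁻¹) S := by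
    have hσ := C.continuous_σ
    refine ContinuousOn.inv₀ (by fun_prop) ?_
    rintro ⟨s, t⟩ ⟨-, ht1, ht2⟩
    rw [norm_ne_zero_iff, sub_ne_zero]
    refine C.σ_add_ne ?_ ?_
    · intro h0
      have h0' : t = 0 := h0
      have ht2' : η ≤ |t| := ht2
      rw [h0', abs_zero] at ht2'
      linarith
    · have := abs_le.2 ht1
      simp only at this
      linarith
  obtain ⟨M, hM⟩ := hScpt.exists_bound_of_continuousOn hcont
  refine ⟨max (2 * A) M, le_max_of_le_left (by positivity), fun s t ht0 ht => ?_⟩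
  have htpos : 0 < |t| := abs_pos.2 ht0
  rcases le_or_gt η |t| with h | h
  · have hs := toIcoMod_mem_Ico C.L_pos 0 s
    rw [zero_add] at hs
    have h1 : C.σ (toIcoMod C.L_pos 0 s + t) = C.σ (s + t) := by
      rw [toIcoMod, sub_add_eq_add_sub]
      exact C.periodic.sub_zsmul_eq _
    have h2 : C.σ (toIcoMod C.L_pos 0 s) = C.σ s := C.periodic.sub_zsmul_eq _
    have h3 := hM (toIcoMod C.L_pos 0 s, t) ⟨Ico_subset_Icc_self hs, abs_le.1 ht, h⟩
    simp only [h1, h2, norm_inv, norm_norm] at h3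
    have h4 : 0 < |t|⁻¹ := by positivity
    exact h3.trans ((le_max_right _ _).trans (le_add_of_nonneg_left h4.le))
  · have h1 := hA s t (by linarith)
    set r := ‖C.σ (s + t) - C.σ s‖ with hr
    have h2 : |t| - A * t ^ 2 ≤ r := by
      have h3 := norm_sub_norm_le (t • deriv C.σ s) (C.σ (s + t) - C.σ s)
      rw [norm_smul, C.norm_deriv, mul_one, Real.norm_eq_abs,
        norm_sub_rev (t • deriv C.σ s)] at h3
      linarith
    have hsq : t ^ 2 = |t| ^ 2 := (sq_abs t).symm
    have h3 : A * |t| ≤ 1 / 2 := by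
      have h4 : A * |t| ≤ (A + 1) * η := by nlinarith
      exact h4.trans hη.le
    have h4 : |t| / 2 ≤ r := by
      rw [hsq] at h2
      nlinarith
    have hrpos : 0 < r := by linarith
    -- The numerator |t| - r is at most At² and the denominator r|t| is at least t²/2.
    have h5 : r⁻¹ - |t|⁻¹ ≤ 2 * A := by
      have h6 : r⁻¹ - |t|⁻¹ = (|t| - r) / (r * |t|) := by
        field_simp
      rw [h6, div_le_iff₀ (by positivity)]
      rw [hsq] at h2
      nlinarith [mul_nonneg hA0 htpos.le]
    linarith [le_max_left (2 * A) M]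

/-! ### Arc distance and arc length measure -/

theorem exists_param : ∃ τ : E3 → ℝ, Measurable τ ∧ ∀ s, C.σ (τ (C.σ s)) = C.σ s := by
  -- An injective continuous map on a Borel set is a measurable embedding, so its inverse is
  -- measurable.
  have hemb : MeasurableEmbedding ((Ico 0 C.L).domRestrict C.σ) :=
    C.continuous_σ.continuousOn.measurableEmbedding measurableSet_Ico C.injOn
  obtain ⟨τ, hτ, hτσ⟩ := hemb.exists_measurable_extend (g := fun x => (x : ℝ))
    measurable_subtype_coe fun _ => ⟨0⟩
  refine ⟨τ, hτ, fun s => ?_⟩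
  obtain ⟨t, ht, hst⟩ := C.periodic.exists_mem_Ico₀ C.L_pos s
  have : τ (C.σ t) = t := congrFun hτσ ⟨t, ht⟩
  rw [hst, this]

/-- A measurable parameter for the points of the curve. -/
def param : E3 → ℝ := C.exists_param.choose

theorem measurable_param : Measurable C.param := C.exists_param.choose_spec.1

theorem σ_param (s : ℝ) : C.σ (C.param (C.σ s)) = C.σ s := C.exists_param.choose_spec.2 s

/-- The distance of two points of the curve, measured along the curve. -/
def arcDist (x y : E3) : ℝ := ‖((C.param x - C.param y : ℝ) : AddCircle C.L)‖

theorem arcDist_comm (x y : E3) : C.arcDist x y = C.arcDist y x := by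
  rw [arcDist, arcDist, ← norm_neg, ← AddCircle.coe_neg, neg_sub]

theorem arcDist_nonneg (x y : E3) : 0 ≤ C.arcDist x y := norm_nonneg _

theorem arcDist_le (x y : E3) : C.arcDist x y ≤ C.L / 2 := by
  have := AddCircle.norm_le_half_period C.L (x := ((C.param x - C.param y : ℝ) : AddCircle C.L))
    C.L_pos.ne'
  rwa [abs_of_pos C.L_pos] at this

theorem measurable_arcDist : Measurable fun p : E3 × E3 => C.arcDist p.1 p.2 := by
  have h : Measurable fun t : ℝ => ‖(t : AddCircle C.L)‖ :=
    (continuous_norm.comp (AddCircle.continuous_mk' C.L)).measurable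
  exact h.comp ((C.measurable_param.comp measurable_fst).sub
    (C.measurable_param.comp measurable_snd))

theorem measurable_arcDist_right (x : E3) : Measurable (C.arcDist x) := by
  have h : Measurable fun t : ℝ => ‖(t : AddCircle C.L)‖ :=
    (continuous_norm.comp (AddCircle.continuous_mk' C.L)).measurable
  exact h.comp (C.measurable_param.const_sub (C.param x))

theorem arcDist_σ (a b : ℝ) : C.arcDist (C.σ a) (C.σ b) = ‖((a - b : ℝ) : AddCircle C.L)‖ := by
  have h : ∀ a, ((C.param (C.σ a) : ℝ) : AddCircle C.L) = (a : AddCircle C.L) := fun a =>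
    C.σ_eq_iff.1 (C.σ_param a)
  rw [arcDist, AddCircle.coe_sub, h, h, AddCircle.coe_sub]

theorem arcDist_σ_add {s t : ℝ} (ht : |t| ≤ C.L / 2) : C.arcDist (C.σ s) (C.σ (s + t)) = |t| := by
  rw [arcDist_comm, arcDist_σ, add_sub_cancel_left, AddCircle.norm_coe_eq_abs_iff _ C.L_pos.ne',
    abs_of_pos C.L_pos]
  exact ht

theorem exists_eq_σ_add (s : ℝ) {y : E3} (hy : y ∈ C.carrier) :
    ∃ t, |t| ≤ C.L / 2 ∧ y = C.σ (s + t) := by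
  obtain ⟨b, rfl⟩ := hy
  have hmem := toIocMod_mem_Ioc C.L_pos (-(C.L / 2)) (b - s)
  refine ⟨toIocMod C.L_pos (-(C.L / 2)) (b - s), abs_le.2 ⟨hmem.1.le, by linarith [hmem.2]⟩, ?_⟩
  rw [toIocMod, ← add_sub_assoc, add_sub_cancel]
  exact (C.periodic.sub_zsmul_eq _).symm

theorem mem_arc_iff {s δ : ℝ} {y : E3} (hy : y ∈ C.carrier) :
    y ∈ C.arc s δ ↔ C.arcDist (C.σ s) y < δ := by
  constructor
  · rintro ⟨b, hb, rfl⟩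
    rw [arcDist_comm, arcDist_σ]
    refine (QuotientAddGroup.norm_mk_le_norm).trans_lt ?_
    rw [Real.norm_eq_abs, abs_lt]
    exact ⟨by linarith [hb.1], by linarith [hb.2]⟩
  · intro h
    obtain ⟨t, ht, rfl⟩ := C.exists_eq_σ_add s hy
    rw [C.arcDist_σ_add ht, abs_lt] at h
    exact ⟨s + t, ⟨by linarith [h.1], by linarith [h.2]⟩, rfl⟩

theorem norm_sub_le_arcDist {x y : E3} (hx : x ∈ C.carrier) (hy : y ∈ C.carrier) :
    ‖x - y‖ ≤ C.arcDist x y := by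
  obtain ⟨s, rfl⟩ := hx
  obtain ⟨t, ht, rfl⟩ := C.exists_eq_σ_add s hy
  rw [C.arcDist_σ_add ht]
  refine (C.norm_sub_le _ _).trans_eq ?_
  rw [sub_add_cancel_left, abs_neg]

theorem arcDist_self (x : E3) : C.arcDist x x = 0 := by
  simp [arcDist]

theorem exists_inv_norm_le : ∃ K : ℝ, 0 ≤ K ∧ ∀ x ∈ C.carrier, ∀ y ∈ C.carrier,
    ‖x - y‖⁻¹ ≤ (C.arcDist x y)⁻¹ + K := by
  obtain ⟨K, hK0, hK⟩ := C.exists_inv_norm_sub_le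
  refine ⟨K, hK0, ?_⟩
  rintro _ ⟨s, rfl⟩ y hy
  obtain ⟨t, ht, rfl⟩ := C.exists_eq_σ_add s hy
  rw [C.arcDist_σ_add ht, norm_sub_rev]
  by_cases h0 : t = 0
  · simpa [h0] using hK0
  · exact hK s t h0 ht

/-- The constant in the comparison of chord length and arc length. -/
def chordConst : ℝ := C.exists_inv_norm_le.choose

theorem chordConst_nonneg : 0 ≤ C.chordConst := C.exists_inv_norm_le.choose_spec.1

theorem inv_norm_le {x y : E3} (hx : x ∈ C.carrier) (hy : y ∈ C.carrier) :
    ‖x - y‖⁻¹ ≤ (C.arcDist x y)⁻¹ + C.chordConst := C.exists_inv_norm_le.choose_spec.2 x hx y hy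

/-- The ratio in the comparison of chord length and arc length. -/
def chordRatio : ℝ := (1 + C.chordConst * (C.L / 2))⁻¹

theorem chordRatio_pos : 0 < C.chordRatio := by
  have := C.chordConst_nonneg
  have := C.L_pos
  unfold chordRatio
  positivity

/-- Multiplying 1/|x - y| ≤ 1/d + K by d|x - y| gives d ≤ (1 + Kd)|x - y|, and d ≤ L/2. -/
theorem chordRatio_mul_le {x y : E3} (hx : x ∈ C.carrier) (hy : y ∈ C.carrier) :
    C.chordRatio * C.arcDist x y ≤ ‖x - y‖ := by
  have h0 := C.arcDist_nonneg x y
  rcases h0.eq_or_lt with h | h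
  · rw [← h, mul_zero]
    exact norm_nonneg _
  have hK := C.chordConst_nonneg
  have hL := C.L_pos
  have h1 := C.inv_norm_le hx hy
  have hne : 0 < ‖x - y‖ := by
    rw [norm_pos_iff, sub_ne_zero]
    rintro rfl
    rw [arcDist_self] at h
    exact lt_irrefl _ h
  have h2 := C.arcDist_le x y
  rw [inv_le_iff_one_le_mul₀ hne] at h1
  rw [chordRatio, inv_mul_le_iff₀ (by positivity)]
  have h3 : C.arcDist x y ≤ C.arcDist x y * (((C.arcDist x y)⁻¹ + C.chordConst) * ‖x - y‖) :=
    le_mul_of_one_le_right h0 h1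
  have h4 : C.arcDist x y * (((C.arcDist x y)⁻¹ + C.chordConst) * ‖x - y‖)
      = (1 + C.chordConst * C.arcDist x y) * ‖x - y‖ := by
    field_simp
  rw [h4] at h3
  refine h3.trans ?_
  gcongr

/-- The arc length measure in terms of an arbitrary base point. -/
theorem arcLength_eq_map (s : ℝ) : C.arcLength =
    (volume.restrict (Ioc (-(C.L / 2)) (C.L / 2))).map fun t => C.σ (s + t) := by
  have hm : Measurable fun t => C.σ (s + t) :=
    (C.continuous_σ.comp (continuous_const_add s)).measurable
  ext A hA
  have hA' := C.continuous_σ.measurable hA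
  rw [arcLength, Measure.map_apply C.continuous_σ.measurable hA, Measure.map_apply hm hA,
    restrict_Ico_eq_restrict_Ioc, Measure.restrict_apply hA', Measure.restrict_apply (hm hA)]
  have h1 : volume ((fun t => C.σ (s + t)) ⁻¹' A ∩ Ioc (-(C.L / 2)) (C.L / 2))
      = volume (C.σ ⁻¹' A ∩ Ioc (s - C.L / 2) (s - C.L / 2 + C.L)) := by
    rw [← measure_preimage_add volume s (C.σ ⁻¹' A ∩ Ioc (s - C.L / 2) (s - C.L / 2 + C.L))]
    congr 1
    ext t
    simp only [mem_inter_iff, mem_preimage, mem_Ioc]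
    refine and_congr_right fun _ => ⟨fun h => ⟨?_, ?_⟩, fun h => ⟨?_, ?_⟩⟩ <;> linarith [h.1, h.2]
  rw [h1]
  -- Any two half-open intervals of length L are fundamental domains for translation by Lℤ, so they
  -- measure an L-periodic set equally.
  have h2 := (isAddFundamentalDomain_Ioc C.L_pos 0 volume).measure_set_eq
    (isAddFundamentalDomain_Ioc C.L_pos (s - C.L / 2) volume) hA' (fun g => ?_)
  · simpa using h2
  · obtain ⟨g, n, rfl⟩ := g
    ext x
    simp only [mem_preimage]
    have : C.σ (((⟨n • C.L, n, rfl⟩ : AddSubgroup.zmultiples C.L)) +ᵥ x) = C.σ x := by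
      change C.σ (n • C.L + x) = C.σ x
      rw [add_comm]
      exact C.periodic.zsmul n x
    rw [← this]

end ClosedCurve

end

noncomputable section

open UnboundedOp

/-! ### The Yukawa potential -/

theorem yukawa_nonneg (lam : ℝ) {r : ℝ} (hr : 0 ≤ r) : 0 ≤ yukawa lam r := by
  unfold yukawa
  positivity

theorem yukawa_le (lam : ℝ) {r : ℝ} (hr : 0 ≤ r) : yukawa lam r ≤ (4 * Real.pi)⁻¹ * r⁻¹ := by
  rw [yukawa, ← mul_inv, ← one_div]
  gcongr
  rw [Real.exp_le_one_iff, neg_nonpos]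
  positivity

theorem le_yukawa (lam : ℝ) {r : ℝ} (hr : 0 ≤ r) :
    (4 * Real.pi)⁻¹ * (r⁻¹ - √(-lam)) ≤ yukawa lam r := by
  -- At r = 0 division by zero makes the potential 0 and the lower bound nonpositive.
  rcases hr.eq_or_lt with rfl | hr
  · simp only [yukawa, inv_zero, zero_sub, mul_zero, div_zero]
    have : 0 ≤ √(-lam) := Real.sqrt_nonneg _
    have h2 : 0 < (4 * Real.pi)⁻¹ := by positivity
    nlinarith
  · have h1 := Real.add_one_le_exp (-(√(-lam) * r))
    rw [yukawa, le_div_iff₀ (by positivity)]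
    refine le_trans (le_of_eq ?_) h1
    field_simp
    ring

theorem measurable_yukawa (lam : ℝ) : Measurable (yukawa lam) := by
  unfold yukawa
  fun_prop

namespace ClosedCurve

variable (C : ClosedCurve)

theorem kern_eq (lam : ℝ) (x y : E3) : kern lam x y = (yukawa lam ‖x - y‖ : ℂ) := rfl

/-! ### The regular part of the kernel -/

/-- The singular part of the kernel, `1 / (4π d(x, y))` with the distance along the curve. -/
def arcKernel (x y : E3) : ℝ := (4 * Real.pi)⁻¹ * (C.arcDist x y)⁻¹

/-- The regular part of the kernel. -/
def regKernel (lam : ℝ) (x y : E3) : ℝ := yukawa lam ‖x - y‖ - C.arcKernel x y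

theorem measurable_arcKernel : Measurable fun p : E3 × E3 => C.arcKernel p.1 p.2 :=
  C.measurable_arcDist.inv.const_mul _

theorem measurable_chordKernel (lam : ℝ) :
    Measurable fun p : E3 × E3 => yukawa lam ‖p.1 - p.2‖ :=
  (measurable_yukawa lam).comp (by fun_prop)

theorem measurable_regKernel (lam : ℝ) : Measurable fun p : E3 × E3 => C.regKernel lam p.1 p.2 :=
  (measurable_chordKernel lam).sub C.measurable_arcKernel

theorem regKernel_comm (lam : ℝ) (x y : E3) : C.regKernel lam x y = C.regKernel lam y x := by
  rw [regKernel, regKernel, arcKernel, arcKernel, norm_sub_rev, arcDist_comm]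

theorem arcDist_pos {x y : E3} (hx : x ∈ C.carrier) (hy : y ∈ C.carrier) (hxy : x ≠ y) :
    0 < C.arcDist x y :=
  (norm_pos_iff.2 (sub_ne_zero.2 hxy)).trans_le (C.norm_sub_le_arcDist hx hy)

theorem inv_arcDist_le {x y : E3} (hx : x ∈ C.carrier) (hy : y ∈ C.carrier) :
    (C.arcDist x y)⁻¹ ≤ ‖x - y‖⁻¹ := by
  by_cases hxy : x = y
  · rw [hxy, arcDist_self, sub_self, norm_zero]
  · exact inv_anti₀ (norm_pos_iff.2 (sub_ne_zero.2 hxy)) (C.norm_sub_le_arcDist hx hy)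

/-- A bound for the regular part of the kernel. -/
def regBound (lam : ℝ) : ℝ := (4 * Real.pi)⁻¹ * (√(-lam) + C.chordConst)

theorem regBound_nonneg (lam : ℝ) : 0 ≤ C.regBound lam := by
  have := C.chordConst_nonneg
  unfold regBound
  positivity

/-- The upper bound compares chord and arc; the lower one uses e^{-κr} ≥ 1 - κr with κ = √(-λ), and
that the chord is at most the arc. -/
theorem abs_regKernel_le (lam : ℝ) {x y : E3} (hx : x ∈ C.carrier) (hy : y ∈ C.carrier) :
    |C.regKernel lam x y| ≤ C.regBound lam := by
  have h1 := yukawa_le lam (norm_nonneg (x - y))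
  have h2 := le_yukawa lam (norm_nonneg (x - y))
  have h3 := C.inv_arcDist_le hx hy
  have h4 := C.inv_norm_le hx hy
  have h5 := C.chordConst_nonneg
  have h6 : 0 ≤ √(-lam) := Real.sqrt_nonneg _
  have hp : 0 < (4 * Real.pi)⁻¹ := by positivity
  rw [regKernel, arcKernel, regBound, abs_le]
  constructor <;> nlinarith

/-- An upper bound that retains the exponential. The subtracted term, integrated over Σ, grows
logarithmically as λ → -∞. -/
theorem regKernel_le (lam : ℝ) {x y : E3} (hx : x ∈ C.carrier) (hy : y ∈ C.carrier) :
    C.regKernel lam x y ≤ (4 * Real.pi)⁻¹ * C.chordConst -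
      (4 * Real.pi)⁻¹ * ((1 - Real.exp (-(√(-lam) * (C.chordRatio * C.arcDist x y)))) *
        (C.arcDist x y)⁻¹) := by
  have h3 := C.inv_arcDist_le hx hy
  have h4 := C.inv_norm_le hx hy
  have h6 : 0 ≤ √(-lam) := Real.sqrt_nonneg _
  have h7 := C.chordRatio_mul_le hx hy
  have ha : 0 ≤ (C.arcDist x y)⁻¹ := inv_nonneg.2 (C.arcDist_nonneg x y)
  have hp : 0 < (4 * Real.pi)⁻¹ := by positivity
  set e := Real.exp (-(√(-lam) * ‖x - y‖)) with he
  have he1 : e ≤ 1 := by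
    rw [he, Real.exp_le_one_iff, neg_nonpos]
    positivity
  have he0 : 0 < e := Real.exp_pos _
  have he2 : e ≤ Real.exp (-(√(-lam) * (C.chordRatio * C.arcDist x y))) := by
    rw [he, Real.exp_le_exp, neg_le_neg_iff]
    gcongr
  have hy' : yukawa lam ‖x - y‖ = (4 * Real.pi)⁻¹ * (e * ‖x - y‖⁻¹) := by
    rw [yukawa, ← he, div_eq_mul_inv, mul_inv]
    ring
  rw [regKernel, arcKernel, hy', ← mul_sub, ← mul_sub]
  refine mul_le_mul_of_nonneg_left ?_ hp.le
  have h8 : e * (‖x - y‖⁻¹ - (C.arcDist x y)⁻¹) ≤ C.chordConst := by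
    have : ‖x - y‖⁻¹ - (C.arcDist x y)⁻¹ ≤ C.chordConst := by linarith
    nlinarith
  have h9 : (e - Real.exp (-(√(-lam) * (C.chordRatio * C.arcDist x y)))) * (C.arcDist x y)⁻¹ ≤ 0 :=
    mul_nonpos_of_nonpos_of_nonneg (by linarith) ha
  nlinarith

/-! ### Integration along the curve -/

theorem integral_eq (s : ℝ) {F : E3 → ℂ} (hF : AEStronglyMeasurable F C.arcLength) :
    ∫ y, F y ∂C.arcLength = ∫ t in Ioc (-(C.L / 2)) (C.L / 2), F (C.σ (s + t)) := by
  have hm : Measurable fun t => C.σ (s + t) :=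
    (C.continuous_σ.comp (continuous_const_add s)).measurable
  rw [C.arcLength_eq_map s] at hF ⊢
  exact integral_map hm.aemeasurable hF

/-- Points at distance t from σ(s) come in pairs σ(s ± t); this is the factor 2. -/
theorem integral_comp_arcDist (s : ℝ) {G : ℝ → ℝ} (hG : Measurable G) :
    ∫ y, G (C.arcDist (C.σ s) y) ∂C.arcLength = 2 * ∫ t in Ioc 0 (C.L / 2), G t := by
  have hm : Measurable fun t => C.σ (s + t) :=
    (C.continuous_σ.comp (continuous_const_add s)).measurable
  have hGd : Measurable fun y => G (C.arcDist (C.σ s) y) :=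
    hG.comp (C.measurable_arcDist_right _)
  have h1 : ∫ y, G (C.arcDist (C.σ s) y) ∂C.arcLength
      = ∫ t in Ioc (-(C.L / 2)) (C.L / 2), G |t| := by
    conv_lhs => rw [C.arcLength_eq_map s]
    rw [integral_map hm.aemeasurable hGd.aestronglyMeasurable]
    refine setIntegral_congr_fun measurableSet_Ioc fun t ht => ?_
    rw [C.arcDist_σ_add (abs_le.2 ⟨ht.1.le, ht.2⟩)]
  have h2 : ∫ t in Ioc (-(C.L / 2)) (C.L / 2), G |t| =
      ∫ t, (Iic (C.L / 2)).indicator G |t| := by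
    rw [← integral_Icc_eq_integral_Ioc, ← integral_indicator measurableSet_Icc]
    refine integral_congr_ae (ae_of_all _ fun t => ?_)
    dsimp only
    by_cases ht : |t| ≤ C.L / 2
    · rw [indicator_of_mem (show t ∈ Icc _ _ from abs_le.1 ht), indicator_of_mem (mem_Iic.2 ht)]
    · rw [indicator_of_notMem (show t ∉ Icc _ _ from fun h => ht (abs_le.2 h)),
        indicator_of_notMem (show |t| ∉ Iic _ from ht)]
  rw [h1, h2, integral_comp_abs, setIntegral_indicator measurableSet_Iic, Ioi_inter_Iic]

theorem measurableSet_le_arcDist (x : E3) (δ : ℝ) : MeasurableSet {y | δ ≤ C.arcDist x y} :=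
  measurableSet_le measurable_const (C.measurable_arcDist_right _)

/-- The integral of the singular part of the kernel outside an arc. -/
theorem integral_arcKernel (s : ℝ) {δ : ℝ} (hδ : 0 < δ) (hδL : δ < C.L / 2) :
    ∫ y in {y | δ ≤ C.arcDist (C.σ s) y}, C.arcKernel (C.σ s) y ∂C.arcLength =
      (Real.log (C.L / 2) - Real.log δ) / (2 * Real.pi) := by
  rw [← integral_indicator (C.measurableSet_le_arcDist _ _)]
  have h1 : ∀ y, ({y | δ ≤ C.arcDist (C.σ s) y}).indicator (fun y => C.arcKernel (C.σ s) y) y =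
      (Ici δ).indicator (fun r => (4 * Real.pi)⁻¹ * r⁻¹) (C.arcDist (C.σ s) y) := fun y => by
    by_cases h : δ ≤ C.arcDist (C.σ s) y
    · rw [indicator_of_mem (show y ∈ {y | δ ≤ C.arcDist (C.σ s) y} from h),
        indicator_of_mem (mem_Ici.2 h), arcKernel]
    · rw [indicator_of_notMem (show y ∉ {y | δ ≤ C.arcDist (C.σ s) y} from h),
        indicator_of_notMem (show C.arcDist (C.σ s) y ∉ Ici δ from h)]
  simp only [h1]
  rw [C.integral_comp_arcDist s ((measurable_inv.const_mul _).indicator measurableSet_Ici),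
    setIntegral_indicator measurableSet_Ici]
  have h2 : Ioc 0 (C.L / 2) ∩ Ici δ = Icc δ (C.L / 2) := by
    ext t
    simp only [mem_inter_iff, mem_Ioc, mem_Ici, mem_Icc]
    exact ⟨fun h => ⟨h.2, h.1.2⟩, fun h => ⟨⟨hδ.trans_le h.1, h.2⟩, h.1⟩⟩
  rw [h2, integral_const_mul, integral_Icc_eq_integral_Ioc,
    ← intervalIntegral.integral_of_le hδL.le, integral_inv_of_pos hδ (hδ.trans hδL),
    Real.log_div (by linarith) hδ.ne']
  field_simp
  norm_num

/-! ### Bounded kernels -/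

theorem ae_mem_carrier_prod :
    ∀ᵐ p ∂(C.arcLength.prod C.arcLength), p.1 ∈ C.carrier ∧ p.2 ∈ C.carrier := by
  filter_upwards [Measure.quasiMeasurePreserving_fst.ae C.ae_mem_carrier,
    Measure.quasiMeasurePreserving_snd.ae C.ae_mem_carrier] with p h1 h2 using ⟨h1, h2⟩

theorem integrable_prod_of_bound {F : E3 → E3 → ℂ} {M : ℝ}
    (hF : Measurable fun p : E3 × E3 => F p.1 p.2)
    (hM : ∀ x ∈ C.carrier, ∀ y ∈ C.carrier, ‖F x y‖ ≤ M) :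
    Integrable (fun p : E3 × E3 => F p.1 p.2) (C.arcLength.prod C.arcLength) := by
  refine Integrable.of_bound hF.aestronglyMeasurable M ?_
  filter_upwards [C.ae_mem_carrier_prod] with p hp using hM _ hp.1 _ hp.2

theorem integrable_of_bound {F : E3 → ℂ} {M : ℝ} (hF : Measurable F)
    (hM : ∀ y ∈ C.carrier, ‖F y‖ ≤ M) : Integrable F C.arcLength := by
  refine Integrable.of_bound hF.aestronglyMeasurable M ?_
  filter_upwards [C.ae_mem_carrier] with y hy using hM y hy

variable {C}

/-! ### Regularized potentials of Lipschitz functions -/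

theorem IsLipschitz.exists_extend {f : E3 → ℂ} (hf : C.IsLipschitz f) :
    ∃ K, ∃ g : E3 → ℂ, LipschitzWith K g ∧ EqOn f g C.carrier := by
  obtain ⟨K, hK⟩ := hf
  obtain ⟨g, hg, hfg⟩ := hK.extend_finite_dimension
  exact ⟨_, g, hg, hfg⟩

variable (C)

theorem exists_bound_of_continuous {g : E3 → ℂ} (hg : Continuous g) :
    ∃ M, 0 ≤ M ∧ ∀ x ∈ C.carrier, ‖g x‖ ≤ M := by
  obtain ⟨M, hM⟩ := C.isCompact_carrier.exists_bound_of_continuousOn hg.continuousOn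
  exact ⟨max M 0, le_max_right _ _, fun x hx => (hM x hx).trans (le_max_left _ _)⟩

theorem norm_sub_mul_kern_le {K : NNReal} {g : E3 → ℂ} (hg : LipschitzWith K g) (lam : ℝ)
    (x y : E3) : ‖(g y - g x) * kern lam x y‖ ≤ K * (4 * Real.pi)⁻¹ := by
  rw [kern_eq, norm_mul, Complex.norm_real, Real.norm_of_nonneg (yukawa_nonneg lam (norm_nonneg _))]
  have h1 := hg.dist_le_mul y x
  rw [dist_eq_norm, dist_eq_norm, norm_sub_rev y x] at h1
  have h2 := yukawa_le lam (norm_nonneg (x - y))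
  calc ‖g y - g x‖ * yukawa lam ‖x - y‖
      ≤ (K * ‖x - y‖) * ((4 * Real.pi)⁻¹ * ‖x - y‖⁻¹) := by
        have := yukawa_nonneg lam (norm_nonneg (x - y))
        gcongr
    _ = K * (4 * Real.pi)⁻¹ * (‖x - y‖ * ‖x - y‖⁻¹) := by ring
    _ ≤ K * (4 * Real.pi)⁻¹ * 1 := by
        gcongr
        exact mul_inv_le_one
    _ = _ := mul_one _

/-- The integrand in the formula for the regularized potential. -/
def potentialIntegrand (lam : ℝ) (f : E3 → ℂ) (x y : E3) : ℂ :=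
  (f y - f x) * kern lam x y + f x * (C.regKernel lam x y : ℂ)

/-- The regularized potential of a Lipschitz function. -/
def potential (lam : ℝ) (f : E3 → ℂ) (x : E3) : ℂ :=
  (∫ y, C.potentialIntegrand lam f x y ∂C.arcLength) +
    f x * ((Real.log (C.L / 2) / (2 * Real.pi) : ℝ) : ℂ)

theorem measurable_kern (lam : ℝ) : Measurable fun p : E3 × E3 => kern lam p.1 p.2 :=
  Complex.measurable_ofReal.comp (measurable_chordKernel lam)

theorem measurable_sub_mul_kern {g : E3 → ℂ} (hg : Continuous g) (lam : ℝ) :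
    Measurable fun p : E3 × E3 => (g p.2 - g p.1) * kern lam p.1 p.2 :=
  (by fun_prop : Continuous fun p : E3 × E3 => g p.2 - g p.1).measurable.mul (measurable_kern lam)

theorem measurable_potentialIntegrand {g : E3 → ℂ} (hg : Continuous g) (lam : ℝ) :
    Measurable fun p : E3 × E3 => C.potentialIntegrand lam g p.1 p.2 :=
  (measurable_sub_mul_kern hg lam).add
    ((by fun_prop : Continuous fun p : E3 × E3 => g p.1).measurable.mul
      (Complex.measurable_ofReal.comp (C.measurable_regKernel lam)))

theorem exists_bound_potentialIntegrand {K : NNReal} {g : E3 → ℂ} (hg : LipschitzWith K g)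
    (lam : ℝ) : ∃ M, ∀ x ∈ C.carrier, ∀ y ∈ C.carrier, ‖C.potentialIntegrand lam g x y‖ ≤ M := by
  obtain ⟨M, hM0, hM⟩ := C.exists_bound_of_continuous hg.continuous
  refine ⟨K * (4 * Real.pi)⁻¹ + M * C.regBound lam, fun x hx y hy => ?_⟩
  refine (norm_add_le _ _).trans (add_le_add (norm_sub_mul_kern_le hg lam x y) ?_)
  rw [norm_mul, Complex.norm_real, Real.norm_eq_abs]
  have := C.abs_regKernel_le lam hx hy
  have := hM x hx
  gcongr

theorem stronglyMeasurable_potential {g : E3 → ℂ} (hg : Continuous g) (lam : ℝ) :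
    StronglyMeasurable (C.potential lam g) :=
  ((C.measurable_potentialIntegrand hg lam).stronglyMeasurable.integral_prod_right').add
    (hg.stronglyMeasurable.mul stronglyMeasurable_const)

theorem memLp_potential {K : NNReal} {g : E3 → ℂ} (hg : LipschitzWith K g) (lam : ℝ) :
    MemLp (C.potential lam g) 2 C.arcLength := by
  obtain ⟨M, hM⟩ := C.exists_bound_potentialIntegrand hg lam
  obtain ⟨M', hM0', hM'⟩ := C.exists_bound_of_continuous hg.continuous
  refine MemLp.of_bound (C.stronglyMeasurable_potential hg.continuous lam).aestronglyMeasurable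
    (M * C.arcLength.real univ + M' * ‖((Real.log (C.L / 2) / (2 * Real.pi) : ℝ) : ℂ)‖) ?_
  filter_upwards [C.ae_mem_carrier] with x hx
  refine (norm_add_le _ _).trans (add_le_add ?_ ?_)
  · refine norm_integral_le_of_norm_le_const ?_
    filter_upwards [C.ae_mem_carrier] with y hy using hM x hx y hy
  · rw [norm_mul]
    gcongr
    exact hM' x hx

theorem carrier_diff_arc_ae_eq (s δ : ℝ) :
    (C.carrier \ C.arc s δ : Set E3) =ᵐ[C.arcLength] {y | δ ≤ C.arcDist (C.σ s) y} := by
  filter_upwards [C.ae_mem_carrier] with y hy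
  apply propext
  change (y ∈ C.carrier ∧ ¬ y ∈ C.arc s δ) ↔ δ ≤ C.arcDist (C.σ s) y
  rw [C.mem_arc_iff hy, not_lt]
  exact and_iff_right hy

theorem integrableOn_mul_kern {g : E3 → ℂ} (hg : Continuous g) (lam s : ℝ) {δ : ℝ} (hδ : 0 < δ) :
    IntegrableOn (fun y => g y * kern lam (C.σ s) y) {y | δ ≤ C.arcDist (C.σ s) y}
      C.arcLength := by
  obtain ⟨M, hM0, hM⟩ := C.exists_bound_of_continuous hg
  have hc := C.chordRatio_pos
  refine Measure.integrableOn_of_bounded (M := M * ((4 * Real.pi)⁻¹ * (C.chordRatio * δ)⁻¹))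
    (measure_ne_top _ _) ?_ ?_
  · exact (hg.measurable.mul
      ((measurable_kern lam).comp measurable_prodMk_left)).aestronglyMeasurable
  · rw [ae_restrict_iff' (C.measurableSet_le_arcDist _ _)]
    filter_upwards [C.ae_mem_carrier] with y hy hyδ
    rw [norm_mul, kern_eq, Complex.norm_real,
      Real.norm_of_nonneg (yukawa_nonneg lam (norm_nonneg _))]
    refine mul_le_mul (hM y hy) ?_ (yukawa_nonneg lam (norm_nonneg _)) hM0
    refine (yukawa_le lam (norm_nonneg _)).trans ?_
    gcongr
    exact (mul_le_mul_of_nonneg_left hyδ hc.le).trans (C.chordRatio_mul_le (mem_range_self s) hy)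

theorem integrable_arcKernel (s : ℝ) {δ : ℝ} (hδ : 0 < δ) :
    IntegrableOn (fun y => C.arcKernel (C.σ s) y) {y | δ ≤ C.arcDist (C.σ s) y} C.arcLength := by
  refine Measure.integrableOn_of_bounded (M := (4 * Real.pi)⁻¹ * δ⁻¹) (measure_ne_top _ _)
    (C.measurable_arcKernel.comp measurable_prodMk_left).aestronglyMeasurable ?_
  rw [ae_restrict_iff' (C.measurableSet_le_arcDist _ _)]
  refine ae_of_all _ fun y hy => ?_
  have : 0 ≤ C.arcDist (C.σ s) y := C.arcDist_nonneg _ _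
  rw [arcKernel, Real.norm_of_nonneg (by positivity)]
  gcongr
  exact hy

/-- Outside the arc, f(y)k(x, y), with k the kernel, is the bounded integrand plus f(x)/(4πd). The
latter integrates to f(x)(ln(L/2) - ln δ)/(2π), so the added f(x) ln δ/(2π) cancels the divergence
exactly and ln(L/2)/(2π) remains. The bounded part converges by dominated convergence. -/
theorem isRegularizedPotential_potential {K : NNReal} {g : E3 → ℂ} (hg : LipschitzWith K g)
    (lam : ℝ) : C.IsRegularizedPotential lam g (C.potential lam g) := by
  intro s
  have hL := C.L_pos
  refine ⟨fun δ hδ => (C.integrableOn_mul_kern hg.continuous lam s hδ).congr_set_ae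
    (C.carrier_diff_arc_ae_eq s δ), ?_⟩
  set x := C.σ s with hx
  have hxc : x ∈ C.carrier := mem_range_self s
  obtain ⟨M, hM⟩ := C.exists_bound_potentialIntegrand hg lam
  have hFm : Measurable (C.potentialIntegrand lam g x) :=
    (C.measurable_potentialIntegrand hg.continuous lam).comp measurable_prodMk_left
  have hFi : Integrable (C.potentialIntegrand lam g x) C.arcLength :=
    C.integrable_of_bound hFm (hM x hxc)
  have hlim : Tendsto (fun δ : ℝ => ∫ y in {y | δ ≤ C.arcDist x y},
      C.potentialIntegrand lam g x y ∂C.arcLength) (𝓝[>] 0)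
      (𝓝 (∫ y, C.potentialIntegrand lam g x y ∂C.arcLength)) := by
    simp only [← integral_indicator (C.measurableSet_le_arcDist x _)]
    refine tendsto_integral_filter_of_dominated_convergence
      (fun y => ‖C.potentialIntegrand lam g x y‖)
      (Eventually.of_forall fun δ =>
        (hFm.indicator (C.measurableSet_le_arcDist x δ)).aestronglyMeasurable)
      (Eventually.of_forall fun δ => ae_of_all _ fun y => norm_indicator_le_norm_self _ _)
      hFi.norm ?_
    have hne : ∀ᵐ y ∂C.arcLength, y ≠ x := by
      rw [ae_iff]
      simp
    filter_upwards [C.ae_mem_carrier, hne] with y hy hyx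
    refine tendsto_const_nhds.congr' ?_
    filter_upwards [mem_nhdsWithin_of_mem_nhds (Iio_mem_nhds (C.arcDist_pos hxc hy hyx.symm))]
      with δ hδ
    rw [indicator_of_mem]
    exact (mem_Iio.1 hδ).le
  refine (hlim.add_const _).congr' ?_
  filter_upwards [self_mem_nhdsWithin, mem_nhdsWithin_of_mem_nhds
    (Iio_mem_nhds (half_pos hL))] with δ hδ hδL
  rw [setIntegral_congr_set (C.carrier_diff_arc_ae_eq s δ)]
  have h1 : ∀ y, g y * kern lam x y = C.potentialIntegrand lam g x y +
      g x * (C.arcKernel x y : ℂ) := fun y => by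
    rw [potentialIntegrand, regKernel, kern_eq]
    push_cast
    ring
  have h2 : IntegrableOn (fun y => (C.arcKernel x y : ℂ)) {y | δ ≤ C.arcDist x y} C.arcLength :=
    (C.integrable_arcKernel s hδ).ofReal
  simp only [← hx, h1]
  rw [integral_add hFi.integrableOn (h2.const_mul _), integral_const_mul, integral_complex_ofReal,
    C.integral_arcKernel s hδ hδL]
  push_cast
  ring

/-- The graph of `B_lam` in terms of Lipschitz functions on the whole space. -/
theorem mem_graph_traceOp_iff (lam : ℝ) {h k : C.L2} :
    (h, k) ∈ (C.traceOp lam).graph ↔ ∃ K, ∃ g : E3 → ℂ, LipschitzWith K g ∧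
      h =ᵐ[C.arcLength] g ∧ k =ᵐ[C.arcLength] C.potential lam g := by
  rw [traceOp_graph]
  constructor
  · rintro ⟨f, k', hf, h1, h2, h3⟩
    obtain ⟨K, g, hg, hfg⟩ := hf.exists_extend
    refine ⟨K, g, hg, h1.trans ?_, h2.trans ?_⟩
    · filter_upwards [C.ae_mem_carrier] with y hy using hfg hy
    · filter_upwards [C.ae_mem_carrier] with y hy
      obtain ⟨s, rfl⟩ := hy
      refine tendsto_nhds_unique (h3 s).2 ?_
      have h4 := (C.isRegularizedPotential_potential hg lam s).2
      refine h4.congr fun δ => ?_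
      rw [← hfg (mem_range_self s)]
      congr 1
      refine integral_congr_ae (ae_restrict_of_ae ?_)
      filter_upwards [C.ae_mem_carrier] with z hz
      rw [hfg hz]
  · rintro ⟨K, g, hg, h1, h2⟩
    exact ⟨g, _, ⟨K, hg.lipschitzOnWith⟩, h1, h2, C.isRegularizedPotential_potential hg lam⟩

theorem mem_domain_traceOp_iff (lam : ℝ) (h : C.L2) :
    h ∈ (C.traceOp lam).domain ↔ ∃ f : E3 → ℂ, C.IsLipschitz f ∧ h =ᵐ[C.arcLength] f := by
  rw [LinearPMap.mem_domain_iff]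
  constructor
  · rintro ⟨k, hk⟩
    obtain ⟨K, g, hg, h1, -⟩ := (C.mem_graph_traceOp_iff lam).1 hk
    exact ⟨g, ⟨K, hg.lipschitzOnWith⟩, h1⟩
  · rintro ⟨f, hf, h1⟩
    obtain ⟨K, g, hg, hfg⟩ := hf.exists_extend
    refine ⟨(C.memLp_potential hg lam).toLp _, (C.mem_graph_traceOp_iff lam).2 ⟨K, g, hg, ?_,
      (C.memLp_potential hg lam).coeFn_toLp⟩⟩
    refine h1.trans ?_
    filter_upwards [C.ae_mem_carrier] with y hy using hfg hy

end ClosedCurve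

end

noncomputable section

open UnboundedOp
open scoped ComplexConjugate

namespace ClosedCurve

variable (C : ClosedCurve)

/-! ### The quadratic form of the boundary operator -/

theorem integrable_regKernel (lam : ℝ) {x : E3} (hx : x ∈ C.carrier) :
    Integrable (fun y => C.regKernel lam x y) C.arcLength := by
  refine Integrable.of_bound ((C.measurable_regKernel lam).comp
    measurable_prodMk_left).aestronglyMeasurable (C.regBound lam) ?_
  filter_upwards [C.ae_mem_carrier] with y hy using C.abs_regKernel_le lam hx hy

/-- The regularized potential of the constant function `1`. -/
def potentialOne (lam : ℝ) (x : E3) : ℝ :=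
  (∫ y, C.regKernel lam x y ∂C.arcLength) + Real.log (C.L / 2) / (2 * Real.pi)

theorem measurable_potentialOne (lam : ℝ) : Measurable (C.potentialOne lam) :=
  ((C.measurable_regKernel lam).stronglyMeasurable.integral_prod_right').measurable.add_const _

theorem abs_potentialOne_le (lam : ℝ) {x : E3} (hx : x ∈ C.carrier) :
    |C.potentialOne lam x| ≤ C.regBound lam * C.arcLength.real univ +
      |Real.log (C.L / 2) / (2 * Real.pi)| := by
  refine (abs_add_le _ _).trans (add_le_add ?_ le_rfl)
  rw [← Real.norm_eq_abs]
  refine norm_integral_le_of_norm_le_const ?_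
  filter_upwards [C.ae_mem_carrier] with y hy using C.abs_regKernel_le lam hx hy

theorem integrable_sub_mul_kern {K : NNReal} {g : E3 → ℂ} (hg : LipschitzWith K g) (lam : ℝ)
    (x : E3) : Integrable (fun y => (g y - g x) * kern lam x y) C.arcLength :=
  C.integrable_of_bound ((measurable_sub_mul_kern hg.continuous lam).comp measurable_prodMk_left)
    fun y _ => norm_sub_mul_kern_le hg lam x y

theorem potential_eq {K : NNReal} {g : E3 → ℂ} (hg : LipschitzWith K g) (lam : ℝ) {x : E3}
    (hx : x ∈ C.carrier) : C.potential lam g x =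
      (∫ y, (g y - g x) * kern lam x y ∂C.arcLength) + g x * (C.potentialOne lam x : ℂ) := by
  have h1 : Integrable (fun y => (C.regKernel lam x y : ℂ)) C.arcLength :=
    (C.integrable_regKernel lam hx).ofReal
  simp only [potential, potentialIntegrand]
  rw [integral_add (C.integrable_sub_mul_kern hg lam x) (h1.const_mul _), integral_const_mul,
    integral_complex_ofReal, potentialOne]
  push_cast
  ring

/-- Exchanging x and y and averaging turns the form into a Dirichlet-type double integral plus
multiplication by B_λ1. Symmetry and the upper bound of B_λ are both read off from this formula. -/
theorem integral_conj_mul_potential {K K' : NNReal} {g g' : E3 → ℂ} (hg : LipschitzWith K g)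
    (hg' : LipschitzWith K' g') (lam : ℝ) :
    ∫ x, conj (g' x) * C.potential lam g x ∂C.arcLength =
      -(1 / 2) * (∫ p : E3 × E3, conj (g' p.2 - g' p.1) * ((g p.2 - g p.1) * kern lam p.1 p.2)
        ∂(C.arcLength.prod C.arcLength)) +
      ∫ x, conj (g' x) * (g x * (C.potentialOne lam x : ℂ)) ∂C.arcLength := by
  obtain ⟨M, hM0, hM⟩ := C.exists_bound_of_continuous hg.continuous
  obtain ⟨M', hM0', hM'⟩ := C.exists_bound_of_continuous hg'.continuous
  have hgm := hg.continuous.measurable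
  have hgm' := hg'.continuous.measurable
  have hconj : Measurable fun z : ℂ => conj z := Complex.continuous_conj.measurable
  set Φ : E3 → E3 → ℂ := fun x y => conj (g' x) * ((g y - g x) * kern lam x y) with hΦ
  have hΦm : Measurable fun p : E3 × E3 => Φ p.1 p.2 :=
    (hconj.comp (hgm'.comp measurable_fst)).mul (measurable_sub_mul_kern hg.continuous lam)
  have hΦi : Integrable (fun p : E3 × E3 => Φ p.1 p.2) (C.arcLength.prod C.arcLength) := by
    refine C.integrable_prod_of_bound (M := M' * (K * (4 * Real.pi)⁻¹)) hΦm fun x hx y hy => ?_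
    rw [hΦ, norm_mul, RCLike.norm_conj]
    exact mul_le_mul (hM' x hx) (norm_sub_mul_kern_le hg lam x y) (norm_nonneg _) hM0'
  have hΦ1 : Integrable (fun x => ∫ y, Φ x y ∂C.arcLength) C.arcLength := hΦi.integral_prod_left
  have h2 : Integrable (fun x => conj (g' x) * (g x * (C.potentialOne lam x : ℂ))) C.arcLength := by
    refine C.integrable_of_bound (M := M' * (M * (C.regBound lam * C.arcLength.real univ +
      |Real.log (C.L / 2) / (2 * Real.pi)|)))
      ((hconj.comp hgm').mul (hgm.mul (Complex.measurable_ofReal.comp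
        (C.measurable_potentialOne lam)))) fun x hx => ?_
    rw [norm_mul, norm_mul, RCLike.norm_conj, Complex.norm_real, Real.norm_eq_abs]
    refine mul_le_mul (hM' x hx) ?_ (by positivity) hM0'
    exact mul_le_mul (hM x hx) (C.abs_potentialOne_le lam hx) (abs_nonneg _) hM0
  have h3 : ∫ x, conj (g' x) * C.potential lam g x ∂C.arcLength =
      ∫ x, ((∫ y, Φ x y ∂C.arcLength) + conj (g' x) * (g x * (C.potentialOne lam x : ℂ)))
        ∂C.arcLength := by
    refine integral_congr_ae ?_
    filter_upwards [C.ae_mem_carrier] with x hx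
    rw [C.potential_eq hg lam hx, mul_add, ← integral_const_mul]
  rw [h3, integral_add hΦ1 h2]
  congr 1
  have h4 : ∫ x, ∫ y, Φ x y ∂C.arcLength ∂C.arcLength =
      ∫ p : E3 × E3, Φ p.1 p.2 ∂(C.arcLength.prod C.arcLength) := integral_integral hΦi
  have h5 : ∫ p : E3 × E3, Φ p.2 p.1 ∂(C.arcLength.prod C.arcLength) =
      ∫ p : E3 × E3, Φ p.1 p.2 ∂(C.arcLength.prod C.arcLength) :=
    integral_prod_swap (fun p : E3 × E3 => Φ p.1 p.2)
  have h6 : ∫ p : E3 × E3, conj (g' p.2 - g' p.1) * ((g p.2 - g p.1) * kern lam p.1 p.2)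
        ∂(C.arcLength.prod C.arcLength) =
      -((∫ p : E3 × E3, Φ p.1 p.2 ∂(C.arcLength.prod C.arcLength)) +
        ∫ p : E3 × E3, Φ p.2 p.1 ∂(C.arcLength.prod C.arcLength)) := by
    have hΦs : Integrable (fun p : E3 × E3 => Φ p.2 p.1) (C.arcLength.prod C.arcLength) := hΦi.swap
    rw [← integral_add hΦi hΦs, ← integral_neg]
    refine integral_congr_ae (ae_of_all _ fun p => ?_)
    have h7 : kern lam p.2 p.1 = kern lam p.1 p.2 := by rw [kern_eq, kern_eq, norm_sub_rev]
    simp only [hΦ, map_sub, h7]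
    ring
  rw [h6, h5, h4]
  ring

theorem inner_eq_integral {h k : C.L2} {g p : E3 → ℂ} (hg : h =ᵐ[C.arcLength] g)
    (hp : k =ᵐ[C.arcLength] p) : inner ℂ h k = ∫ x, conj (g x) * p x ∂C.arcLength := by
  rw [L2.inner_def]
  refine integral_congr_ae ?_
  filter_upwards [hg, hp] with x h1 h2
  rw [h1, h2, RCLike.inner_apply, mul_comm]

theorem inner_traceOp_symm (lam : ℝ) {h k h' k' : C.L2} (hk : (h, k) ∈ (C.traceOp lam).graph)
    (hk' : (h', k') ∈ (C.traceOp lam).graph) : inner ℂ k h' = inner ℂ h k' := by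
  obtain ⟨K, g, hg, h1, h2⟩ := (C.mem_graph_traceOp_iff lam).1 hk
  obtain ⟨K', g', hg', h1', h2'⟩ := (C.mem_graph_traceOp_iff lam).1 hk'
  rw [← inner_conj_symm, C.inner_eq_integral h1' h2, C.inner_eq_integral h1 h2',
    C.integral_conj_mul_potential hg hg', C.integral_conj_mul_potential hg' hg, map_add, map_mul,
    ← integral_conj, ← integral_conj]
  congr 1
  · congr 1
    · simp [Complex.conj_ofNat]
    · refine integral_congr_ae (ae_of_all _ fun p => ?_)
      simp only [map_mul, Complex.conj_conj, kern_eq, Complex.conj_ofReal]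
      ring
  · refine integral_congr_ae (ae_of_all _ fun x => ?_)
    simp only [map_mul, Complex.conj_conj, Complex.conj_ofReal]
    ring

/-- The double integral is nonnegative and enters with a minus sign, so an upper bound for B_λ1
bounds the whole operator. -/
theorem re_inner_traceOp_le {lam β : ℝ} (hβ : ∀ x ∈ C.carrier, C.potentialOne lam x ≤ β)
    {h k : C.L2} (hk : (h, k) ∈ (C.traceOp lam).graph) :
    (inner ℂ h k).re ≤ β * ‖h‖ ^ 2 := by
  obtain ⟨K, g, hg, h1, h2⟩ := (C.mem_graph_traceOp_iff lam).1 hk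
  obtain ⟨M, hM0, hM⟩ := C.exists_bound_of_continuous hg.continuous
  have hgm := hg.continuous.measurable
  have hn : ‖h‖ ^ 2 = ∫ x, ‖g x‖ ^ 2 ∂C.arcLength := by
    have h3 : ((‖h‖ ^ 2 : ℝ) : ℂ) = ((∫ x, ‖g x‖ ^ 2 ∂C.arcLength : ℝ) : ℂ) := by
      rw [← integral_complex_ofReal]
      have h4 := inner_self_eq_norm_sq_to_K (𝕜 := ℂ) h
      rw [C.inner_eq_integral h1 h1] at h4
      push_cast
      refine h4.symm.trans (integral_congr_ae (ae_of_all _ fun x => ?_))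
      dsimp only
      rw [Complex.conj_mul']
    exact_mod_cast h3
  have hA : ∫ p : E3 × E3, conj (g p.2 - g p.1) * ((g p.2 - g p.1) * kern lam p.1 p.2)
        ∂(C.arcLength.prod C.arcLength) =
      ((∫ p : E3 × E3, ‖g p.2 - g p.1‖ ^ 2 * yukawa lam ‖p.1 - p.2‖
        ∂(C.arcLength.prod C.arcLength) : ℝ) : ℂ) := by
    rw [← integral_complex_ofReal]
    refine integral_congr_ae (ae_of_all _ fun p => ?_)
    dsimp only
    rw [← mul_assoc, Complex.conj_mul', kern_eq]
    push_cast
    ring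
  have hB : ∫ x, conj (g x) * (g x * (C.potentialOne lam x : ℂ)) ∂C.arcLength =
      ((∫ x, ‖g x‖ ^ 2 * C.potentialOne lam x ∂C.arcLength : ℝ) : ℂ) := by
    rw [← integral_complex_ofReal]
    refine integral_congr_ae (ae_of_all _ fun x => ?_)
    dsimp only
    rw [← mul_assoc, Complex.conj_mul']
    push_cast
    ring
  have hgi : Integrable (fun x => ‖g x‖ ^ 2) C.arcLength := by
    refine Integrable.of_bound (hgm.norm.pow_const 2).aestronglyMeasurable (M ^ 2) ?_
    filter_upwards [C.ae_mem_carrier] with x hx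
    rw [norm_pow, norm_norm]
    have := hM x hx
    gcongr
  have hbi : Integrable (fun x => ‖g x‖ ^ 2 * C.potentialOne lam x) C.arcLength := by
    refine hgi.mul_bdd (c := C.regBound lam * C.arcLength.real univ +
      |Real.log (C.L / 2) / (2 * Real.pi)|) (C.measurable_potentialOne lam).aestronglyMeasurable ?_
    filter_upwards [C.ae_mem_carrier] with x hx using C.abs_potentialOne_le lam hx
  rw [C.inner_eq_integral h1 h2, C.integral_conj_mul_potential hg hg, hA, hB, hn,
    ← integral_const_mul]
  have h5 : (-(1 / 2) * ((∫ p : E3 × E3, ‖g p.2 - g p.1‖ ^ 2 * yukawa lam ‖p.1 - p.2‖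
      ∂(C.arcLength.prod C.arcLength) : ℝ) : ℂ) +
      ((∫ x, ‖g x‖ ^ 2 * C.potentialOne lam x ∂C.arcLength : ℝ) : ℂ)).re =
      -(1 / 2) * (∫ p : E3 × E3, ‖g p.2 - g p.1‖ ^ 2 * yukawa lam ‖p.1 - p.2‖
      ∂(C.arcLength.prod C.arcLength)) + ∫ x, ‖g x‖ ^ 2 * C.potentialOne lam x ∂C.arcLength := by
    rw [← Complex.ofReal_re (-(1 / 2) * (∫ p : E3 × E3, ‖g p.2 - g p.1‖ ^ 2 *
      yukawa lam ‖p.1 - p.2‖ ∂(C.arcLength.prod C.arcLength)) +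
      ∫ x, ‖g x‖ ^ 2 * C.potentialOne lam x ∂C.arcLength)]
    congr 1
    push_cast
    ring
  rw [h5]
  have h6 : 0 ≤ ∫ p : E3 × E3, ‖g p.2 - g p.1‖ ^ 2 * yukawa lam ‖p.1 - p.2‖
      ∂(C.arcLength.prod C.arcLength) :=
    integral_nonneg fun p => mul_nonneg (by positivity) (yukawa_nonneg lam (norm_nonneg _))
  have h7 : ∫ x, ‖g x‖ ^ 2 * C.potentialOne lam x ∂C.arcLength ≤
      ∫ x, β * ‖g x‖ ^ 2 ∂C.arcLength := by
    refine integral_mono_ae hbi (hgi.const_mul β) ?_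
    filter_upwards [C.ae_mem_carrier] with x hx
    rw [mul_comm β]
    exact mul_le_mul_of_nonneg_left (hβ x hx) (by positivity)
  linarith

theorem exists_forall_potentialOne_le (lam : ℝ) :
    ∃ β, ∀ x ∈ C.carrier, C.potentialOne lam x ≤ β :=
  ⟨_, fun _ hx => (le_abs_self _).trans (C.abs_potentialOne_le lam hx)⟩

/-- With κ = √(-λ) and c the chord ratio, 1 - exp(-κcd) is at least 1 - e^{-c} where d ≥ 1/κ, and is
nonnegative elsewhere. The integral of 1/(4πd) over d ≥ 1/κ is (ln(L/2) + ln κ)/(2π); the hypothesis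
says 1/κ < L/2. -/
theorem potentialOne_le {lam : ℝ} (hlam : 2 / C.L < √(-lam)) {x : E3} (hx : x ∈ C.carrier) :
    C.potentialOne lam x ≤ (4 * Real.pi)⁻¹ * C.chordConst * C.arcLength.real univ +
      Real.log (C.L / 2) / (2 * Real.pi) - (1 - Real.exp (-C.chordRatio)) *
        ((Real.log (C.L / 2) + Real.log √(-lam)) / (2 * Real.pi)) := by
  obtain ⟨s, rfl⟩ := hx
  have hL := C.L_pos
  set κ := √(-lam) with hκ
  have hκ0 : 0 < κ := lt_trans (by positivity) hlam
  have hδL : κ⁻¹ < C.L / 2 := by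
    rw [inv_lt_comm₀ hκ0 (by positivity), inv_div]
    exact hlam
  have hc := C.chordRatio_pos
  have he : 0 ≤ 1 - Real.exp (-C.chordRatio) := by
    rw [sub_nonneg, Real.exp_le_one_iff]
    linarith
  set S : Set E3 := {y | κ⁻¹ ≤ C.arcDist (C.σ s) y} with hS
  have hSm : MeasurableSet S := C.measurableSet_le_arcDist _ _
  have hint : Integrable (S.indicator fun y => C.arcKernel (C.σ s) y) C.arcLength :=
    (C.integrable_arcKernel s (inv_pos.2 hκ0)).integrable_indicator hSm
  have h1 : ∫ y, C.regKernel lam (C.σ s) y ∂C.arcLength ≤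
      ∫ y, ((4 * Real.pi)⁻¹ * C.chordConst - (1 - Real.exp (-C.chordRatio)) *
        S.indicator (fun y => C.arcKernel (C.σ s) y) y) ∂C.arcLength := by
    refine integral_mono_ae (C.integrable_regKernel lam (mem_range_self s))
      ((integrable_const _).sub (hint.const_mul _)) ?_
    filter_upwards [C.ae_mem_carrier] with y hy
    refine (C.regKernel_le lam (mem_range_self s) hy).trans (sub_le_sub_left ?_ _)
    rw [← hκ]
    have ha := C.arcDist_nonneg (C.σ s) y
    have hp : 0 < (4 * Real.pi)⁻¹ := by positivity
    by_cases hyS : y ∈ S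
    · rw [indicator_of_mem hyS, arcKernel]
      have h2 : C.chordRatio ≤ κ * (C.chordRatio * C.arcDist (C.σ s) y) := by
        have h3 : 1 ≤ κ * C.arcDist (C.σ s) y := by
          have h4 : κ⁻¹ ≤ C.arcDist (C.σ s) y := hyS
          rwa [inv_le_iff_one_le_mul₀' hκ0] at h4
        nlinarith
      have h5 : Real.exp (-(κ * (C.chordRatio * C.arcDist (C.σ s) y))) ≤ Real.exp (-C.chordRatio) :=
        Real.exp_le_exp.2 (by linarith)
      have h6 : 0 ≤ (C.arcDist (C.σ s) y)⁻¹ := inv_nonneg.2 ha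
      calc (1 - Real.exp (-C.chordRatio)) * ((4 * Real.pi)⁻¹ * (C.arcDist (C.σ s) y)⁻¹)
          = (4 * Real.pi)⁻¹ * ((1 - Real.exp (-C.chordRatio)) * (C.arcDist (C.σ s) y)⁻¹) := by ring
        _ ≤ _ := by gcongr
    · rw [indicator_of_notMem hyS, mul_zero]
      have h7 : Real.exp (-(κ * (C.chordRatio * C.arcDist (C.σ s) y))) ≤ 1 := by
        rw [Real.exp_le_one_iff, neg_nonpos]
        positivity
      have h8 : 0 ≤ 1 - Real.exp (-(κ * (C.chordRatio * C.arcDist (C.σ s) y))) := by linarith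
      positivity
  rw [integral_sub (integrable_const _) (hint.const_mul _), integral_const, integral_const_mul,
    integral_indicator hSm, C.integral_arcKernel s (inv_pos.2 hκ0) hδL, Real.log_inv, smul_eq_mul,
    sub_neg_eq_add] at h1
  rw [potentialOne]
  linarith

/-- The boundary operators are bounded from above, with bounds tending to `-∞`. -/
theorem exists_lam_forall_potentialOne_le (a : ℝ) :
    ∃ lam < 0, ∃ β < a, ∀ x ∈ C.carrier, C.potentialOne lam x ≤ β := by
  have hL := C.L_pos
  have hc := C.chordRatio_pos
  set A := (4 * Real.pi)⁻¹ * C.chordConst * C.arcLength.real univ +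
      Real.log (C.L / 2) / (2 * Real.pi)
  set B := (1 - Real.exp (-C.chordRatio)) / (2 * Real.pi) with hB
  have hB0 : 0 < B := by
    have : Real.exp (-C.chordRatio) < 1 := by
      rw [Real.exp_lt_one_iff]
      linarith
    exact div_pos (by linarith) (by positivity)
  -- Here t = ln √(-λ): the first entry makes A - B(ln(L/2) + t) smaller than a, the second makes
  -- √(-λ) exceed 2/L.
  set t := max ((A - a) / B - Real.log (C.L / 2)) (Real.log (2 / C.L)) + 1 with ht
  have ht1 : (A - a) / B < Real.log (C.L / 2) + t := by
    have := le_max_left ((A - a) / B - Real.log (C.L / 2)) (Real.log (2 / C.L))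
    linarith
  have ht2 : Real.log (2 / C.L) < t := by
    have := le_max_right ((A - a) / B - Real.log (C.L / 2)) (Real.log (2 / C.L))
    linarith
  have hsq : √(-(-(Real.exp t ^ 2))) = Real.exp t := by
    rw [neg_neg, Real.sqrt_sq (Real.exp_pos t).le]
  refine ⟨-(Real.exp t ^ 2), by have := Real.exp_pos t; nlinarith,
    A - B * (Real.log (C.L / 2) + t), ?_, fun x hx => ?_⟩
  · rw [div_lt_iff₀ hB0] at ht1
    linarith
  · have h1 := C.potentialOne_le (lam := -(Real.exp t ^ 2)) ?_ hx
    · rw [hsq, Real.log_exp] at h1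
      refine h1.trans_eq ?_
      rw [hB]
      ring
    · rw [hsq, ← Real.log_lt_iff_lt_exp (by positivity)]
      exact ht2

/-! ### Integral operators with bounded kernels -/

theorem exists_integralOperator {q : E3 → E3 → ℝ} {M : ℝ}
    (hq : Measurable fun p : E3 × E3 => q p.1 p.2)
    (hM : ∀ x ∈ C.carrier, ∀ y ∈ C.carrier, |q x y| ≤ M) (hsymm : ∀ x y, q x y = q y x) :
    ∃ D : C.L2 →L[ℂ] C.L2, IsSelfAdjoint D ∧
      ∀ h : C.L2, D h =ᵐ[C.arcLength] fun x => ∫ y, (q x y : ℂ) * h y ∂C.arcLength := by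
  have hqm : Measurable fun p : E3 × E3 => (q p.1 p.2 : ℂ) := Complex.measurable_ofReal.comp hq
  have hint : ∀ h : C.L2, Integrable h C.arcLength := fun h =>
    (Lp.memLp h).integrable one_le_two
  have hqx : ∀ h : C.L2, ∀ x ∈ C.carrier,
      Integrable (fun y => (q x y : ℂ) * h y) C.arcLength := fun h x hx => by
    refine (hint h).bdd_mul (c := M) (hqm.comp measurable_prodMk_left).aestronglyMeasurable ?_
    filter_upwards [C.ae_mem_carrier] with y hy
    rw [Complex.norm_real]
    exact hM x hx y hy
  have hmem : ∀ h : C.L2,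
      MemLp (fun x => ∫ y, (q x y : ℂ) * h y ∂C.arcLength) 2 C.arcLength := fun h => by
    have hm : AEStronglyMeasurable (fun p : E3 × E3 => (q p.1 p.2 : ℂ) * h p.2)
        (C.arcLength.prod C.arcLength) :=
      hqm.aestronglyMeasurable.mul (hint h).1.comp_snd
    refine MemLp.of_bound hm.integral_prod_right' (∫ y, M * ‖h y‖ ∂C.arcLength) ?_
    filter_upwards [C.ae_mem_carrier] with x hx
    refine norm_integral_le_of_norm_le ((hint h).norm.const_mul M) ?_
    filter_upwards [C.ae_mem_carrier] with y hy
    rw [norm_mul, Complex.norm_real]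
    exact mul_le_mul_of_nonneg_right (hM x hx y hy) (norm_nonneg _)
  set T : C.L2 →ₗ[ℂ] C.L2 :=
    { toFun := fun h => (hmem h).toLp _
      map_add' := fun h k => by
        rw [← MemLp.toLp_add]
        refine MemLp.toLp_congr _ _ ?_
        filter_upwards [C.ae_mem_carrier] with x hx
        rw [Pi.add_apply, ← integral_add (hqx h x hx) (hqx k x hx)]
        refine integral_congr_ae ?_
        filter_upwards [Lp.coeFn_add h k] with y hy
        rw [hy, Pi.add_apply, mul_add]
      map_smul' := fun c h => by
        rw [RingHom.id_apply, ← MemLp.toLp_const_smul]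
        refine MemLp.toLp_congr _ _ (ae_of_all _ fun x => ?_)
        rw [Pi.smul_apply, smul_eq_mul, ← integral_const_mul]
        refine integral_congr_ae ?_
        filter_upwards [Lp.coeFn_smul c h] with y hy
        rw [hy, Pi.smul_apply, smul_eq_mul]
        ring } with hT
  have hTval : ∀ h, T h =ᵐ[C.arcLength] fun x => ∫ y, (q x y : ℂ) * h y ∂C.arcLength :=
    fun h => (hmem h).coeFn_toLp
  have hTs : T.IsSymmetric := by
    intro h k
    rw [← inner_conj_symm, C.inner_eq_integral (EventuallyEq.refl _ _) (hTval h),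
      C.inner_eq_integral (EventuallyEq.refl _ _) (hTval k), ← integral_conj]
    have hprod : Integrable (fun p : E3 × E3 => (q p.1 p.2 : ℂ) * (conj (h p.1) * k p.2))
        (C.arcLength.prod C.arcLength) := by
      have h1 : Integrable (fun x => conj (h x)) C.arcLength :=
        Complex.conjLIE.toContinuousLinearEquiv.toContinuousLinearMap.integrable_comp (hint h)
      refine (h1.mul_prod (hint k)).bdd_mul (c := M) hqm.aestronglyMeasurable ?_
      filter_upwards [C.ae_mem_carrier_prod] with p hp
      rw [Complex.norm_real]
      exact hM _ hp.1 _ hp.2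
    have e1 : ∀ x, conj (h x) * ∫ y, (q x y : ℂ) * k y ∂C.arcLength =
        ∫ y, (q x y : ℂ) * (conj (h x) * k y) ∂C.arcLength := fun x => by
      rw [← integral_const_mul]
      refine integral_congr_ae (ae_of_all _ fun y => ?_)
      dsimp only
      ring
    have e2 : ∀ y, conj (conj (k y) * ∫ x, (q y x : ℂ) * h x ∂C.arcLength) =
        ∫ x, (q x y : ℂ) * (conj (h x) * k y) ∂C.arcLength := fun y => by
      rw [map_mul, Complex.conj_conj, ← integral_conj, ← integral_const_mul]
      refine integral_congr_ae (ae_of_all _ fun x => ?_)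
      simp only [map_mul, Complex.conj_ofReal, hsymm y x]
      ring
    simp only [e1, e2]
    exact (integral_integral_swap hprod).symm
  -- Boundedness comes from the Hellinger–Toeplitz theorem, since T is symmetric and everywhere
  -- defined.
  refine ⟨(hTs.toSelfAdjoint : C.L2 →L[ℂ] C.L2), hTs.toSelfAdjoint.2, fun h => ?_⟩
  exact hTval h

/-- The regular part of the boundary operator. -/
theorem exists_regOperator (lam : ℝ) : ∃ D : C.L2 →L[ℂ] C.L2, IsSelfAdjoint D ∧
    ∀ h : C.L2, D h =ᵐ[C.arcLength] fun x => ∫ y, (C.regKernel lam x y : ℂ) * h y ∂C.arcLength :=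
  C.exists_integralOperator (C.measurable_regKernel lam)
    (fun _ hx _ hy => C.abs_regKernel_le lam hx hy) (C.regKernel_comm lam)

/-! ### Change of the spectral parameter -/

/-- The arc kernel and the logarithmic terms do not depend on the parameter, so they cancel in the
difference. What is left is the difference of two Yukawa kernels, which is the kernel of (λ -
μ)γ_λ*γ_μ. -/
theorem traceOp_graph_add {lam mu : ℝ} (hlam : lam < 0) (hmu : mu < 0) {h k : C.L2}
    (hk : (h, k) ∈ (C.traceOp mu).graph) :
    (h, k + ((lam - mu : ℝ) : ℂ) • (C.gammaField lam).adjoint (C.gammaField mu h)) ∈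
      (C.traceOp lam).graph := by
  obtain ⟨K, g, hg, h1, h2⟩ := (C.mem_graph_traceOp_iff mu).1 hk
  refine (C.mem_graph_traceOp_iff lam).2 ⟨K, g, hg, h1, ?_⟩
  filter_upwards [h2, C.coeFn_adjoint_gammaField_gammaField hlam hmu h, C.ae_mem_carrier,
    Lp.coeFn_add k (((lam - mu : ℝ) : ℂ) • (C.gammaField lam).adjoint (C.gammaField mu h))]
    with x e1 e2 hx e3
  rw [e3, Pi.add_apply, e1, e2, potential, potential]
  have hi : ∀ lam, Integrable (C.potentialIntegrand lam g x) C.arcLength := fun lam => by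
    obtain ⟨M, hM⟩ := C.exists_bound_potentialIntegrand hg lam
    exact C.integrable_of_bound ((C.measurable_potentialIntegrand hg.continuous lam).comp
      measurable_prodMk_left) (hM x hx)
  have h3 : ∫ y, (kern lam x y - kern mu x y) * h y ∂C.arcLength =
      (∫ y, C.potentialIntegrand lam g x y ∂C.arcLength) -
        ∫ y, C.potentialIntegrand mu g x y ∂C.arcLength := by
    rw [← integral_sub (hi lam) (hi mu)]
    refine integral_congr_ae ?_
    filter_upwards [h1] with y hy
    rw [hy, potentialIntegrand, potentialIntegrand, regKernel, regKernel, kern_eq, kern_eq]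
    push_cast
    ring
  rw [h3]
  ring

end ClosedCurve

end

noncomputable section

open UnboundedOp
open scoped ComplexConjugate

/-! ### Essential selfadjointness of bounded perturbations of diagonal operators -/

/-- Testing a pair (x, y) of the adjoint on the basis gives the coefficients of y - Dx as μ i times
those of x; the μ i are real by symmetry and may be unbounded. Hence A maps the partial sums of x to
vectors converging to y, and the adjoint lies in the closure. -/
theorem UnboundedOp.isSelfAdjoint_closure_of_hilbertBasis {H : Type*} [NormedAddCommGroup H]
    [InnerProductSpace ℂ H] [CompleteSpace H] {ι : Type*} {A : H →ₗ.[ℂ] H} (b : HilbertBasis ι ℂ H)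
    {D : H →L[ℂ] H} (hD : IsSelfAdjoint D) {μ : ι → ℂ}
    (hb : ∀ i, (b i, μ i • b i + D (b i)) ∈ A.graph)
    (hsymm : ∀ h k h' k' : H, (h, k) ∈ A.graph → (h', k') ∈ A.graph →
      inner ℂ k h' = inner ℂ h k') :
    A.graph.topologicalClosure = A.closure.graph ∧ IsSelfAdjoint A.closure := by
  have hDs : ∀ x y : H, inner ℂ (D x) y = inner ℂ x (D y) :=
    ContinuousLinearMap.isSelfAdjoint_iff_isSymmetric.1 hD
  have hdom : Submodule.span ℂ (range b) ≤ A.domain := by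
    rw [Submodule.span_le]
    rintro _ ⟨i, rfl⟩
    exact LinearPMap.mem_domain_of_mem_graph (hb i)
  have hdense : Dense (A.domain : Set H) := by
    have h1 : Dense (Submodule.span ℂ (range b) : Set H) := by
      rw [dense_iff_closure_eq, ← Submodule.topologicalClosure_coe, b.dense_span]
      rfl
    exact h1.mono hdom
  refine isSelfAdjoint_closure hdense hsymm fun x y hxy => ?_
  have hreal : ∀ i, conj (μ i) = μ i := fun i => by
    have h1 := hsymm _ _ _ _ (hb i) (hb i)
    have h2 : inner ℂ (b i) (b i) = (1 : ℂ) := by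
      rw [inner_self_eq_norm_sq_to_K, b.orthonormal.1 i]
      simp
    rw [inner_add_left, inner_add_right, inner_smul_left, inner_smul_right, h2, hDs, mul_one,
      mul_one] at h1
    exact add_right_cancel h1
  have hcoef : ∀ i, inner ℂ (b i) (y - D x) = μ i * inner ℂ (b i) x := fun i => by
    have h1 := hxy _ _ (hb i)
    rw [inner_add_left, inner_smul_left, hreal, hDs] at h1
    rw [inner_sub_right, ← h1, add_sub_cancel_right]
  have hx := b.hasSum_repr x
  have hy := b.hasSum_repr (y - D x)
  have hlim : Tendsto (fun s : Finset ι => ((∑ i ∈ s, b.repr x i • b i,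
      (∑ i ∈ s, b.repr (y - D x) i • b i) + D (∑ i ∈ s, b.repr x i • b i)) : H × H)) atTop
      (𝓝 (x, y)) := by
    rw [HasSum, SummationFilter.unconditional_filter] at hx hy
    have h1 := Filter.Tendsto.add hy ((D.continuous.tendsto x).comp hx)
    rw [sub_add_cancel] at h1
    exact hx.prodMk_nhds h1
  refine mem_closure_of_tendsto hlim (Eventually.of_forall fun s => ?_)
  have h2 : ((∑ i ∈ s, b.repr x i • b i,
      (∑ i ∈ s, b.repr (y - D x) i • b i) + D (∑ i ∈ s, b.repr x i • b i)) : H × H) =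
      ∑ i ∈ s, b.repr x i • (b i, μ i • b i + D (b i)) := by
    have h3 : ∀ i, b.repr (y - D x) i • b i = b.repr x i • μ i • b i := fun i => by
      rw [b.repr_apply_apply, b.repr_apply_apply, hcoef, smul_smul, mul_comm]
    ext
    · simp [Prod.fst_sum]
    · simp only [Prod.snd_sum, Prod.smul_snd, smul_add, Finset.sum_add_distrib, map_sum, map_smul,
        h3]
  rw [h2]
  exact Submodule.sum_mem _ fun i _ => Submodule.smul_mem _ _ (hb i)

namespace ClosedCurve

variable (C : ClosedCurve)

/-! ### Fourier series on the curve -/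

/-- The characters of the curve. -/
def character (n : ℤ) (s : ℝ) : ℂ := Complex.exp (2 * Real.pi * Complex.I * n * s / C.L)

theorem character_add (n : ℤ) (s t : ℝ) :
    C.character n (s + t) = C.character n s * C.character n t := by
  rw [character, character, character, ← Complex.exp_add]
  congr 1
  push_cast
  ring

theorem character_eq (n : ℤ) (s : ℝ) :
    C.character n s = Complex.exp (((2 * Real.pi * n / C.L * s : ℝ) : ℂ) * Complex.I) := by
  rw [character]
  congr 1
  push_cast
  ring

theorem norm_character (n : ℤ) (s : ℝ) : ‖C.character n s‖ = 1 := by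
  rw [character_eq, Complex.norm_exp_ofReal_mul_I]

theorem conj_character (n : ℤ) (s : ℝ) : conj (C.character n s) = C.character (-n) s := by
  rw [character_eq, character_eq, ← Complex.exp_conj, map_mul, Complex.conj_ofReal, Complex.conj_I]
  congr 1
  push_cast
  ring

theorem character_mul (m n : ℤ) (s : ℝ) :
    C.character m s * C.character n s = C.character (m + n) s := by
  rw [character, character, character, ← Complex.exp_add]
  congr 1
  push_cast
  ring

theorem norm_character_sub_one_le (n : ℤ) (t : ℝ) :
    ‖C.character n t - 1‖ ≤ |2 * Real.pi * n / C.L| * |t| := by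
  rw [character_eq, mul_comm, ← abs_mul]
  exact Real.norm_exp_I_mul_ofReal_sub_one_le

theorem character_zsmul (n k : ℤ) : C.character n (k • C.L) = 1 := by
  have hL : (C.L : ℂ) ≠ 0 := by exact_mod_cast C.L_pos.ne'
  rw [character, Complex.exp_eq_one_iff]
  refine ⟨n * k, ?_⟩
  rw [zsmul_eq_mul]
  push_cast
  field_simp

theorem character_congr (n : ℤ) {a b : ℝ} (hab : C.σ a = C.σ b) :
    C.character n a = C.character n b := by
  rw [σ_eq_iff, QuotientAddGroup.eq, AddSubgroup.mem_zmultiples_iff] at hab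
  obtain ⟨k, hk⟩ := hab
  have : b = a + k • C.L := by linarith
  rw [this, character_add, character_zsmul, mul_one]

theorem exists_lipschitz_character (n : ℤ) :
    ∃ K, ∃ g : E3 → ℂ, LipschitzWith K g ∧ ∀ s, g (C.σ s) = C.character n s := by
  have hval : ∀ s, C.character n (C.param (C.σ s)) = C.character n s := fun s =>
    C.character_congr n (C.σ_param s)
  have hlip : C.IsLipschitz fun y => C.character n (C.param y) := by
    have hc := C.chordRatio_pos
    refine ⟨Real.toNNReal (|2 * Real.pi * n / C.L| * C.chordRatio⁻¹),
      LipschitzOnWith.of_dist_le_mul ?_⟩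
    rintro _ ⟨s, rfl⟩ y hy
    obtain ⟨t, ht, rfl⟩ := C.exists_eq_σ_add s hy
    rw [Real.coe_toNNReal _ (by positivity), hval, hval, character_add, dist_eq_norm]
    have h1 : C.character n s - C.character n s * C.character n t =
        -(C.character n s * (C.character n t - 1)) := by ring
    rw [h1, norm_neg, norm_mul, norm_character, one_mul, mul_assoc]
    refine (C.norm_character_sub_one_le n t).trans (mul_le_mul_of_nonneg_left ?_ (abs_nonneg _))
    have h2 := C.chordRatio_mul_le (mem_range_self s) hy
    rw [C.arcDist_σ_add ht] at h2
    rw [dist_eq_norm, ← div_eq_inv_mul, le_div_iff₀ hc, mul_comm]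
    exact h2
  obtain ⟨K, g, hg, hfg⟩ := hlip.exists_extend
  exact ⟨K, g, hg, fun s => (hfg (mem_range_self s)).symm.trans (hval s)⟩

/-- A Lipschitz extension of a character to the whole space. -/
def characterExt (n : ℤ) : E3 → ℂ := (C.exists_lipschitz_character n).choose_spec.choose

theorem lipschitz_characterExt (n : ℤ) : ∃ K, LipschitzWith K (C.characterExt n) :=
  ⟨_, (C.exists_lipschitz_character n).choose_spec.choose_spec.1⟩

theorem continuous_characterExt (n : ℤ) : Continuous (C.characterExt n) :=
  (C.lipschitz_characterExt n).choose_spec.continuous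

theorem characterExt_σ (n : ℤ) (s : ℝ) : C.characterExt n (C.σ s) = C.character n s :=
  (C.exists_lipschitz_character n).choose_spec.choose_spec.2 s

theorem memLp_characterExt (n : ℤ) : MemLp (C.characterExt n) 2 C.arcLength := by
  refine MemLp.of_bound (C.continuous_characterExt n).aestronglyMeasurable 1 ?_
  filter_upwards [C.ae_mem_carrier] with y hy
  obtain ⟨s, rfl⟩ := hy
  rw [characterExt_σ, norm_character]

/-- The characters as elements of `L²(Σ)`. -/
def characterLp (n : ℤ) : C.L2 := (C.memLp_characterExt n).toLp _

theorem coeFn_characterLp (n : ℤ) : C.characterLp n =ᵐ[C.arcLength] C.characterExt n :=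
  (C.memLp_characterExt n).coeFn_toLp

/-- The singular part is a convolution on the circle, so characters are its eigenfunctions: g(σ(s +
t)) - g(σ(s)) factors as g(σ(s)) times a function of t. The eigenvalue c absorbs the constant
ln(L/2)/(2π). -/
theorem potential_characterExt (lam : ℝ) (n : ℤ) : ∃ c : ℂ, ∀ x ∈ C.carrier,
    C.potential lam (C.characterExt n) x = c * C.characterExt n x +
      ∫ y, (C.regKernel lam x y : ℂ) * C.characterExt n y ∂C.arcLength := by
  obtain ⟨K, hg⟩ := C.lipschitz_characterExt n
  set g := C.characterExt n with hgdef
  refine ⟨(∫ t in Ioc (-(C.L / 2)) (C.L / 2), (C.character n t - 1) *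
    (((4 * Real.pi)⁻¹ * |t|⁻¹ : ℝ) : ℂ)) + ((Real.log (C.L / 2) / (2 * Real.pi) : ℝ) : ℂ), ?_⟩
  rintro _ ⟨s, rfl⟩
  have hx : C.σ s ∈ C.carrier := mem_range_self s
  set x := C.σ s with hxdef
  obtain ⟨M, hM⟩ := C.exists_bound_potentialIntegrand hg lam
  obtain ⟨M', hM0', hM'⟩ := C.exists_bound_of_continuous hg.continuous
  have hi1 : Integrable (C.potentialIntegrand lam g x) C.arcLength :=
    C.integrable_of_bound ((C.measurable_potentialIntegrand hg.continuous lam).comp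
      measurable_prodMk_left) (hM x hx)
  have hi2 : Integrable (fun y => (C.regKernel lam x y : ℂ) * g y) C.arcLength := by
    refine C.integrable_of_bound (M := C.regBound lam * M') ((Complex.measurable_ofReal.comp
      ((C.measurable_regKernel lam).comp measurable_prodMk_left)).mul hg.continuous.measurable)
      fun y hy => ?_
    rw [norm_mul, Complex.norm_real]
    exact mul_le_mul (C.abs_regKernel_le lam hx hy) (hM' y hy) (norm_nonneg _)
      (C.regBound_nonneg lam)
  have h1 : ∀ y, C.potentialIntegrand lam g x y - (C.regKernel lam x y : ℂ) * g y =
      (g y - g x) * (C.arcKernel x y : ℂ) := fun y => by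
    rw [potentialIntegrand, regKernel, kern_eq]
    push_cast
    ring
  have h2 : ∫ y, (g y - g x) * (C.arcKernel x y : ℂ) ∂C.arcLength =
      g x * ∫ t in Ioc (-(C.L / 2)) (C.L / 2), (C.character n t - 1) *
        (((4 * Real.pi)⁻¹ * |t|⁻¹ : ℝ) : ℂ) := by
    have hm : Measurable fun y => (g y - g x) * (C.arcKernel x y : ℂ) :=
      (hg.continuous.measurable.sub_const _).mul (Complex.measurable_ofReal.comp
        ((C.measurable_arcDist_right x).inv.const_mul _))
    rw [C.integral_eq s hm.aestronglyMeasurable, ← integral_const_mul]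
    refine setIntegral_congr_fun measurableSet_Ioc fun t ht => ?_
    rw [hgdef, hxdef, arcKernel, C.arcDist_σ_add (abs_le.2 ⟨ht.1.le, ht.2⟩), characterExt_σ,
      characterExt_σ, character_add]
    ring
  have h3 : ∫ y, C.potentialIntegrand lam g x y ∂C.arcLength =
      (∫ y, (g y - g x) * (C.arcKernel x y : ℂ) ∂C.arcLength) +
        ∫ y, (C.regKernel lam x y : ℂ) * g y ∂C.arcLength := by
    simp only [← h1]
    rw [integral_sub hi1 hi2, sub_add_cancel]
  rw [potential, h3, h2]
  ring

theorem integral_character (n : ℤ) :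
    ∫ t in Ioc (-(C.L / 2)) (C.L / 2), C.character n t = if n = 0 then (C.L : ℂ) else 0 := by
  have hL := C.L_pos
  have hLc : (C.L : ℂ) ≠ 0 := by exact_mod_cast hL.ne'
  rw [← intervalIntegral.integral_of_le (by linarith)]
  split_ifs with hn
  · simp [character, hn]
  · have hc : 2 * Real.pi * Complex.I * n / C.L ≠ 0 := by
      have h1 : (n : ℂ) ≠ 0 := by exact_mod_cast hn
      have h2 : (Real.pi : ℂ) ≠ 0 := by exact_mod_cast Real.pi_ne_zero
      simp [h1, h2, hLc, Complex.I_ne_zero]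
    have h1 : ∀ t : ℝ, C.character n t = Complex.exp (2 * Real.pi * Complex.I * n / C.L * t) :=
      fun t => by
        rw [character]
        congr 1
        ring
    have h2 : C.character n (C.L / 2) = C.character n (-(C.L / 2)) := by
      have h3 : C.L / 2 = -(C.L / 2) + (1 : ℤ) • C.L := by
        rw [one_smul]
        ring
      conv_lhs => rw [h3]
      rw [character_add, character_zsmul, mul_one]
    simp only [h1]
    rw [integral_exp_mul_complex hc, ← h1, ← h1, h2, sub_self, zero_div]

theorem inner_characterLp (n : ℤ) (x : C.L2) :
    inner ℂ (C.characterLp n) x =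
      ∫ t in Ioc (-(C.L / 2)) (C.L / 2), C.character (-n) t * x (C.σ t) := by
  rw [C.inner_eq_integral (C.coeFn_characterLp n) (EventuallyEq.refl _ x)]
  have hm : AEStronglyMeasurable (fun y => conj (C.characterExt n y) * x y) C.arcLength :=
    (Complex.continuous_conj.comp (C.continuous_characterExt n)).aestronglyMeasurable.mul
      (Lp.aestronglyMeasurable x)
  rw [C.integral_eq 0 hm]
  refine setIntegral_congr_fun measurableSet_Ioc fun t ht => ?_
  rw [zero_add, characterExt_σ, conj_character]

theorem inner_characterLp_characterLp (m n : ℤ) :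
    inner ℂ (C.characterLp m) (C.characterLp n) = if m = n then (C.L : ℂ) else 0 := by
  rw [C.inner_eq_integral (C.coeFn_characterLp m) (C.coeFn_characterLp n)]
  have hm : AEStronglyMeasurable (fun y => conj (C.characterExt m y) * C.characterExt n y)
      C.arcLength :=
    ((Complex.continuous_conj.comp (C.continuous_characterExt m)).mul
      (C.continuous_characterExt n)).aestronglyMeasurable
  rw [C.integral_eq 0 hm]
  have h1 : ∫ t in Ioc (-(C.L / 2)) (C.L / 2),
      conj (C.characterExt m (C.σ (0 + t))) * C.characterExt n (C.σ (0 + t)) =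
      ∫ t in Ioc (-(C.L / 2)) (C.L / 2), C.character (-m + n) t := by
    refine setIntegral_congr_fun measurableSet_Ioc fun t ht => ?_
    rw [zero_add, characterExt_σ, characterExt_σ, conj_character, character_mul]
  rw [h1, integral_character]
  by_cases h : m = n
  · simp [h]
  · rw [if_neg h, if_neg]
    omega

theorem memLp_comp_σ {F : E3 → ℂ} (hF : MemLp F 2 C.arcLength) :
    MemLp (fun t => F (C.σ t)) 2 (volume.restrict (Ioc (-(C.L / 2)) (C.L / 2))) := by
  rw [C.arcLength_eq_map 0] at hF
  simp only [zero_add] at hF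
  exact hF.comp_of_map C.continuous_σ.aemeasurable

/-- The characters are total in `L²(Σ)`. -/
theorem eq_zero_of_inner_characterLp {x : C.L2} (hx : ∀ n, inner ℂ (C.characterLp n) x = 0) :
    x = 0 := by
  have hL := C.L_pos
  have hab : -(C.L / 2) < C.L / 2 := by linarith
  have hmem := C.memLp_comp_σ (Lp.memLp x)
  -- Parseval on an interval of length L: once all coefficients vanish, so does the L² norm.
  have h1 := hasSum_sq_fourierCoeffOn hab hmem
  have h2 : ∀ n, fourierCoeffOn hab (fun t => x (C.σ t)) n = 0 := fun n => by
    rw [fourierCoeffOn_eq_integral, intervalIntegral.integral_of_le hab.le]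
    have h3 := hx n
    rw [inner_characterLp] at h3
    have h4 : ∀ t : ℝ, (fourier (-n) (t : AddCircle (C.L / 2 - -(C.L / 2))) : ℂ) =
        C.character (-n) t := fun t => by
      rw [fourier_coe_apply, character]
      congr 2
      push_cast
      ring
    simp only [h4, smul_eq_mul]
    rw [h3, smul_zero]
  simp only [h2, norm_zero, ne_eq, OfNat.ofNat_ne_zero, not_false_eq_true, zero_pow] at h1
  have h5 : (C.L / 2 - -(C.L / 2))⁻¹ • ∫ t in (-(C.L / 2))..(C.L / 2), ‖x (C.σ t)‖ ^ 2 = 0 :=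
    h1.unique hasSum_zero
  have h6 : ∫ t in (-(C.L / 2))..(C.L / 2), ‖x (C.σ t)‖ ^ 2 = 0 := by
    rcases smul_eq_zero.1 h5 with h | h
    · rw [inv_eq_zero] at h
      linarith
    · exact h
  rw [intervalIntegral.integral_of_le hab.le] at h6
  rw [← inner_self_eq_zero (𝕜 := ℂ), C.inner_eq_integral (EventuallyEq.refl _ x)
    (EventuallyEq.refl _ x), C.integral_eq 0]
  · have h7 : ∫ t in Ioc (-(C.L / 2)) (C.L / 2), conj (x (C.σ (0 + t))) * x (C.σ (0 + t)) =
        ((∫ t in Ioc (-(C.L / 2)) (C.L / 2), ‖x (C.σ t)‖ ^ 2 : ℝ) : ℂ) := by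
      rw [← integral_complex_ofReal]
      refine setIntegral_congr_fun measurableSet_Ioc fun t _ => ?_
      rw [zero_add, Complex.conj_mul']
      push_cast
      rfl
    rw [h7, h6, Complex.ofReal_zero]
  · exact (Complex.continuous_conj.comp_aestronglyMeasurable (Lp.aestronglyMeasurable x)).mul
      (Lp.aestronglyMeasurable x)

/-- The orthonormal basis of normalized characters. -/
theorem exists_hilbertBasis : ∃ b : HilbertBasis ℤ ℂ C.L2,
    ∀ n, b n = (((√C.L)⁻¹ : ℝ) : ℂ) • C.characterLp n := by
  have hL := C.L_pos
  have hs : 0 < √C.L := Real.sqrt_pos.2 hL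
  have hne : (((√C.L)⁻¹ : ℝ) : ℂ) ≠ 0 := by
    exact_mod_cast (inv_pos.2 hs).ne'
  have hon : Orthonormal ℂ fun n => (((√C.L)⁻¹ : ℝ) : ℂ) • C.characterLp n := by
    rw [orthonormal_iff_ite]
    intro m n
    rw [inner_smul_left, inner_smul_right, Complex.conj_ofReal, inner_characterLp_characterLp]
    split_ifs with h
    · rw [← mul_assoc, ← Complex.ofReal_mul, ← Complex.ofReal_mul, ← mul_inv,
        Real.mul_self_sqrt hL.le, inv_mul_cancel₀ hL.ne', Complex.ofReal_one]
    · simp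
  refine ⟨HilbertBasis.mkOfOrthogonalEqBot hon ?_, fun n => by
    rw [HilbertBasis.coe_mkOfOrthogonalEqBot]⟩
  rw [Submodule.eq_bot_iff]
  intro x hx
  refine C.eq_zero_of_inner_characterLp fun n => ?_
  have h1 := (Submodule.mem_orthogonal _ _).1 hx _ (Submodule.subset_span (mem_range_self n))
  rw [inner_smul_left, mul_eq_zero, Complex.conj_ofReal] at h1
  exact h1.resolve_left hne

/-! ### Selfadjointness of the closure of the boundary operator -/

theorem exists_mem_graph_characterLp (lam : ℝ) {D : C.L2 →L[ℂ] C.L2}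
    (hD : ∀ h : C.L2, D h =ᵐ[C.arcLength]
      fun x => ∫ y, (C.regKernel lam x y : ℂ) * h y ∂C.arcLength) (n : ℤ) :
    ∃ c : ℂ, (C.characterLp n, c • C.characterLp n + D (C.characterLp n)) ∈
      (C.traceOp lam).graph := by
  obtain ⟨c, hc⟩ := C.potential_characterExt lam n
  obtain ⟨K, hg⟩ := C.lipschitz_characterExt n
  refine ⟨c, (C.mem_graph_traceOp_iff lam).2 ⟨K, _, hg, C.coeFn_characterLp n, ?_⟩⟩
  filter_upwards [Lp.coeFn_add (c • C.characterLp n) (D (C.characterLp n)),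
    Lp.coeFn_smul c (C.characterLp n), C.coeFn_characterLp n, hD (C.characterLp n),
    C.ae_mem_carrier] with x h1 h2 h3 h4 hx
  rw [h1, Pi.add_apply, h2, Pi.smul_apply, h3, h4, hc x hx, smul_eq_mul]
  congr 1
  refine integral_congr_ae ?_
  filter_upwards [C.coeFn_characterLp n] with y hy
  rw [hy]

/-- On characters B_λ is diagonal plus the bounded selfadjoint operator of the regular kernel.
Symmetry on all Lipschitz functions completes the criterion for essential selfadjointness. -/
theorem traceOpClosure_graph_and_isSelfAdjoint (lam : ℝ) :
    (C.traceOp lam).graph.topologicalClosure = (C.traceOpClosure lam).graph ∧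
      IsSelfAdjoint (C.traceOpClosure lam) := by
  obtain ⟨D, hDs, hD⟩ := C.exists_regOperator lam
  obtain ⟨b, hb⟩ := C.exists_hilbertBasis
  choose μ hμ using C.exists_mem_graph_characterLp lam hD
  refine isSelfAdjoint_closure_of_hilbertBasis (μ := μ) b hDs (fun n => ?_)
    fun h k h' k' hk hk' => C.inner_traceOp_symm lam hk hk'
  have h1 := (C.traceOp lam).graph.smul_mem (((√C.L)⁻¹ : ℝ) : ℂ) (hμ n)
  rw [Prod.smul_mk, smul_add, smul_comm, ← map_smul, ← hb] at h1
  exact h1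

theorem isSelfAdjoint_traceOpClosure (lam : ℝ) : IsSelfAdjoint (C.traceOpClosure lam) :=
  (C.traceOpClosure_graph_and_isSelfAdjoint lam).2

theorem traceOpClosure_graph (lam : ℝ) :
    (C.traceOpClosure lam).graph = (C.traceOp lam).graph.topologicalClosure :=
  (C.traceOpClosure_graph_and_isSelfAdjoint lam).1.symm

theorem re_inner_traceOpClosure_le {lam β : ℝ} (hβ : ∀ x ∈ C.carrier, C.potentialOne lam x ≤ β)
    (h k : C.L2) (hk : (h, k) ∈ (C.traceOpClosure lam).graph) :
    (inner ℂ h k).re ≤ β * ‖h‖ ^ 2 := by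
  rw [traceOpClosure_graph] at hk
  have hcl : IsClosed {p : C.L2 × C.L2 | (inner ℂ p.1 p.2).re ≤ β * ‖p.1‖ ^ 2} :=
    isClosed_le (Complex.continuous_re.comp (continuous_fst.inner continuous_snd)) (by fun_prop)
  exact closure_minimal (fun p hp => C.re_inner_traceOp_le hβ (h := p.1) (k := p.2) hp) hcl hk

theorem traceOpClosure_graph_add {lam mu : ℝ} (hlam : lam < 0) (hmu : mu < 0) {h k : C.L2}
    (hk : (h, k) ∈ (C.traceOpClosure mu).graph) :
    (h, k + ((lam - mu : ℝ) : ℂ) • (C.gammaField lam).adjoint (C.gammaField mu h)) ∈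
      (C.traceOpClosure lam).graph := by
  rw [traceOpClosure_graph] at hk ⊢
  have hcont : Continuous fun p : C.L2 × C.L2 => (p.1, p.2 + ((lam - mu : ℝ) : ℂ) •
      (C.gammaField lam).adjoint (C.gammaField mu p.1)) := by fun_prop
  exact map_mem_closure (f := fun p : C.L2 × C.L2 => (p.1, p.2 + ((lam - mu : ℝ) : ℂ) •
      (C.gammaField lam).adjoint (C.gammaField mu p.1))) hcont hk
    fun p hp => C.traceOp_graph_add hlam hmu (h := p.1) (k := p.2) hp

end ClosedCurve

end

noncomputable section
open UnboundedOp

namespace UnboundedOp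

theorem kernel_scalarSub_eq {H : Type*} [NormedAddCommGroup H] [InnerProductSpace ℂ H]
    (B : H →ₗ.[ℂ] H) (z : ℂ) : kernel (scalarSub z B) = kernel (subScalar B z) := by
  ext h
  rw [mem_kernel, mem_kernel, mem_graph_scalarSub, mem_graph_subScalar, sub_zero, zero_add]

end UnboundedOp

namespace ClosedCurve

variable (C : ClosedCurve)

/-! ### The operator with `δ`-interaction -/

/-- Single-valuedness: u = 0 makes f a distribution carried by Σ, whatever the trace t is, and such
an f in L² vanishes. -/
theorem mem_graph_deltaOp {lam α : ℝ} {u f : L2E3} :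
    (u, f) ∈ (C.deltaOp lam α).graph ↔ C.IsDeltaAction lam α u f := by
  have hg : (C.deltaOp lam α).graph = C.deltaGraph lam α := by
    apply Submodule.toLinearPMap_graph_eq
    rintro ⟨u, f⟩ ⟨t, -, hf⟩ (rfl : u = 0)
    refine (C.eq_zero_of_coe_eq_deltaDist (h := -(((1 / α : ℝ) : ℂ) • t)) ?_).1
    simp only [deltaDist, ← Lp.toTemperedDistributionCLM_apply, ← laplacianCLM_apply] at hf ⊢
    rw [hf, map_zero, map_zero, neg_zero, zero_sub, map_neg, map_smul]
  rw [hg]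
  rfl

/-- The same density h serves both parameters. The corrections from B_λ - B_μ, from γ_λ - γ_μ = (λ -
μ)(-Δ - λ)⁻¹γ_μ and from the free resolvent identity cancel. -/
theorem IsDeltaAction.change_parameter {C : ClosedCurve} {lam mu α : ℝ} (hlam : lam < 0)
    (hmu : mu < 0) (hα : α ≠ 0) {u f : L2E3} (h : C.IsDeltaAction mu α u f) :
    C.IsDeltaAction lam α u f := by
  rw [C.isDeltaAction_iff hmu hα] at h
  rw [C.isDeltaAction_iff hlam hα]
  obtain ⟨h, hh, hu⟩ := h
  rw [mem_graph_scalarSub] at hh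
  set g := f - (mu : ℂ) • u with hg
  have hf : f - (lam : ℂ) • u = g - ((lam - mu : ℝ) : ℂ) • u := by
    rw [hg]
    push_cast
    module
  refine ⟨h, ?_, ?_⟩
  · rw [mem_graph_scalarSub]
    have h1 := C.traceOpClosure_graph_add hlam hmu hh
    have h2 : (C.gammaField mu).adjoint g = (C.gammaField lam).adjoint g -
        ((lam - mu : ℝ) : ℂ) • (C.gammaField lam).adjoint (freeResolvent mu g) := by
      rw [C.adjoint_gammaField_apply_eq_add hmu hlam]
      push_cast
      module
    have h3 := congrArg (C.gammaField lam).adjoint hu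
    rw [map_add] at h3
    convert h1 using 2
    rw [hf, h2, map_sub, map_smul, h3]
    module
  · have h1 := C.gammaField_apply_eq_add hlam hmu h
    have h2 := congrArg (fun T : L2E3 →L[ℂ] L2E3 => T g)
      (resolvent_identity (isBoundedInverse_freeResolvent hmu)
        (isBoundedInverse_freeResolvent hlam))
    have h3 := congrArg (freeResolvent lam) hu
    have h4 : freeResolvent lam g = freeResolvent mu g +
        ((lam - mu : ℝ) : ℂ) • freeResolvent lam (freeResolvent mu g) := by
      push_cast
      exact h2
    rw [map_add] at h3
    rw [hf, map_sub, map_smul, h3, h1, h4]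
    linear_combination (norm := module) hu

theorem deltaOp_eq {lam mu α : ℝ} (hlam : lam < 0) (hmu : mu < 0) (hα : α ≠ 0) :
    C.deltaOp lam α = C.deltaOp mu α := by
  apply LinearPMap.eq_of_eq_graph
  ext ⟨u, f⟩
  rw [mem_graph_deltaOp, mem_graph_deltaOp]
  exact ⟨fun h => h.change_parameter hmu hlam hα, fun h => h.change_parameter hlam hmu hα⟩

theorem mem_graph_subScalar_deltaOp {lam mu α : ℝ} (hlam : lam < 0) (hmu : mu < 0) (hα : α ≠ 0)
    {u f : L2E3} : (u, f) ∈ (subScalar (C.deltaOp mu α) lam).graph ↔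
      ∃ h : C.L2, (h, (C.gammaField lam).adjoint f) ∈
        (scalarSub (α : ℂ) (C.traceOpClosure lam)).graph ∧
      u = freeResolvent lam f + C.gammaField lam h := by
  rw [mem_graph_subScalar, C.deltaOp_eq hmu hlam hα, mem_graph_deltaOp,
    C.isDeltaAction_iff hlam hα, add_sub_cancel_right]

/-- The resolvent formula. -/
theorem isBoundedInverse_deltaOp {lam mu α : ℝ} (hlam : lam < 0) (hmu : mu < 0) (hα : α ≠ 0)
    {Q : C.L2 →L[ℂ] C.L2} (hQ : IsBoundedInverse (scalarSub (α : ℂ) (C.traceOpClosure lam)) Q) :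
    IsBoundedInverse (subScalar (C.deltaOp mu α) lam)
      (freeResolvent lam + C.gammaField lam ∘L Q ∘L (C.gammaField lam).adjoint) := by
  intro u f
  rw [C.mem_graph_subScalar_deltaOp hlam hmu hα]
  constructor
  · rintro ⟨h, hh, hu⟩
    rw [hQ] at hh
    rw [hu, hh]
    rfl
  · exact fun hu => ⟨_, (hQ _ _).2 rfl, hu⟩

theorem mem_kernel_subScalar_deltaOp {lam mu α : ℝ} (hlam : lam < 0) (hmu : mu < 0) (hα : α ≠ 0)
    {u : L2E3} : u ∈ kernel (subScalar (C.deltaOp mu α) lam) ↔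
      ∃ h ∈ kernel (scalarSub (α : ℂ) (C.traceOpClosure lam)), u = C.gammaField lam h := by
  simp only [mem_kernel, C.mem_graph_subScalar_deltaOp hlam hmu hα, map_zero, zero_add]

theorem isCompactOperator_gammaField_comp {lam : ℝ} (hlam : lam < 0) (Q : C.L2 →L[ℂ] C.L2) :
    IsCompactOperator (C.gammaField lam ∘L Q ∘L (C.gammaField lam).adjoint) :=
  (C.isCompactOperator_adjoint_gammaField hlam).clm_comp (C.gammaField lam ∘L Q)

/-- For λ negative enough B_λ ≤ β < α, so α - B_λ is invertible after closure. This one real point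
with a selfadjoint resolvent is what selfadjointness, compactness and the essential spectrum rest
on; λ need not be the parameter μ that defines the operator. -/
theorem exists_isBoundedInverse_deltaOp {mu α : ℝ} (hmu : mu < 0) (hα : α ≠ 0) :
    ∃ lam < 0, ∃ Q : C.L2 →L[ℂ] C.L2, IsSelfAdjoint Q ∧
      IsBoundedInverse (scalarSub (α : ℂ) (C.traceOpClosure lam)) Q ∧
      IsBoundedInverse (subScalar (C.deltaOp mu α) (lam : ℝ))
        (freeResolvent lam + C.gammaField lam ∘L Q ∘L (C.gammaField lam).adjoint) := by
  obtain ⟨lam, hlam, β, hβα, hβ⟩ := C.exists_lam_forall_potentialOne_le α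
  obtain ⟨Q, hQ, -, hQs⟩ := exists_isBoundedInverse_scalarSub (C.isSelfAdjoint_traceOpClosure lam)
    (C.re_inner_traceOpClosure_le hβ) hβα
  exact ⟨lam, hlam, Q, hQs, hQ, C.isBoundedInverse_deltaOp hlam hmu hα hQ⟩

theorem isClosed_kernel_scalarSub (lam : ℝ) (z : ℂ) :
    IsClosed (kernel (scalarSub z (C.traceOpClosure lam)) : Set C.L2) := by
  have h1 : IsClosed ((C.traceOpClosure lam).graph : Set (C.L2 × C.L2)) := by
    rw [traceOpClosure_graph]
    exact Submodule.isClosed_topologicalClosure _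
  have h2 : (kernel (scalarSub z (C.traceOpClosure lam)) : Set C.L2) =
      (fun h : C.L2 => (h, z • h)) ⁻¹' (C.traceOpClosure lam).graph := by
    ext h
    rw [SetLike.mem_coe, mem_kernel, mem_graph_scalarSub, sub_zero]
    rfl
  rw [h2]
  exact h1.preimage (by fun_prop)

theorem kernel_eq_bot_iff {lam mu α : ℝ} (hlam : lam < 0) (hmu : mu < 0) (hα : α ≠ 0) :
    kernel (subScalar (C.deltaOp mu α) lam) = ⊥ ↔
      kernel (scalarSub (α : ℂ) (C.traceOpClosure lam)) = ⊥ := by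
  rw [Submodule.eq_bot_iff, Submodule.eq_bot_iff]
  constructor
  · exact fun h k hk => C.gammaField_injective hlam
      (h _ ((C.mem_kernel_subScalar_deltaOp hlam hmu hα).2 ⟨k, hk, rfl⟩))
  · intro h u hu
    obtain ⟨k, hk, rfl⟩ := (C.mem_kernel_subScalar_deltaOp hlam hmu hα).1 hu
    rw [h k hk, map_zero]

/-- Both kernels are closed, hence complete, so the bounded bijection between them has a bounded
inverse by the open mapping theorem. -/
theorem exists_kernelEquiv {lam mu α : ℝ} (hlam : lam < 0) (hmu : mu < 0) (hα : α ≠ 0) :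
    ∃ e : kernel (scalarSub (α : ℂ) (C.traceOpClosure lam)) ≃L[ℂ]
        kernel (subScalar (C.deltaOp mu α) (lam : ℂ)),
      ∀ h, (e h : L2E3) = C.gammaField lam (h : C.L2) := by
  obtain ⟨_, _, _, _, _, hR⟩ := C.exists_isBoundedInverse_deltaOp hmu hα
  have : CompleteSpace (kernel (scalarSub (α : ℂ) (C.traceOpClosure lam))) :=
    (C.isClosed_kernel_scalarSub lam α).completeSpace_coe
  have : CompleteSpace (kernel (subScalar (C.deltaOp mu α) (lam : ℂ))) :=
    (isClosed_kernel_subScalar hR lam).completeSpace_coe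
  set G : kernel (scalarSub (α : ℂ) (C.traceOpClosure lam)) →L[ℂ]
      kernel (subScalar (C.deltaOp mu α) (lam : ℂ)) :=
    (C.gammaField lam ∘L (kernel (scalarSub (α : ℂ) (C.traceOpClosure lam))).subtypeL).codRestrict _
      fun h => (C.mem_kernel_subScalar_deltaOp hlam hmu hα).2 ⟨h, h.2, rfl⟩ with hG
  refine ⟨ContinuousLinearEquiv.ofBijective G ?_ ?_, fun h => rfl⟩
  · refine LinearMap.ker_eq_bot'.2 fun h hh => Subtype.ext (C.gammaField_injective hlam ?_)
    exact congrArg Subtype.val hh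
  · refine LinearMap.range_eq_top.2 fun u => ?_
    obtain ⟨h, hh, hu⟩ := (C.mem_kernel_subScalar_deltaOp hlam hmu hα).1 u.2
    exact ⟨⟨h, hh⟩, Subtype.ext hu.symm⟩

theorem mem_graph_traceOpClosure_iff {lam mu : ℝ} (hlam : lam < 0) (hmu : mu < 0) (h k : C.L2) :
    (h, k) ∈ (C.traceOpClosure lam).graph ↔ (h, k - (((lam - mu : ℝ) : ℂ) •
      ((C.gammaField lam).adjoint ∘L C.gammaField mu)) h) ∈ (C.traceOpClosure mu).graph := by
  constructor
  · intro hk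
    have h1 := C.traceOpClosure_graph_add hmu hlam hk
    convert h1 using 2
    -- The operator γ_λ*γ_μ is symmetric in the two parameters, so the change of parameter can be
    -- undone.
    have h2 : (C.gammaField mu).adjoint (C.gammaField lam h) =
        (C.gammaField lam).adjoint (C.gammaField mu h) := by
      rw [C.gammaField_apply_eq_add hlam hmu, map_add, map_smul,
        C.adjoint_gammaField_apply_eq_add hlam hmu]
    rw [h2]
    change k - ((lam - mu : ℝ) : ℂ) • (C.gammaField lam).adjoint (C.gammaField mu h) = _
    push_cast
    module
  · intro hk
    have h1 := C.traceOpClosure_graph_add hlam hmu hk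
    convert h1 using 2
    exact (sub_add_cancel _ _).symm

/-- The boundary operator is boundedly invertible at points of the resolvent set. -/
theorem exists_isBoundedInverse_traceOpClosure {lam mu α : ℝ} (hlam : lam < 0) (hmu : mu < 0)
    (hα : α ≠ 0) (h : (lam : ℂ) ∈ resolventSet (C.deltaOp mu α)) :
    ∃ Q, IsBoundedInverse (scalarSub (α : ℂ) (C.traceOpClosure lam)) Q := by
  obtain ⟨nu, hnu, Q, -, hQ, -⟩ := C.exists_isBoundedInverse_deltaOp hmu hα
  -- At ν the inverse is known and the boundary operators at λ and ν differ by a compact operator.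
  -- By the correspondence of kernels, injectivity of α - B at λ is that of -Δ_{Σ,α} - λ.
  refine exists_isBoundedInverse_of_kernel_eq_bot ?_ hQ
    (C.mem_graph_traceOpClosure_iff hlam hnu) ?_
  · exact ((C.isCompactOperator_adjoint_gammaField hlam).comp_clm (C.gammaField nu)).smul
      ((lam - nu : ℝ) : ℂ)
  · rw [← C.kernel_eq_bot_iff hlam hmu hα]
    exact (isBoundedInverse_resolvent h).kernel_eq_bot

/-- Only the middle factor (a - B)⁻¹ of Krein's formula depends on a, and its norm is at most 1/(a -
β). Any fixed negative λ would do; -1 is used. -/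
theorem normResolventTendsto_deltaOp {mu : ℝ} (hmu : mu < 0) :
    NormResolventTendsto (fun a : ℝ => C.deltaOp mu a) atTop freeLaplacian := by
  have hlam : (-1 : ℝ) < 0 := by norm_num
  obtain ⟨β, hβ⟩ := C.exists_forall_potentialOne_le (-1)
  have hex : ∀ a : ℝ, ∃ Q : C.L2 →L[ℂ] C.L2, β < a →
      IsBoundedInverse (scalarSub (a : ℂ) (C.traceOpClosure (-1))) Q ∧ ‖Q‖ ≤ (a - β)⁻¹ := by
    intro a
    by_cases ha : β < a
    · obtain ⟨Q, hQ, hn, -⟩ := exists_isBoundedInverse_scalarSub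
        (C.isSelfAdjoint_traceOpClosure (-1)) (C.re_inner_traceOpClosure_le hβ) ha
      exact ⟨Q, fun _ => ⟨hQ, hn⟩⟩
    · exact ⟨0, fun h => absurd h ha⟩
  choose Q hQ using hex
  have hQ0 : Tendsto Q atTop (𝓝 0) := by
    refine squeeze_zero_norm' ?_
      (tendsto_inv_atTop_zero.comp (tendsto_atTop_add_const_right atTop (-β) tendsto_id))
    filter_upwards [eventually_gt_atTop β] with a ha
    exact (hQ a ha).2
  refine normResolventTendsto_of_tendsto (z₀ := ((-1 : ℝ) : ℂ)) (R := fun a => freeResolvent (-1) +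
    C.gammaField (-1) ∘L Q a ∘L (C.gammaField (-1)).adjoint) ?_
    (isBoundedInverse_freeResolvent hlam) ?_
  · filter_upwards [eventually_gt_atTop β, eventually_ne_atTop 0] with a ha ha0
    exact C.isBoundedInverse_deltaOp hlam hmu ha0 (hQ a ha).1
  · have hc : Continuous fun T : C.L2 →L[ℂ] C.L2 => freeResolvent (-1) +
        C.gammaField (-1) ∘L T ∘L (C.gammaField (-1)).adjoint := by fun_prop
    have h1 := (hc.tendsto 0).comp hQ0
    rw [ContinuousLinearMap.zero_comp, ContinuousLinearMap.comp_zero, add_zero] at h1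
    exact h1

/-- Off [0,∞) points belong to the free resolvent set, by the Fourier multiplier or by nonzero
imaginary part, so the spectrum there is discrete. On [0,∞) the free singular sequences survive the
compact perturbation. -/
theorem essentialSpectrum_deltaOp {mu α : ℝ} (hmu : mu < 0) (hα : α ≠ 0) :
    essentialSpectrum (C.deltaOp mu α) = {z : ℂ | ∃ x : ℝ, 0 ≤ x ∧ z = (x : ℂ)} := by
  obtain ⟨lam, hlam, Q, hQs, hQ, hR⟩ := C.exists_isBoundedInverse_deltaOp hmu hα
  have hRs : IsSelfAdjoint (freeResolvent lam +
      C.gammaField lam ∘L Q ∘L (C.gammaField lam).adjoint) :=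
    (isSelfAdjoint_freeResolvent hlam).add (hQs.conj_adjoint _)
  have hR₀ := isBoundedInverse_freeResolvent hlam
  have hc : IsCompactOperator (freeResolvent lam +
      C.gammaField lam ∘L Q ∘L (C.gammaField lam).adjoint - freeResolvent lam) := by
    rw [add_sub_cancel_left]
    exact C.isCompactOperator_gammaField_comp hlam Q
  ext z
  constructor
  · rintro ⟨hz, hzd⟩
    by_contra hcon
    refine hzd (mem_discreteSpectrum (isSelfAdjoint_of_isBoundedInverse hR hRs) hR hR₀ hc hz ?_)
    by_cases him : z.im = 0
    · have hzre : z = (z.re : ℂ) := Complex.ext rfl him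
      have hneg : z.re < 0 := by
        by_contra! h
        exact hcon ⟨z.re, h, hzre⟩
      rw [hzre]
      exact ⟨_, isBoundedInverse_freeResolvent hneg⟩
    · exact mem_resolventSet_of_im_ne_zero hR₀ (isSelfAdjoint_freeResolvent hlam) him
  · rintro ⟨x, hx, rfl⟩
    obtain ⟨v, hv, hlim⟩ := exists_singular_sequence hx hlam
    exact mem_essentialSpectrum hR hRs hc hv hlim

end ClosedCurve

end

/-! ### Assembly of the main theorem -/

open UnboundedOp in
theorem theorem3p1 (C : ClosedCurve) (α : ℝ) (hα : α ≠ 0) (μ : ℝ) (hμ : μ < 0) :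
    -- the objects are well defined
    ((∀ lam : ℝ, lam < 0 → ∀ (h : C.L2) (u : L2E3), C.Solves lam h u ↔ u = C.gammaField lam h) ∧
      (∀ lam : ℝ, lam < 0 → ∀ h : C.L2,
        h ∈ (C.traceOp lam).domain ↔ ∃ f : E3 → ℂ, C.IsLipschitz f ∧ h =ᵐ[C.arcLength] f) ∧
      (∀ lam : ℝ, lam < 0 → IsSelfAdjoint (C.traceOpClosure lam)) ∧
      (∀ u ∈ sobolevH2, ∃ t : C.L2, C.IsTrace u t) ∧
      (∀ u f : L2E3, (u, f) ∈ (C.deltaOp μ α).graph ↔ C.IsDeltaAction μ α u f) ∧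
      (∀ μ' : ℝ, μ' < 0 → C.deltaOp μ' α = C.deltaOp μ α)) ∧
    -- selfadjointness
    IsSelfAdjoint (C.deltaOp μ α) ∧
    -- (i)
    (∀ lam : ℝ, lam < 0 →
      (∃ e : kernel (scalarSub (α : ℂ) (C.traceOpClosure lam)) ≃L[ℂ]
          kernel (subScalar (C.deltaOp μ α) (lam : ℂ)),
        ∀ h, (e h : L2E3) = C.gammaField lam (h : C.L2)) ∧
      ((lam : ℂ) ∈ pointSpectrum (C.deltaOp μ α) ↔
        (α : ℂ) ∈ pointSpectrum (C.traceOpClosure lam))) ∧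
    -- (ii)
    ((∃ lam : ℝ, lam < 0 ∧ (lam : ℂ) ∈ resolventSet (C.deltaOp μ α)) ∧
      (∀ lam : ℝ, lam < 0 → (lam : ℂ) ∈ resolventSet (C.deltaOp μ α) →
        (lam : ℂ) ∈ resolventSet freeLaplacian ∧
        (∃ R, IsBoundedInverse (scalarSub (α : ℂ) (C.traceOpClosure lam)) R) ∧
        resolvent (C.deltaOp μ α) (lam : ℂ) =
          resolvent freeLaplacian (lam : ℂ) +
            C.gammaField lam ∘L boundedInverse (scalarSub (α : ℂ) (C.traceOpClosure lam)) ∘L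
              ContinuousLinearMap.adjoint (C.gammaField lam)) ∧
      NormResolventTendsto (fun a : ℝ => C.deltaOp μ a) Filter.atTop freeLaplacian) ∧
    -- (iii)
    ((∀ z : ℂ, z ∈ resolventSet (C.deltaOp μ α) → z ∈ resolventSet freeLaplacian →
        IsCompactOperator (resolvent (C.deltaOp μ α) z - resolvent freeLaplacian z)) ∧
      essentialSpectrum (C.deltaOp μ α) = {z : ℂ | ∃ x : ℝ, 0 ≤ x ∧ z = (x : ℂ)}) := by
  obtain ⟨nu, hnu, Q, hQs, hQ, hR⟩ := C.exists_isBoundedInverse_deltaOp hμ hα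
  refine ⟨⟨fun lam hlam => C.solves_iff hlam, fun lam _ => C.mem_domain_traceOp_iff lam,
    fun lam _ => C.isSelfAdjoint_traceOpClosure lam, fun u hu => C.exists_isTrace hu,
    fun u f => C.mem_graph_deltaOp, fun μ' hμ' => C.deltaOp_eq hμ' hμ hα⟩,
    isSelfAdjoint_of_isBoundedInverse hR
      ((isSelfAdjoint_freeResolvent hnu).add (hQs.conj_adjoint _)),
    fun lam hlam => ⟨C.exists_kernelEquiv hlam hμ hα, ?_⟩,
    ⟨⟨nu, hnu, _, hR⟩, fun lam hlam h => ?_, C.normResolventTendsto_deltaOp hμ⟩,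
    fun z hz hz₀ => ?_, C.essentialSpectrum_deltaOp hμ hα⟩
  · change kernel _ ≠ ⊥ ↔ kernel _ ≠ ⊥
    rw [Ne, C.kernel_eq_bot_iff hlam hμ hα, kernel_scalarSub_eq]
  · have hR₀ := isBoundedInverse_freeResolvent hlam
    obtain ⟨Q', hQ'⟩ := C.exists_isBoundedInverse_traceOpClosure hlam hμ hα h
    refine ⟨⟨_, hR₀⟩, ⟨Q', hQ'⟩, ?_⟩
    rw [hR₀.resolvent_eq, hQ'.boundedInverse_eq]
    exact (C.isBoundedInverse_deltaOp hlam hμ hα hQ').resolvent_eq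
  · refine isCompactOperator_resolvent_sub hR (isBoundedInverse_freeResolvent hnu)
      (isBoundedInverse_resolvent hz) (isBoundedInverse_resolvent hz₀) ?_
    rw [add_sub_cancel_left]
    exact C.isCompactOperator_gammaField_comp hnu Q
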